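/- Let $K$ be a local field of characteristic $p$, i.e. a field complete with respect to a normalized discrete valuation $v_K$, with perfect residue field $\mathbb F$; then $K\cong\mathbb F((t))$ and we regard $\mathbb F\subset K$. Let $L/K$ be a totally ramified Galois extension with group $G\cong C_p^2$ and normalized valuation $v_L$ on $L$, having a single (lower) ramification break $b>0$. *Artin–Schreier data.* Let $\beta\in K$, $\omega_1,\omega_2\in\mathbb F$, $\epsilon_1,\epsilon_2\in K$ be Artin–Schreier data for $L/K$: setting $\alpha_i=\omega_i^{p^2}\beta+\epsilon_i$, the field $L$ is generated over $K$ by roots $x_i$ of $X^p-X-\alpha_i$ $(i=1,2)$; $v_K(\beta)=v_K(\alpha_i)=-b<v_K(\epsilon_i)$; and for each $i$ either $v_K(\epsilon_i)<0$ and $p\nmid v_K(\epsilon_i)$, or $\epsilon_i\in\mathbb F$. Assume $\omega_1=1$ and $\epsilon_1=0$. Put $e_2=-v_K(\epsilon_2)$ (so $e_2=-\infty$ if $\epsilon_2=0$) and $$b_*=\min\{(b-e_2)p+b,\;bp\}.$$ *Refined breaks.* Let $R=\mathbb F[G]$, acting on $L$ by $\left(\sum c_\sigma\sigma\right)(x)=\sum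 c_\sigma\sigma(x)$, and let $A$ be its augmentation ideal. For $\gamma\in 1+A$ and $\omega\in\mathbb F$ put $\gamma^{[\omega]}=\sum_{i=0}^{p-1}\binom{\omega}{i}(\gamma-1)^i$. For $2\le k\le p$, the group $(1+A)/(1+A^k)$, viewed inside $R/A^k$, is an $\mathbb F$-vector space with scalar multiplication $\omega\cdot\bar\gamma=\overline{\gamma^{[\omega]}}$; let $\bar G^{[\mathbb F]}$ be the $\mathbb F$-span of the image of $G$. For $\rho\in L^\times$ with $v_L(\rho)\equiv b\pmod{p^2}$ (a valuation criterion element) and $\bar\gamma\in\bar G^{[\mathbb F]}$ let $i_\rho(\bar\gamma)=\max\{v_L((\gamma'-1)(\rho)):\gamma'\in\bar\gamma\}$ and $B_{\rho,k}=\{i_\rho(\bar\gamma)-v_L(\rho):\bar\gamma\in\bar G^{[\mathbb F]},\ \bar\gamma\ne\bar 1\}$. If $B_{\rho,k}$ is the same for all such $\rho$, the VC$_k$-refined breaks of $L/K$ are said to be defined, and they are the elements of this common set. For $\gamma\in R$ let $\hat v_L(\gamma)=\min\{v_L(\gamma(x))-v_L(x):x\in L^\times\}$, and for $\bar\gamma\in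 R/A^k$ let $\hat v_L(\bar\gamma)=\max\{\hat v_L(\gamma'):\gamma'\in\bar\gamma\}$. For integers $h\ge0$ let $\bar G^{[\mathbb F]}_h=\{\bar\gamma\in\bar G^{[\mathbb F]}:\hat v_L(\bar\gamma-\bar1)\ge h\}$. The SS$_k$-refined breaks of $L/K$ are the integers $h\ge0$ with $\bar G^{[\mathbb F]}_{h+1}\ne\bar G^{[\mathbb F]}_h$. *Statement.* For every $k$ with $2\le k\le p$, the set of VC$_k$-refined breaks of $L/K$ is defined and equal to $\{b,b_*\}$, and the set of SS$_k$-refined breaks of $L/K$ is equal to $\{b,b_*\}$. -/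

import Mathlib

/-! ## Local fields of characteristic `p`, ramification, Artin-Schreier data -/

/-- `K` is complete with respect to the normalized discrete valuation `vK`, and `F ⊆ K` is a field
of representatives for the residue field, so that the residue field of `K` is identified with `F`
(for `K` of characteristic `p` with perfect residue field this says `K ≅ F((t))`). -/
structure IsLocalFieldOver (F : Type*) {K : Type*} [Field F] [Field K] [Algebra F K]
    (vK : AddValuation K (WithTop ℤ)) : Prop where
  normalized : ∃ t : K, vK t = 1
  complete : ∀ u : ℕ → K,
    (∀ N : ℤ, ∃ m, ∀ i, m ≤ i → ∀ j, m ≤ j → (N : WithTop ℤ) ≤ vK (u i - u j)) →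
      ∃ l : K, ∀ N : ℤ, ∃ m, ∀ i, m ≤ i → (N : WithTop ℤ) ≤ vK (u i - l)
  coeff_integral : ∀ a : F, 0 ≤ vK (algebraMap F K a)
  coeff_residue : ∀ x : K, 0 ≤ vK x → ∃! a : F, 0 < vK (x - algebraMap F K a)

/-- The lower ramification group `G_i = {σ : v_L(σ x - x) ≥ i + 1 for all x ∈ O_L}`. -/
def lowerRamificationGroup {K L : Type*} [Field K] [Field L] [Algebra K L]
    (vL : AddValuation L (WithTop ℤ)) (i : ℤ) : Set (L ≃ₐ[K] L) :=
  {σ | ∀ x : L, 0 ≤ vL x → ((i + 1 : ℤ) : WithTop ℤ) ≤ vL (σ x - x)}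

/-- The set of lower ramification breaks of `L/K`. -/
def lowerRamificationBreaks (K : Type*) {L : Type*} [Field K] [Field L] [Algebra K L]
    (vL : AddValuation L (WithTop ℤ)) : Set ℤ :=
  {i | -1 ≤ i ∧ lowerRamificationGroup (K := K) vL i ≠ lowerRamificationGroup (K := K) vL (i + 1)}

/-- `L/K` is a totally ramified `C_p^n`-extension, `vL` is the normalized valuation of `L`,
and `b` is the only ramification break of `L/K`. -/
structure IsOneBreakExtension (p n : ℕ) {K L : Type*} [Field K] [Field L] [Algebra K L]
    (vK : AddValuation K (WithTop ℤ)) (vL : AddValuation L (WithTop ℤ)) (b : ℤ) : Prop where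
  finite : FiniteDimensional K L
  galois : IsGalois K L
  elementary : Nonempty ((L ≃ₐ[K] L) ≃* Multiplicative (Fin n → ZMod p))
  normalized : ∃ π : L, vL π = 1
  totally_ramified : ∀ x : K, vL (algebraMap K L x) = Module.finrank K L • vK x
  breaks : lowerRamificationBreaks K vL = {b}

/-- `(β, ω, ε)` is Artin-Schreier data for the `C_p^n`-extension `L/K` with single break `b`:
`L` is the compositum of the splitting fields of `X^p - X - α_i`,
where `α_i = ω_i^(p^n) β + ε_i`. -/
structure IsArtinSchreierData (p n : ℕ) {F K : Type*} (L : Type*) [Field F] [Field K] [Field L]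
    [Algebra F K] [Algebra K L] (vK : AddValuation K (WithTop ℤ)) (b : ℤ)
    (β : K) (ω : Fin n → F) (ε : Fin n → K) : Prop where
  val_beta : vK β = ((-b : ℤ) : WithTop ℤ)
  val_alpha : ∀ i, vK (algebraMap F K (ω i) ^ p ^ n * β + ε i) = ((-b : ℤ) : WithTop ℤ)
  val_eps : ∀ i, ((-b : ℤ) : WithTop ℤ) < vK (ε i)
  reduced : ∀ i, (∃ m : ℤ, vK (ε i) = (m : WithTop ℤ) ∧ m < 0 ∧ ¬ (p : ℤ) ∣ m) ∨
    ε i ∈ Set.range (algebraMap F K)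
  generates : ∃ x : Fin n → L,
    (∀ i, x i ^ p - x i = algebraMap K L (algebraMap F K (ω i) ^ p ^ n * β + ε i)) ∧
      IntermediateField.adjoin K (Set.range x) = ⊤

/-! ## The group ring `R = F[G]`, truncated powers and refined breaks -/

section RefinedBreaks

variable (F K L : Type*) [Field F] [Field K] [Field L] [Algebra F K] [Algebra K L]

/-- The group ring `R = F[G]`, `G = Gal(L/K)`. -/
abbrev GalRing : Type _ := MonoidAlgebra F (L ≃ₐ[K] L)

/-- The augmentation ideal `A` of `R = F[G]`. -/
noncomputable abbrev augIdeal : Ideal (GalRing F K L) :=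
  RingHom.ker (MonoidAlgebra.lift F F (L ≃ₐ[K] L) (1 : (L ≃ₐ[K] L) →* F))

/-- The quotient ring `R / A^k`. -/
abbrev GalQuot (k : ℕ) : Type _ := GalRing F K L ⧸ (augIdeal F K L) ^ k

variable {F K L}

/-- The class of `γ ∈ R` in `R / A^k`. -/
noncomputable def GalQuot.mk (k : ℕ) (γ : GalRing F K L) : GalQuot F K L k :=
  Ideal.Quotient.mk ((augIdeal F K L) ^ k) γ

/-- The action of `γ = ∑ c_σ σ ∈ F[G]` on `L`: `γ(x) = ∑ c_σ σ(x)`. -/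
noncomputable def galAct (γ : GalRing F K L) (x : L) : L :=
  γ.coeff.sum fun σ c => algebraMap K L (algebraMap F K c) * σ x

/-- The binomial coefficient `w (w - 1) ⋯ (w - (i - 1)) / i!` for `w ∈ F`
(used only for `i < p = char F`). -/
def fieldBinom (w : F) (i : ℕ) : F :=
  (∏ j ∈ Finset.range i, (w - (j : F))) / (i.factorial : F)

/-- The truncated power `γ^[w] = ∑_{i < p} (w choose i) (γ - 1)^i`. -/
noncomputable def truncPow (p : ℕ) (γ : GalRing F K L) (w : F) : GalRing F K L :=
  ∑ i ∈ Finset.range p, fieldBinom w i • (γ - 1) ^ i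

/-- The `F`-span of the image of `G` in `(1 + A)/(1 + A^k) ⊆ R / A^k`, which is an `F`-vector space
with multiplication as its vector addition and truncated powers as its scalar multiplication:
the smallest subset that contains the image of `G` and is closed under these two operations. -/
inductive InGalSpan (p k : ℕ) : GalQuot F K L k → Prop
  | of (σ : L ≃ₐ[K] L) : InGalSpan p k (GalQuot.mk k (MonoidAlgebra.of F (L ≃ₐ[K] L) σ))
  | mul {x y : GalQuot F K L k} : InGalSpan p k x → InGalSpan p k y → InGalSpan p k (x * y)
  | pow (γ : GalRing F K L) (w : F) : InGalSpan p k (GalQuot.mk k γ) →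
      InGalSpan p k (GalQuot.mk k (truncPow p γ w))

/-- `i_ρ(γ̄) = max {v_L((γ' - 1)(ρ)) : γ' ∈ γ̄}`. -/
noncomputable def iRho (vL : AddValuation L (WithTop ℤ)) (k : ℕ) (ρ : L)
    (g : GalQuot F K L k) : WithTop ℤ :=
  sSup {d | ∃ γ : GalRing F K L, GalQuot.mk k γ = g ∧ d = vL (galAct (γ - 1) ρ)}

variable (F K) in
/-- The set `B_{ρ,k}` of `(ρ,k)`-refined breaks of `L/K`. -/
noncomputable def rhoRefinedBreaks (p : ℕ) (vL : AddValuation L (WithTop ℤ)) (k : ℕ) (ρ : L) :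
    Set (WithTop ℤ) :=
  {h | ∃ g : GalQuot F K L k, InGalSpan p k g ∧ g ≠ 1 ∧ h = iRho vL k ρ g - vL ρ}

/-- `ρ` is a valuation criterion element: `v_L(ρ) ≡ b (mod p^n)`. -/
def IsValuationCriterion (p n : ℕ) (vL : AddValuation L (WithTop ℤ)) (b : ℤ) (ρ : L) : Prop :=
  ∃ m : ℤ, vL ρ = (m : WithTop ℤ) ∧ m ≡ b [ZMOD ((p : ℤ) ^ n)]

variable (F K) in
/-- The `VC_k`-refined breaks of `L/K` are defined, and `B` is the set of them. -/
def HasVCRefinedBreaks (p n : ℕ) (vL : AddValuation L (WithTop ℤ)) (b : ℤ) (k : ℕ)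
    (B : Set (WithTop ℤ)) : Prop :=
  (∃ ρ : L, IsValuationCriterion p n vL b ρ) ∧
    ∀ ρ : L, IsValuationCriterion p n vL b ρ → rhoRefinedBreaks F K p vL k ρ = B

/-- `v̂_L(γ) = min {v_L(γ(x)) - v_L(x) : x ∈ L^×}` for `γ ∈ R`. -/
noncomputable def vHat (vL : AddValuation L (WithTop ℤ)) (γ : GalRing F K L) : WithTop ℤ :=
  sInf {d | ∃ x : L, x ≠ 0 ∧ d = vL (galAct γ x) - vL x}

/-- `v̂_L(γ̄) = max {v̂_L(γ') : γ' ∈ γ̄}` for `γ̄ ∈ R / A^k`. -/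
noncomputable def vHatQuot (vL : AddValuation L (WithTop ℤ)) (k : ℕ)
    (g : GalQuot F K L k) : WithTop ℤ :=
  sSup {d | ∃ γ : GalRing F K L, GalQuot.mk k γ = g ∧ d = vHat vL γ}

variable (F K) in
/-- The filtration step: all `γ̄` in the `F`-span of `G` with `v̂_L(γ̄ - 1) ≥ h`. -/
def galSpanFiltration (p : ℕ) (vL : AddValuation L (WithTop ℤ)) (k : ℕ) (h : ℕ) :
    Set (GalQuot F K L k) :=
  {g | InGalSpan p k g ∧ ((h : ℤ) : WithTop ℤ) ≤ vHatQuot vL k (g - 1)}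

variable (F K) in
/-- The set of `SS_k`-refined breaks of `L/K`. -/
def ssRefinedBreaks (p : ℕ) (vL : AddValuation L (WithTop ℤ)) (k : ℕ) : Set (WithTop ℤ) :=
  {d | ∃ h : ℕ, d = ((h : ℤ) : WithTop ℤ) ∧
    galSpanFiltration F K p vL k (h + 1) ≠ galSpanFiltration F K p vL k h}

end RefinedBreaks

/-- `b_* = min {(b - e) p + b, b p}` where `e = -v_K(ε)`; for `ε = 0` one has `v_K(ε) = ∞`,
that is `e = -∞`, and `b_* = b p`. -/
def bStar (p : ℕ) {K : Type*} [Field K] (vK : AddValuation K (WithTop ℤ)) (b : ℤ) (ε : K) :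
    WithTop ℤ :=
  min (p • ((b : WithTop ℤ) + vK ε) + (b : WithTop ℤ)) ((b * p : ℤ) : WithTop ℤ)

/-!
The proof constructs an element of the group ring that raises valuations by exactly `b_*` and that
generates the `F`-span of `G` together with an ordinary automorphism, which raises them by `b`.

Let `x₁`, `x₂` be the Artin-Schreier generators and `σ₁`, `σ₂` the dual generators of `G`.
A nontrivial `σ ∈ G` raises valuations by at least `b`, and by exactly `b` on elements of valuation
prime to `p` (`IsOneBreakExtension.val_gal_sub`); as `(σ - 1) ^ p = 0`, this forces `p ∤ b`
(`IsOneBreakExtension.not_dvd_break`).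

Write `w = ω ^ p`, where `ω` is the second coefficient. As `F` is perfect and `v_K(β) = -b` is prime
to `p`, the error term `ε` of the second equation is close to a `p`-th power `E ^ p` with
`E ∈ K(x₁)` (`IsOneBreakExtension.exists_approx_eq`). Removing from `x₂` the `p`-th root of
the dominant term of `x₂ ^ p` leaves `X = x₂ - w x₁ - E` of valuation exactly `-b`
(`IsArtinSchreierData.exists_generator`); this uses that `ω` is not in the prime field, which again
is a consequence of the single break (`IsArtinSchreierData.coeff_pow_ne`). The Galois group acts by
`σ₂ X = X + 1` and `σ₁ X = X - w - μ`, where `μ = σ₁ E - E` is small.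

The elements `x₁ ^ j (X choose i)` with `i, j < p` have valuations that are distinct modulo `p ^ 2`.
By Vandermonde's identity the truncated power `σ₂^[w]` translates `X` by `w`, so `τ = σ₁ σ₂^[w]`
maps `x₁ ^ j (X choose i)` to `(x₁ + 1) ^ j (X - μ choose i)`
(`IsScaffold.scaffoldOperator_apply`). The translation of `x₁` contributes `b p` and the one of `X`
contributes `v(μ) + b`; the smaller of the two is `b_*`. Hence `Θ = τ - 1` raises all valuations by
at least `b_*`, with equality on valuation criterion elements, whose leading term has
`i = j = p - 1` (`IsScaffold.val_scaffoldOperator_sub`).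

On the algebraic side, each class in the `F`-span of `G` is that of some `τ^[u] σ₂^[v]`
(`InGalSpan.exists_eq`). The rules for truncated powers modulo `A ^ k` with `k ≤ p` are polynomial
identities of degree less than `p` in the exponents, so they need to be checked only for natural
numbers (`IsReesFunction.eq_of_natCast`). With `Ψ = σ₂ - 1` one has `A ^ 2 = Ψ ^ 2 F[Ψ] + Θ A`
(`augIdeal_normal_form`). Thus every representative of the class of `τ^[u] σ₂^[v]` is
`1 + v Ψ + u Θ + Ψ ^ 2 f(Ψ) + Θ a` with `a ∈ A`. If `v ≠ 0`, the term `v Ψ` dominates and the value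
of the class is `b`. If `v = 0` and `u ≠ 0`, the value is `b_*`: on a valuation criterion element
`Ψ ^ 2 f(Ψ)` gives a valuation raised by `i b` with `2 ≤ i < p`, which is never `b_*` because
`b_*` is `b p` or congruent to `b` modulo `p`, so no cancellation with `u Θ` is possible
(`IsScaffold.hasRefinedValue_scaffoldElement`).
-/

/-! ### Integer-valued estimates for additive valuations -/

section Valuation

variable {L : Type*} [Field L] {v : AddValuation L (WithTop ℤ)} {x y : L} {m n : ℤ}

theorem exists_val_eq (v : AddValuation L (WithTop ℤ)) (hx : x ≠ 0) :
    ∃ m : ℤ, v x = (m : WithTop ℤ) := by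
  obtain ⟨m, hm⟩ := WithTop.ne_top_iff_exists.1 ((AddValuation.ne_top_iff v).2 hx)
  exact ⟨m, hm.symm⟩

theorem ne_zero_of_val_eq (hx : v x = (m : WithTop ℤ)) : x ≠ 0 := by
  rintro rfl
  simp at hx

theorem val_mul_eq (hx : v x = (m : WithTop ℤ)) (hy : v y = (n : WithTop ℤ)) :
    v (x * y) = ((m + n : ℤ) : WithTop ℤ) := by
  rw [AddValuation.map_mul, hx, hy]; rfl

theorem le_val_mul (hx : (m : WithTop ℤ) ≤ v x) (hy : (n : WithTop ℤ) ≤ v y) :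
    ((m + n : ℤ) : WithTop ℤ) ≤ v (x * y) := by
  rw [AddValuation.map_mul, WithTop.coe_add]
  exact add_le_add hx hy

theorem val_pow_eq (hx : v x = (m : WithTop ℤ)) (k : ℕ) :
    v (x ^ k) = ((k * m : ℤ) : WithTop ℤ) := by
  induction k with
  | zero => simp
  | succ k ih =>
    rw [pow_succ, val_mul_eq ih hx]
    congr 1; push_cast; ring

theorem le_val_pow (hx : (m : WithTop ℤ) ≤ v x) (k : ℕ) :
    ((k * m : ℤ) : WithTop ℤ) ≤ v (x ^ k) := by
  induction k with
  | zero => simp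
  | succ k ih =>
    rw [pow_succ]
    refine le_of_eq_of_le ?_ (le_val_mul ih hx)
    congr 1; push_cast; ring

theorem val_inv_eq (hx : v x = (m : WithTop ℤ)) : v x⁻¹ = ((-m : ℤ) : WithTop ℤ) := by
  rw [AddValuation.map_inv, hx]; rfl

theorem le_val_of_le (hx : (n : WithTop ℤ) ≤ v x) (h : m ≤ n) : (m : WithTop ℤ) ≤ v x :=
  le_trans (WithTop.coe_le_coe.2 h) hx

theorem le_val_of_eq (hx : v x = (n : WithTop ℤ)) (h : m ≤ n) : (m : WithTop ℤ) ≤ v x :=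
  le_val_of_le hx.ge h

theorem le_of_le_val (hx : v x = (n : WithTop ℤ)) (h : (m : WithTop ℤ) ≤ v x) : m ≤ n :=
  WithTop.coe_le_coe.1 (hx ▸ h)

theorem val_unique (hx : v x = (n : WithTop ℤ)) (h : v x = (m : WithTop ℤ)) : m = n :=
  WithTop.coe_injective (h.symm.trans hx)

theorem val_add_eq (hx : v x = (m : WithTop ℤ)) (hy : (n : WithTop ℤ) ≤ v y) (h : m < n) :
    v (x + y) = (m : WithTop ℤ) := by
  rw [AddValuation.map_add_eq_of_lt_left, hx]
  exact hx ▸ lt_of_lt_of_le (WithTop.coe_lt_coe.2 h) hy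

theorem val_sub_eq (hx : v x = (m : WithTop ℤ)) (hy : (n : WithTop ℤ) ≤ v y) (h : m < n) :
    v (x - y) = (m : WithTop ℤ) := by
  rw [sub_eq_add_neg]
  exact val_add_eq hx (by rwa [AddValuation.map_neg]) h

theorem val_neg_eq (hx : v x = (m : WithTop ℤ)) : v (-x) = (m : WithTop ℤ) := by
  rwa [AddValuation.map_neg]

theorem lt_val_iff : (m : WithTop ℤ) < v x ↔ ((m + 1 : ℤ) : WithTop ℤ) ≤ v x := by
  by_cases hx : x = 0
  · subst hx; simp [-WithTop.coe_add]
  · obtain ⟨n, hn⟩ := exists_val_eq v hx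
    rw [hn, WithTop.coe_lt_coe, WithTop.coe_le_coe]; rfl

theorem val_natCast_nonneg (v : AddValuation L (WithTop ℤ)) (k : ℕ) :
    ((0 : ℤ) : WithTop ℤ) ≤ v (k : L) := by
  induction k with
  | zero => simp
  | succ k ih =>
    rw [Nat.cast_succ]
    exact AddValuation.map_le_add v ih (by simp)

theorem le_val_natCast_mul (k : ℕ) (hx : (m : WithTop ℤ) ≤ v x) :
    (m : WithTop ℤ) ≤ v (k * x) := by
  simpa using le_val_mul (val_natCast_nonneg v k) hx

theorem val_natCast_eq_zero (v : AddValuation L (WithTop ℤ)) (p : ℕ) [Fact p.Prime] [CharP L p]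
    {k : ℕ} (hk : ¬ p ∣ k) : v (k : L) = ((0 : ℤ) : WithTop ℤ) := by
  have hk0 : (k : L) ≠ 0 := fun h => hk ((CharP.cast_eq_zero_iff L p k).1 h)
  obtain ⟨m, hm⟩ := exists_val_eq v hk0
  have hz : ((k : ZMod p)) ≠ 0 := fun h => hk ((ZMod.natCast_eq_zero_iff k p).1 h)
  have h1 : ((k ^ (p - 1) : ℕ) : L) = 1 := by
    have := ZMod.pow_card_sub_one_eq_one hz
    rw [← Nat.cast_pow, ← Nat.cast_one (R := ZMod p), ZMod.natCast_eq_natCast_iff] at this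
    rw [← Nat.cast_one (R := L)]
    exact (CharP.natCast_eq_natCast L p).2 this
  have h2 := val_pow_eq hm (p - 1)
  rw [← Nat.cast_pow, h1, AddValuation.map_one] at h2
  have h3 : ((p - 1 : ℕ) : ℤ) * m = 0 := (WithTop.coe_injective h2).symm
  have hp : ((p - 1 : ℕ) : ℤ) ≠ 0 := by
    have := (Fact.out : p.Prime).two_le
    omega
  rw [hm, (mul_eq_zero.1 h3).resolve_left hp]

/-- A small additive change `B` of `A` changes `A ^ (k + 1)` at most by `v(B) + k v(A)`. -/
theorem le_val_add_pow_sub_pow {A B : L} {a c : ℤ} (hA : (a : WithTop ℤ) ≤ v A)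
    (hB : (c : WithTop ℤ) ≤ v B) (hac : a ≤ c) (k : ℕ) :
    ((c + k * a : ℤ) : WithTop ℤ) ≤ v ((A + B) ^ (k + 1) - A ^ (k + 1)) := by
  induction k with
  | zero => simpa using hB
  | succ k ih =>
    have h : (A + B) ^ (k + 1 + 1) - A ^ (k + 1 + 1)
        = (A + B) * ((A + B) ^ (k + 1) - A ^ (k + 1)) + B * A ^ (k + 1) := by ring
    rw [h]
    refine AddValuation.map_le_add v ?_ ?_
    · refine le_of_eq_of_le ?_
        (le_val_mul (AddValuation.map_le_add v hA (le_val_of_le hB hac)) ih)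
      congr 1; push_cast; ring
    · refine le_of_eq_of_le ?_ (le_val_mul hB (le_val_pow hA (k + 1)))
      congr 1

/-- The first order term of `(A + B) ^ (k + 1) - A ^ (k + 1)` dominates. -/
theorem val_add_pow_sub_pow {A B : L} {a c : ℤ} (hA : v A = (a : WithTop ℤ))
    (hB : v B = (c : WithTop ℤ)) (hac : a < c) (k : ℕ)
    (hk : v ((k + 1 : ℕ) : L) = ((0 : ℤ) : WithTop ℤ)) :
    v ((A + B) ^ (k + 1) - A ^ (k + 1)) = ((c + k * a : ℤ) : WithTop ℤ) := by
  have key : ∀ k : ℕ, ((c + k * a + 1 : ℤ) : WithTop ℤ) ≤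
      v ((A + B) ^ (k + 1) - A ^ (k + 1) - (k + 1 : ℕ) * (A ^ k * B)) := by
    intro k
    induction k with
    | zero => simp
    | succ k ih =>
      have h : (A + B) ^ (k + 1 + 1) - A ^ (k + 1 + 1) - (k + 1 + 1 : ℕ) * (A ^ (k + 1) * B)
          = (A + B) * ((A + B) ^ (k + 1) - A ^ (k + 1) - (k + 1 : ℕ) * (A ^ k * B))
            + (k + 1 : ℕ) * (A ^ k * (B * B)) := by push_cast; ring
      rw [h]
      refine AddValuation.map_le_add v ?_ (le_val_natCast_mul _ ?_)
      · refine le_of_eq_of_le ?_ (le_val_mul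
          (AddValuation.map_le_add v hA.ge (le_val_of_eq hB hac.le)) ih)
        congr 1; push_cast; ring
      · refine le_val_of_eq (val_mul_eq (val_pow_eq hA k) (val_mul_eq hB hB)) ?_
        push_cast; linarith
  have h1 := val_mul_eq hk (val_mul_eq (val_pow_eq hA k) hB)
  have h2 := val_add_eq h1 (key k) (by linarith)
  rw [show (A + B) ^ (k + 1) - A ^ (k + 1) = ((k + 1 : ℕ) : L) * (A ^ k * B) +
    ((A + B) ^ (k + 1) - A ^ (k + 1) - (k + 1 : ℕ) * (A ^ k * B)) by ring, h2]
  congr 1; ring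

/-- If the nonzero terms of a finite sum have distinct valuations, then exactly one term has the
valuation of the sum, and the other terms are smaller. -/
theorem exists_val_sum_eq {ι : Type*} [Fintype ι] (f : ι → L)
    (hd : ∀ i j, i ≠ j → f i ≠ 0 → v (f i) ≠ v (f j)) (hne : ∃ i, f i ≠ 0) :
    ∃ i, f i ≠ 0 ∧ v (∑ j, f j) = v (f i) ∧ ∀ j, j ≠ i → v (f i) < v (f j) := by
  classical
  obtain ⟨i₁, hi₁⟩ := hne
  have : Nonempty ι := ⟨i₁⟩
  obtain ⟨i, hi⟩ := Finite.exists_min fun i => v (f i)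
  have hfi : f i ≠ 0 := by
    rw [← AddValuation.ne_top_iff v]
    exact ne_top_of_le_ne_top ((AddValuation.ne_top_iff v).2 hi₁) (hi i₁)
  have hlt : ∀ j, j ≠ i → v (f i) < v (f j) := fun j hj =>
    lt_of_le_of_ne (hi j) (hd i j hj.symm hfi)
  refine ⟨i, hfi, ?_, hlt⟩
  rw [← Finset.add_sum_erase _ _ (Finset.mem_univ i)]
  exact AddValuation.map_add_eq_of_lt_left v (AddValuation.map_lt_sum v
    ((AddValuation.ne_top_iff v).2 hfi) fun j hj => hlt j (Finset.ne_of_mem_erase hj))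

end Valuation

/-! ### Bases with distinct valuations and operators that shift the valuation -/

section ValuationBasis

variable {K L : Type*} [Field K] [Field L] [Algebra K L]

/-- `e` is a `K`-basis of `L` whose members have valuations `d i` that are pairwise incongruent
modulo `N`, where `N` is the ramification index of `L/K`. -/
structure IsValuationBasis (vL : AddValuation L (WithTop ℤ)) (N : ℤ) {ι : Type*} [Fintype ι]
    (K : Type*) [Field K] [Algebra K L] (e : ι → L) (d : ι → ℤ) : Prop where
  val_base : ∀ c : K, c ≠ 0 → ∃ m : ℤ, vL (algebraMap K L c) = ((N * m : ℤ) : WithTop ℤ)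
  val_eq : ∀ i, vL (e i) = (d i : WithTop ℤ)
  incongruent : ∀ i j, N ∣ d i - d j → i = j
  card_eq : Fintype.card ι = Module.finrank K L

variable {vL : AddValuation L (WithTop ℤ)} {N : ℤ} {ι : Type*} [Fintype ι]
  {e : ι → L} {d : ι → ℤ}

namespace IsValuationBasis

theorem val_ne (h : IsValuationBasis vL N K e d) (c : ι → K) (i j : ι) (hij : i ≠ j)
    (hi : algebraMap K L (c i) * e i ≠ 0) :
    vL (algebraMap K L (c i) * e i) ≠ vL (algebraMap K L (c j) * e j) := by
  intro heq
  have hj : algebraMap K L (c j) * e j ≠ 0 := by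
    rw [← AddValuation.ne_top_iff vL, ← heq, AddValuation.ne_top_iff]; exact hi
  obtain ⟨m, hm⟩ := h.val_base (c i) (by rintro h0; simp [h0] at hi)
  obtain ⟨n, hn⟩ := h.val_base (c j) (by rintro h0; simp [h0] at hj)
  rw [val_mul_eq hm (h.val_eq i), val_mul_eq hn (h.val_eq j)] at heq
  have h1 : N * m + d i = N * n + d j := WithTop.coe_injective heq
  exact hij (h.incongruent i j ⟨n - m, by linarith⟩)

variable [Nonempty ι]

theorem exists_expansion (h : IsValuationBasis vL N K e d) (x : L) :
    ∃ c : ι → K, x = ∑ i, algebraMap K L (c i) * e i := by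
  classical
  have hli : LinearIndependent K e := by
    rw [Fintype.linearIndependent_iff]
    intro c hc i
    by_contra hci
    have hne : algebraMap K L (c i) * e i ≠ 0 :=
      mul_ne_zero (by simpa using hci) (ne_zero_of_val_eq (h.val_eq i))
    obtain ⟨j, hj, hs, -⟩ := exists_val_sum_eq (v := vL) (fun i => algebraMap K L (c i) * e i)
      (h.val_ne c) ⟨i, hne⟩
    simp only [Algebra.smul_def] at hc
    rw [hc, AddValuation.map_zero] at hs
    exact hj ((AddValuation.top_iff vL).1 hs.symm)
  refine ⟨fun i => (basisOfLinearIndependentOfCardEqFinrank hli h.card_eq).repr x i, ?_⟩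
  have := (basisOfLinearIndependentOfCardEqFinrank hli h.card_eq).sum_repr x
  simpa [Algebra.smul_def] using this.symm

/-- The expansion of `x ≠ 0` has exactly one term of valuation `v(x)`, and its other terms are
smaller. -/
theorem exists_leading_term (h : IsValuationBasis vL N K e d) {x : L} {m : ℤ}
    (hx : vL x = (m : WithTop ℤ)) :
    ∃ (c : ι → K) (i : ι), x = ∑ j, algebraMap K L (c j) * e j ∧
      vL (algebraMap K L (c i) * e i) = (m : WithTop ℤ) ∧
      (∀ j, j ≠ i → (m : WithTop ℤ) < vL (algebraMap K L (c j) * e j)) ∧ N ∣ m - d i := by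
  obtain ⟨c, hc⟩ := h.exists_expansion x
  have hne : ∃ i, algebraMap K L (c i) * e i ≠ 0 := by
    by_contra! h0
    exact ne_zero_of_val_eq hx (by rw [hc]; exact Finset.sum_eq_zero fun i _ => h0 i)
  obtain ⟨i, hi, hs, hlt⟩ := exists_val_sum_eq (v := vL) (fun i => algebraMap K L (c i) * e i)
    (h.val_ne c) hne
  rw [← hc, hx] at hs
  refine ⟨c, i, hc, hs.symm, fun j hj => hs ▸ hlt j hj, ?_⟩
  obtain ⟨n, hn⟩ := h.val_base (c i) (by rintro h0; simp [h0] at hi)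
  exact ⟨n, by linarith [val_unique hs.symm (val_mul_eq hn (h.val_eq i))]⟩

theorem exists_expansion_le (h : IsValuationBasis vL N K e d) {x : L} {m : ℤ}
    (hx : (m : WithTop ℤ) ≤ vL x) :
    ∃ c : ι → K, x = ∑ j, algebraMap K L (c j) * e j ∧
      ∀ j, (m : WithTop ℤ) ≤ vL (algebraMap K L (c j) * e j) := by
  by_cases h0 : x = 0
  · exact ⟨0, by simp [h0], by simp⟩
  · obtain ⟨n, hn⟩ := exists_val_eq vL h0
    obtain ⟨c, i, hc, hi, hlt, -⟩ := h.exists_leading_term hn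
    refine ⟨c, hc, fun j => le_val_of_le ?_ (le_of_le_val hn hx)⟩
    by_cases hj : j = i
    · exact hj ▸ hi.ge
    · exact (hlt j hj).le

/-- A `K`-linear operator that raises the valuation of each basis vector by at least `s` does so on
all of `L`; if the raise is exactly `s` on the leading basis vector of `x`, it is exactly `s`
on `x`. -/
theorem shift (h : IsValuationBasis vL N K e d) (T : L →ₗ[K] L) (s : ℤ)
    (hT : ∀ i, ((d i + s : ℤ) : WithTop ℤ) ≤ vL (T (e i))) {x : L} {m : ℤ}
    (hx : vL x = (m : WithTop ℤ)) :
    ((m + s : ℤ) : WithTop ℤ) ≤ vL (T x) ∧ ∃ i, N ∣ m - d i ∧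
      (vL (T (e i)) = ((d i + s : ℤ) : WithTop ℤ) → vL (T x) = ((m + s : ℤ) : WithTop ℤ)) := by
  classical
  obtain ⟨c, i, hc, hi, hlt, hN⟩ := h.exists_leading_term hx
  have hTx : T x = ∑ j, algebraMap K L (c j) * T (e j) := by
    rw [hc, map_sum]
    refine Finset.sum_congr rfl fun j _ => ?_
    rw [← Algebra.smul_def, map_smul, Algebra.smul_def]
  have hterm : ∀ (j : ι) (k : ℤ), (k : WithTop ℤ) ≤ vL (algebraMap K L (c j) * e j) →
      ((k + s : ℤ) : WithTop ℤ) ≤ vL (algebraMap K L (c j) * T (e j)) := by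
    intro j k hk
    by_cases hcj : c j = 0
    · simp [hcj]
    · obtain ⟨n, hn⟩ := h.val_base (c j) hcj
      have h1 := le_of_le_val (val_mul_eq hn (h.val_eq j)) hk
      exact le_val_of_le (le_val_mul hn.ge (hT j)) (by linarith)
  have hrest : ∀ j, j ≠ i →
      ((m + s + 1 : ℤ) : WithTop ℤ) ≤ vL (algebraMap K L (c j) * T (e j)) := by
    intro j hj
    have := hterm j (m + 1) (lt_val_iff.1 (hlt j hj))
    rwa [show m + 1 + s = m + s + 1 by ring] at this
  have hsplit := Finset.add_sum_erase Finset.univ (fun j => algebraMap K L (c j) * T (e j))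
    (Finset.mem_univ i)
  have hrest' := AddValuation.map_le_sum vL
    fun j (hj : j ∈ Finset.univ.erase i) => hrest j (Finset.ne_of_mem_erase hj)
  refine ⟨?_, i, hN, fun hTi => ?_⟩
  · rw [hTx, ← hsplit]
    exact AddValuation.map_le_add vL (hterm i m hi.ge) (le_val_of_le hrest' (by linarith))
  · obtain ⟨n, hn⟩ := h.val_base (c i) (by
      rintro h0
      simp [h0] at hi)
    have h1 := val_unique hi (val_mul_eq hn (h.val_eq i))
    rw [hTx, ← hsplit]
    refine val_add_eq ?_ hrest' (by linarith)
    rw [val_mul_eq hn hTi]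
    congr 1
    linarith

end IsValuationBasis

end ValuationBasis

/-! ### Ramification in an extension with one break -/

namespace IsOneBreakExtension

variable {p : ℕ} {K L : Type*} [Field K] [Field L] [Algebra K L]
  {vK : AddValuation K (WithTop ℤ)} {vL : AddValuation L (WithTop ℤ)} {b : ℤ}

theorem val_algebraMap {n : ℕ} (hL : IsOneBreakExtension p n vK vL b) {c : K} {m : ℤ}
    (hc : vK c = (m : WithTop ℤ)) :
    vL (algebraMap K L c) = ((Module.finrank K L * m : ℤ) : WithTop ℤ) := by
  rw [hL.totally_ramified, hc, ← WithTop.coe_nsmul]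
  simp

theorem le_val_algebraMap {n : ℕ} (hL : IsOneBreakExtension p n vK vL b) {c : K} {m : ℤ}
    (hc : (m : WithTop ℤ) ≤ vK c) :
    ((Module.finrank K L * m : ℤ) : WithTop ℤ) ≤ vL (algebraMap K L c) := by
  by_cases h0 : c = 0
  · simp [h0]
  · obtain ⟨k, hk⟩ := exists_val_eq vK h0
    refine le_val_of_eq (hL.val_algebraMap hk) ?_
    exact mul_le_mul_of_nonneg_left (le_of_le_val hk hc) (by positivity)

theorem finrank_eq {n : ℕ} [Fact p.Prime] (hL : IsOneBreakExtension p n vK vL b) :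
    Module.finrank K L = p ^ n := by
  have := hL.finite
  have := hL.galois
  obtain ⟨φ⟩ := hL.elementary
  rw [← IsGalois.card_aut_eq_finrank, Nat.card_congr φ.toEquiv]
  simp

theorem isValuationBasis_pow {n : ℕ} (hL : IsOneBreakExtension p n vK vL b) {π : L}
    (hπ : vL π = ((1 : ℤ) : WithTop ℤ)) :
    IsValuationBasis vL (Module.finrank K L) K (fun i : Fin (Module.finrank K L) => π ^ (i : ℕ))
      (fun i => ((i : ℕ) : ℤ)) where
  val_base c hc := by
    obtain ⟨m, hm⟩ := exists_val_eq vK hc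
    exact ⟨m, hL.val_algebraMap hm⟩
  val_eq i := by rw [val_pow_eq hπ, mul_one]
  incongruent i j hij := by
    refine Fin.ext (Nat.ModEq.eq_of_lt_of_lt (m := Module.finrank K L) ?_ i.2 j.2)
    exact ((Nat.modEq_iff_dvd (n := Module.finrank K L)).2 hij).symm
  card_eq := Fintype.card_fin _

section

variable {n : ℕ} (hL : IsOneBreakExtension p n vK vL b) {π : L}
  (hπ : vL π = ((1 : ℤ) : WithTop ℤ))
include hL hπ

/-- A conjugate of a uniformizer has positive valuation, as it is a root of the same Eisenstein
polynomial. -/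
theorem one_le_val_gal_uniformizer (σ : L ≃ₐ[K] L) : ((1 : ℤ) : WithTop ℤ) ≤ vL (σ π) := by
  have := hL.finite
  have hN : 0 < Module.finrank K L := Module.finrank_pos
  have : Nonempty (Fin (Module.finrank K L)) := ⟨⟨0, hN⟩⟩
  have hB := hL.isValuationBasis_pow hπ
  obtain ⟨c, hc, hle⟩ := hB.exists_expansion_le (val_pow_eq hπ (Module.finrank K L)).ge
  obtain ⟨w, hw⟩ := exists_val_eq vL (x := σ π) (by
    rw [Ne, EmbeddingLike.map_eq_zero_iff]
    exact ne_zero_of_val_eq hπ)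
  refine le_val_of_eq hw ?_
  by_contra! hw0
  have hcj : ∀ j, ((Module.finrank K L : ℤ) : WithTop ℤ) ≤ vL (algebraMap K L (c j)) := by
    intro j
    by_cases h0 : c j = 0
    · simp [h0]
    · obtain ⟨m, hm⟩ := hB.val_base _ h0
      have h1 := le_of_le_val (val_mul_eq hm (hB.val_eq j)) (hle j)
      have h2 : ((j : ℕ) : ℤ) < Module.finrank K L := by exact_mod_cast j.2
      refine le_val_of_eq hm ?_
      have : 0 < m := by
        by_contra! hm0
        nlinarith
      nlinarith
  have h1 : σ π ^ Module.finrank K L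
      = ∑ j : Fin (Module.finrank K L), algebraMap K L (c j) * σ π ^ (j : ℕ) := by
    rw [← map_pow, hc, map_sum]
    simp
  have h2 := le_of_le_val (val_pow_eq hw (Module.finrank K L)) (m := Module.finrank K L +
      (Module.finrank K L - 1) * w) (by
    rw [h1]
    refine AddValuation.map_le_sum vL fun j _ => ?_
    refine le_val_of_le (le_val_mul (hcj j) (val_pow_eq hw j).ge) ?_
    have h2 : ((j : ℕ) : ℤ) + 1 ≤ Module.finrank K L := by exact_mod_cast j.2
    nlinarith)
  have h3 : (0 : ℤ) < Module.finrank K L := by exact_mod_cast hN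
  linarith

omit hπ in
/-- An integral element has integral coefficients in its expansion in powers of a uniformizer. -/
theorem exists_integral_expansion (hπ : vL π = ((1 : ℤ) : WithTop ℤ)) {x : L} (hx : 0 ≤ vL x) :
    ∃ c : Fin (Module.finrank K L) → K,
      x = ∑ j, algebraMap K L (c j) * π ^ (j : ℕ) ∧
        ∀ j, ((0 : ℤ) : WithTop ℤ) ≤ vL (algebraMap K L (c j)) := by
  have := hL.finite
  have : Nonempty (Fin (Module.finrank K L)) := ⟨⟨0, Module.finrank_pos⟩⟩
  have hB := hL.isValuationBasis_pow hπ
  obtain ⟨c, hc, hle⟩ := hB.exists_expansion_le (x := x) (m := 0) hx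
  refine ⟨c, hc, fun j => ?_⟩
  by_cases h0 : c j = 0
  · simp [h0]
  · obtain ⟨m, hm⟩ := hB.val_base _ h0
    have h1 := le_of_le_val (val_mul_eq hm (hB.val_eq j)) (hle j)
    have h2 : ((j : ℕ) : ℤ) < Module.finrank K L := by exact_mod_cast j.2
    refine le_val_of_eq hm ?_
    have : 0 ≤ m := by
      by_contra! hm0
      nlinarith
    positivity

theorem mem_lowerRamificationGroup {σ : L ≃ₐ[K] L} {i : ℤ} (hi : -1 ≤ i)
    (h : ((i + 1 : ℤ) : WithTop ℤ) ≤ vL (σ π - π)) :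
    σ ∈ lowerRamificationGroup (K := K) vL i := by
  intro x hx
  obtain ⟨c, hc, hint⟩ := hL.exists_integral_expansion hπ hx
  have h1 : σ x - x = ∑ j, algebraMap K L (c j) * (σ π ^ (j : ℕ) - π ^ (j : ℕ)) := by
    rw [hc, map_sum, ← Finset.sum_sub_distrib]
    refine Finset.sum_congr rfl fun j _ => ?_
    rw [map_mul, map_pow, AlgEquiv.commutes]; ring
  rw [h1]
  refine AddValuation.map_le_sum vL fun j _ => ?_
  suffices h2 : ∀ k : ℕ, ((i + 1 : ℤ) : WithTop ℤ) ≤ vL (σ π ^ k - π ^ k) by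
    simpa using le_val_mul (hint j) (h2 j)
  intro k
  cases k with
  | zero => simp
  | succ k =>
    have h3 := le_val_add_pow_sub_pow (A := π) (a := 0) (le_val_of_eq hπ (by norm_num)) h
      (by linarith) k
    simpa using h3

/-- All nontrivial automorphisms lie in the same ramification groups. -/
theorem val_gal_uniformizer_sub {σ : L ≃ₐ[K] L} (hσ : σ ≠ 1) :
    vL (σ π - π) = ((b + 1 : ℤ) : WithTop ℤ) := by
  have hne : σ π - π ≠ 0 := by
    intro h0
    apply hσ
    have := hL.finite
    have : Nonempty (Fin (Module.finrank K L)) := ⟨⟨0, Module.finrank_pos⟩⟩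
    ext x
    obtain ⟨c, hc⟩ := (hL.isValuationBasis_pow hπ).exists_expansion x
    rw [hc, map_sum]
    simp [sub_eq_zero.1 h0]
  obtain ⟨m, hm⟩ := exists_val_eq vL hne
  have hm1 : 0 ≤ m := le_of_le_val hm (AddValuation.map_le_sub vL
    (le_val_of_le (hL.one_le_val_gal_uniformizer hπ σ) (by norm_num))
    (le_val_of_eq hπ (by norm_num)))
  have hbr : m - 1 ∈ lowerRamificationBreaks K vL := by
    refine ⟨by linarith, fun heq => ?_⟩
    have h1 := hL.mem_lowerRamificationGroup hπ (σ := σ) (i := m - 1) (by linarith)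
      (by rw [hm]; simp)
    rw [heq] at h1
    have h2 := le_of_le_val hm (h1 π (le_val_of_eq (m := 0) hπ (by norm_num)))
    linarith
  rw [hL.breaks, Set.mem_singleton_iff] at hbr
  rw [hm, ← hbr]
  congr 1; ring

end

/-- Every nontrivial automorphism raises valuations by at least the break, and by exactly the break
on elements whose valuation is prime to `p`. -/
theorem val_gal_sub [Fact p.Prime] [CharP K p] (hL : IsOneBreakExtension p 2 vK vL b) (hb : 0 < b)
    {σ : L ≃ₐ[K] L} (hσ : σ ≠ 1) {x : L} {m : ℤ} (hx : vL x = (m : WithTop ℤ)) :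
    ((m + b : ℤ) : WithTop ℤ) ≤ vL (σ x - x) ∧
      (¬ (p : ℤ) ∣ m → vL (σ x - x) = ((m + b : ℤ) : WithTop ℤ)) := by
  have := hL.finite
  have : CharP L p := charP_of_injective_algebraMap (algebraMap K L).injective p
  have : Nonempty (Fin (Module.finrank K L)) := ⟨⟨0, Module.finrank_pos⟩⟩
  obtain ⟨π, hπ⟩ := hL.normalized
  replace hπ : vL π = ((1 : ℤ) : WithTop ℤ) := hπ
  have hδ := hL.val_gal_uniformizer_sub hπ hσ
  have key := (hL.isValuationBasis_pow hπ).shift (σ.toLinearMap - LinearMap.id) b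
    (fun i => by
      change _ ≤ vL (σ (π ^ (i : ℕ)) - π ^ (i : ℕ))
      rw [map_pow]
      generalize (i : ℕ) = k
      cases k with
      | zero => simp
      | succ k =>
        have h3 := le_val_add_pow_sub_pow hπ.ge hδ.ge (by linarith) k
        rw [add_sub_cancel] at h3
        refine le_val_of_le h3 (le_of_eq ?_)
        push_cast; ring) hx
  refine ⟨key.1, fun hm => ?_⟩
  obtain ⟨i, hi, h⟩ := key.2
  refine h ?_
  have hpi : ¬ p ∣ (i : ℕ) := by
    intro hp
    apply hm
    have h1 : (p : ℤ) ∣ m - ((i : ℕ) : ℤ) := dvd_trans (by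
      rw [hL.finrank_eq]
      exact_mod_cast dvd_pow_self p two_ne_zero) hi
    simpa using dvd_add h1 (Int.natCast_dvd_natCast.2 hp)
  change vL (σ (π ^ (i : ℕ)) - π ^ (i : ℕ)) = _
  rw [map_pow]
  revert hpi
  generalize (i : ℕ) = k
  intro hpk
  cases k with
  | zero => simp at hpk
  | succ k =>
    have h3 := val_add_pow_sub_pow hπ hδ (by linarith) k (val_natCast_eq_zero vL p hpk)
    rw [add_sub_cancel] at h3
    rw [h3]
    congr 1
    push_cast; ring

theorem le_val_gal_sub [Fact p.Prime] [CharP K p] (hL : IsOneBreakExtension p 2 vK vL b)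
    (hb : 0 < b) (σ : L ≃ₐ[K] L) {x : L} {m : ℤ} (hx : (m : WithTop ℤ) ≤ vL x) :
    ((m + b : ℤ) : WithTop ℤ) ≤ vL (σ x - x) := by
  by_cases hσ : σ = 1
  · simp [hσ]
  by_cases h0 : x = 0
  · simp [h0]
  obtain ⟨n, hn⟩ := exists_val_eq vL h0
  exact le_val_of_le (hL.val_gal_sub hb hσ hn).1 (by linarith [le_of_le_val hn hx])

theorem le_val_gal [Fact p.Prime] [CharP K p] (hL : IsOneBreakExtension p 2 vK vL b)
    (hb : 0 < b) (σ : L ≃ₐ[K] L) {x : L} {m : ℤ} (hx : (m : WithTop ℤ) ≤ vL x) :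
    (m : WithTop ℤ) ≤ vL (σ x) := by
  have h := AddValuation.map_le_add vL (le_val_of_le (hL.le_val_gal_sub hb σ hx)
    (show m ≤ m + b by linarith)) hx
  rwa [sub_add_cancel] at h

theorem pow_eq_one {n : ℕ} (hL : IsOneBreakExtension p n vK vL b) (σ : L ≃ₐ[K] L) :
    σ ^ p = 1 := by
  obtain ⟨φ⟩ := hL.elementary
  apply φ.injective
  rw [map_pow, map_one]
  apply Multiplicative.toAdd.injective
  rw [toAdd_pow]
  ext i
  simp

/-- If `v(x) + i b` is prime to `p` for all `i < j`, then `(σ - 1) ^ j` raises `v(x)` by `j b`. -/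
theorem val_gal_sub_pow [Fact p.Prime] [CharP K p] (hL : IsOneBreakExtension p 2 vK vL b)
    (hb : 0 < b) {σ : L ≃ₐ[K] L} (hσ : σ ≠ 1) {x : L} {m : ℤ} (hx : vL x = (m : WithTop ℤ))
    (j : ℕ) (hj : ∀ i < j, ¬ (p : ℤ) ∣ m + i * b) :
    vL (((σ.toLinearMap - 1 : Module.End K L) ^ j) x) = ((m + j * b : ℤ) : WithTop ℤ) := by
  induction j with
  | zero => simpa using hx
  | succ j ih =>
    rw [pow_succ']
    have h1 := ih fun i hi => hj i (hi.trans (Nat.lt_succ_self j))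
    refine ((hL.val_gal_sub hb hσ h1).2 (hj j (Nat.lt_succ_self j))).trans ?_
    congr 1; push_cast; ring

theorem gal_sub_one_pow_eq_zero [Fact p.Prime] [CharP K p] {n : ℕ}
    (hL : IsOneBreakExtension p n vK vL b) (σ : L ≃ₐ[K] L) :
    (σ.toLinearMap - 1 : Module.End K L) ^ p = 0 := by
  have : CharP (Module.End K L) p :=
    charP_of_injective_algebraMap (algebraMap K (Module.End K L)).injective p
  rw [sub_pow_char_of_commute p (Commute.one_right _), one_pow, sub_eq_zero]
  ext x
  have h3 : ∀ k : ℕ, ((σ.toLinearMap : Module.End K L) ^ k) x = (σ ^ k) x := by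
    intro k
    induction k with
    | zero => simp
    | succ k ih => rw [pow_succ', pow_succ', Module.End.mul_apply, ih]; rfl
  rw [h3, hL.pow_eq_one]; rfl

/-- The break is prime to `p`: otherwise `(σ - 1) ^ p` would not kill a uniformizer. -/
theorem not_dvd_break [Fact p.Prime] [CharP K p] (hL : IsOneBreakExtension p 2 vK vL b)
    (hb : 0 < b) : ¬ (p : ℤ) ∣ b := by
  intro hpb
  have := hL.finite
  have := hL.galois
  have hp := (Fact.out : p.Prime)
  obtain ⟨σ, hσ⟩ : ∃ σ : L ≃ₐ[K] L, σ ≠ 1 := by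
    by_contra! h
    have h1 : Nat.card (L ≃ₐ[K] L) = p ^ 2 := by
      rw [IsGalois.card_aut_eq_finrank, hL.finrank_eq]
    have : Subsingleton (L ≃ₐ[K] L) := ⟨fun a b => by rw [h a, h b]⟩
    have h2 := Nat.card_of_subsingleton (1 : L ≃ₐ[K] L)
    have := Nat.one_lt_pow two_ne_zero hp.one_lt
    omega
  obtain ⟨π, hπ⟩ := hL.normalized
  replace hπ : vL π = ((1 : ℤ) : WithTop ℤ) := hπ
  have h1 := hL.val_gal_sub_pow hb hσ hπ p fun i _ hdvd => by
    have h2 : (p : ℤ) ∣ 1 := by simpa using dvd_sub hdvd (dvd_mul_of_dvd_right hpb i)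
    exact hp.one_lt.ne' (by exact_mod_cast Int.eq_one_of_dvd_one (by positivity) h2)
  rw [hL.gal_sub_one_pow_eq_zero, LinearMap.zero_apply, AddValuation.map_zero] at h1
  exact WithTop.top_ne_coe h1

end IsOneBreakExtension

/-! ### The coefficient field -/

namespace IsLocalFieldOver

variable {F K : Type*} [Field F] [Field K] [Algebra F K] {vK : AddValuation K (WithTop ℤ)}

theorem val_coeff_eq_zero (hK : IsLocalFieldOver F vK) {a : F} (ha : a ≠ 0) :
    vK (algebraMap F K a) = ((0 : ℤ) : WithTop ℤ) := by
  have h0 : algebraMap F K a ≠ 0 := by simpa using ha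
  obtain ⟨m, hm⟩ := exists_val_eq vK h0
  have h1 : (0 : ℤ) ≤ m := le_of_le_val hm (hK.coeff_integral a)
  have h2 := val_inv_eq hm
  rw [← map_inv₀] at h2
  have h3 : (0 : ℤ) ≤ -m := le_of_le_val h2 (hK.coeff_integral a⁻¹)
  rw [hm, show m = 0 by linarith]

theorem exists_val (hK : IsLocalFieldOver F vK) (u : ℤ) : ∃ t : K, vK t = (u : WithTop ℤ) := by
  obtain ⟨t, ht⟩ := hK.normalized
  replace ht : vK t = ((1 : ℤ) : WithTop ℤ) := ht
  obtain ⟨k, rfl | rfl⟩ := u.eq_nat_or_neg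
  · exact ⟨t ^ k, by rw [val_pow_eq ht, mul_one]⟩
  · exact ⟨(t ^ k)⁻¹, by rw [val_inv_eq (val_pow_eq ht k), mul_one]⟩

theorem exists_leading_coeff (hK : IsLocalFieldOver F vK) {x z : K} {m : ℤ}
    (hx : vK x = (m : WithTop ℤ)) (hz : vK z = (m : WithTop ℤ)) :
    ∃ a : F, a ≠ 0 ∧ ((m + 1 : ℤ) : WithTop ℤ) ≤ vK (x - algebraMap F K a * z) := by
  have h1 := val_mul_eq hx (val_inv_eq hz)
  rw [add_neg_cancel] at h1
  obtain ⟨a, ha, -⟩ := hK.coeff_residue (x * z⁻¹) h1.ge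
  have hz0 := ne_zero_of_val_eq hz
  have ha' := lt_val_iff (m := 0).1 ha
  refine ⟨a, ?_, ?_⟩
  · rintro rfl
    rw [map_zero, sub_zero] at ha'
    have := le_of_le_val h1 ha'
    omega
  · have h2 := le_val_mul ha' hz.ge
    rw [sub_mul, inv_mul_cancel_right₀ hz0] at h2
    rwa [show m + 1 = 0 + 1 + m by ring]

end IsLocalFieldOver

/-! ### Roots of Artin-Schreier polynomials -/

theorem exists_natCast_of_pow_eq_self {L : Type*} [Field L] {p : ℕ} [Fact p.Prime] [CharP L p]
    {z : L} (hz : z ^ p = z) : ∃ n : ℕ, z = n := by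
  have h1 : z ∈ (⊥ : Subfield L) := (Subfield.mem_bot_iff_pow_eq_self L p).2 hz
  rw [← ZMod.fieldRange_castHom_eq_bot p] at h1
  obtain ⟨a, rfl⟩ := h1
  exact ⟨a.val, by simp [ZMod.natCast_val]⟩

theorem val_of_pow_sub_self {L : Type*} [Field L] {v : AddValuation L (WithTop ℤ)} {p : ℕ}
    (hp : 1 < p) {y : L} {m : ℤ} (hm : m < 0)
    (hy : v (y ^ p - y) = ((p * m : ℤ) : WithTop ℤ)) : v y = (m : WithTop ℤ) := by
  have hp' : (1 : ℤ) < p := by exact_mod_cast hp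
  have h0 : y ≠ 0 := by
    rintro rfl
    rw [zero_pow (by omega), sub_zero, AddValuation.map_zero] at hy
    exact WithTop.top_ne_coe hy
  obtain ⟨w, hw⟩ := exists_val_eq v h0
  have hw0 : w < 0 := by
    by_contra! h
    have h1 := le_of_le_val hy (m := 0) (AddValuation.map_le_sub v
      (le_val_of_eq (val_pow_eq hw p) (by positivity)) (le_val_of_eq hw h))
    nlinarith
  have h1 := val_sub_eq (val_pow_eq hw p) hw.ge (by nlinarith)
  have h2 := val_unique h1 hy
  rw [hw, mul_left_cancel₀ (by linarith) h2]

section Approximation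

variable {p : ℕ} [Fact p.Prime] {F K L : Type*} [Field F] [Field K]
  [Algebra F K] [Field L] [Algebra K L]
  {vK : AddValuation K (WithTop ℤ)} {vL : AddValuation L (WithTop ℤ)} {b : ℤ}

theorem IsOneBreakExtension.val_artinSchreier_root (hL : IsOneBreakExtension p 2 vK vL b)
    {α : K} {y : L} {c : ℤ} (hc : 0 < c) (hα : vK α = ((-c : ℤ) : WithTop ℤ))
    (hy : y ^ p - y = algebraMap K L α) : vL y = ((-(p * c) : ℤ) : WithTop ℤ) := by
  have hp := (Fact.out : p.Prime)
  have hp0 : (0 : ℤ) < p := by exact_mod_cast hp.pos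
  refine val_of_pow_sub_self hp.one_lt (by nlinarith) ?_
  rw [hy, hL.val_algebraMap hα, hL.finrank_eq]
  congr 1
  push_cast; ring

variable [CharP K p]

/-- For a monomial `a₀ y ^ i`, where `y ^ p - y = α` and `σ y = y + 1`: by how much `σ` moves it,
and how far its `p`-th power is from `a₀ ^ p α ^ i`. Both are governed by the linear term of a
binomial expansion in `y + 1` and `y ^ p - y` respectively. -/
theorem IsOneBreakExtension.monomial_estimates (hL : IsOneBreakExtension p 2 vK vL b)
    {α : K} {y : L} {c : ℤ} (hc : 0 < c) (hα : vK α = ((-c : ℤ) : WithTop ℤ))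
    (hy : y ^ p - y = algebraMap K L α) {σ : L ≃ₐ[K] L} (hσ : σ y = y + 1)
    {a₀ : K} (i : ℕ) (hi : i < p) {w : ℤ} (hw : vK (a₀ ^ p * α ^ i) = (w : WithTop ℤ)) :
    ((p * w + p * c : ℤ) : WithTop ℤ) ≤
        vL (σ (algebraMap K L a₀ * y ^ i) - algebraMap K L a₀ * y ^ i) ∧
    ((p ^ 2 * w + (p - 1) * p * c : ℤ) : WithTop ℤ) ≤
        vL ((algebraMap K L a₀ * y ^ i) ^ p - algebraMap K L (a₀ ^ p * α ^ i)) ∧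
    (i ≠ 0 →
      vL (σ (algebraMap K L a₀ * y ^ i) - algebraMap K L a₀ * y ^ i)
        = ((p * w + p * c : ℤ) : WithTop ℤ) ∧
      vL ((algebraMap K L a₀ * y ^ i) ^ p - algebraMap K L (a₀ ^ p * α ^ i))
        = ((p ^ 2 * w + (p - 1) * p * c : ℤ) : WithTop ℤ)) := by
  have hp := (Fact.out : p.Prime)
  have hp1 : (1 : ℤ) < p := by exact_mod_cast hp.one_lt
  have : CharP L p := charP_of_injective_algebraMap (algebraMap K L).injective p
  rcases Nat.eq_zero_or_eq_succ_pred i with h0 | h0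
  · subst h0; simp
  set k := i.pred
  clear_value k
  subst h0
  have ha0 : a₀ ≠ 0 := by
    rintro rfl
    simp [hp.ne_zero] at hw
  obtain ⟨u, hu⟩ := exists_val_eq vK ha0
  have hwu : w = p * u - (k + 1) * c := by
    rw [← val_unique hw (val_mul_eq (val_pow_eq hu p) (val_pow_eq hα (k + 1)))]
    push_cast; ring
  have hyv := hL.val_artinSchreier_root hc hα hy
  have huL := hL.val_algebraMap hu
  rw [hL.finrank_eq] at huL
  have hk := val_natCast_eq_zero vL p (Nat.not_dvd_of_pos_of_lt (Nat.succ_pos k) hi)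
  have h1 : vL (σ (algebraMap K L a₀ * y ^ (k + 1)) - algebraMap K L a₀ * y ^ (k + 1))
      = ((p * w + p * c : ℤ) : WithTop ℤ) := by
    rw [map_mul, map_pow, hσ, AlgEquiv.commutes, ← mul_sub, val_mul_eq huL
      (val_add_pow_sub_pow hyv (show vL 1 = ((0 : ℤ) : WithTop ℤ) by simp) (by nlinarith) k hk)]
    congr 1
    rw [hwu]; push_cast; ring
  have h2 : vL ((algebraMap K L a₀ * y ^ (k + 1)) ^ p - algebraMap K L (a₀ ^ p * α ^ (k + 1)))
      = ((p ^ 2 * w + (p - 1) * p * c : ℤ) : WithTop ℤ) := by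
    have h3 : (algebraMap K L a₀ * y ^ (k + 1)) ^ p - algebraMap K L (a₀ ^ p * α ^ (k + 1))
        = -(algebraMap K L a₀ ^ p * ((y ^ p + -y) ^ (k + 1) - (y ^ p) ^ (k + 1))) := by
      rw [map_mul, map_pow, map_pow, ← hy]; ring
    rw [h3]
    refine (val_neg_eq (val_mul_eq (val_pow_eq huL p) (val_add_pow_sub_pow (val_pow_eq hyv p)
      (val_neg_eq hyv) (by nlinarith [mul_pos (mul_pos (by linarith : (0 : ℤ) < p) hc) (by
        linarith : (0 : ℤ) < p - 1)]) k hk))).trans ?_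
    congr 1
    rw [hwu]; push_cast; ring
  exact ⟨h1.ge, h2.ge, fun _ => ⟨h1, h2⟩⟩

/-- As the valuation of `α` is prime to `p` and `F` is perfect, each element of `K` has the same
leading term as some `a₀ ^ p * α ^ i`. -/
theorem IsLocalFieldOver.exists_leading_monomial [PerfectField F] (hK : IsLocalFieldOver F vK)
    {α : K} {c : ℤ} (hpc : ¬ (p : ℤ) ∣ c) (hα : vK α = ((-c : ℤ) : WithTop ℤ))
    {a : K} {w : ℤ} (ha : vK a = (w : WithTop ℤ)) :
    ∃ (a₀ : K) (i : ℕ), i < p ∧ vK (a₀ ^ p * α ^ i) = (w : WithTop ℤ) ∧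
      ((w + 1 : ℤ) : WithTop ℤ) ≤ vK (a - a₀ ^ p * α ^ i) ∧ (¬ (p : ℤ) ∣ w → i ≠ 0) := by
  have hp := (Fact.out : p.Prime)
  have : CharP F p := (algebraMap F K).charP (algebraMap F K).injective p
  have : ExpChar F p := ExpChar.prime hp
  obtain ⟨i, u, hi, hw⟩ : ∃ (i : ℕ) (u : ℤ), i < p ∧ w = p * u - i * c := by
    have hc : (c : ZMod p) ≠ 0 := by rwa [Ne, ZMod.intCast_zmod_eq_zero_iff_dvd]
    have h1 : ((w + (-(w : ZMod p) / c).val * c : ℤ) : ZMod p) = 0 := by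
      push_cast
      rw [ZMod.natCast_zmod_val]
      field_simp
      ring
    obtain ⟨u, hu⟩ := (ZMod.intCast_zmod_eq_zero_iff_dvd _ _).1 h1
    exact ⟨_, u, ZMod.val_lt _, by linarith⟩
  obtain ⟨t, ht⟩ := hK.exists_val u
  have hz := val_mul_eq (val_pow_eq ht p) (val_pow_eq hα i)
  rw [show (p * u + i * -c : ℤ) = w by rw [hw]; ring] at hz
  obtain ⟨e, he, hle⟩ := hK.exists_leading_coeff ha hz
  obtain ⟨r, rfl⟩ := (PerfectRing.bijective_frobenius (R := F) (p := p)).2 e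
  simp only [map_pow] at hle he
  rw [← mul_assoc, ← mul_pow] at hle
  refine ⟨algebraMap F K r * t, i, hi, ?_, hle, ?_⟩
  · have hr : r ≠ 0 := by
      rintro rfl
      exact he (zero_pow hp.ne_zero)
    rw [mul_pow, mul_assoc, val_mul_eq (val_pow_eq (hK.val_coeff_eq_zero hr) p) hz]
    simp
  · rintro hpw rfl
    exact hpw ⟨u, by rw [hw]; simp⟩

/-- Approximation of `a ∈ K` by `p`-th powers from `K(y)`, up to an error of valuation `≥ p² N`
and the error that is caused by `y ^ p ≠ α`. -/
theorem IsOneBreakExtension.exists_approx [PerfectField F] (hK : IsLocalFieldOver F vK)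
    (hL : IsOneBreakExtension p 2 vK vL b)
    {α : K} {y : L} {c : ℤ} (hc : 0 < c) (hpc : ¬ (p : ℤ) ∣ c)
    (hα : vK α = ((-c : ℤ) : WithTop ℤ))
    (hy : y ^ p - y = algebraMap K L α) {σ : L ≃ₐ[K] L} (hσ : σ y = y + 1) (N : ℤ) (n : ℕ) :
    ∀ a : K, ((N - n : ℤ) : WithTop ℤ) ≤ vK a → ∃ E : L,
      (∀ τ : L ≃ₐ[K] L, τ y = y → τ E = E) ∧
      ((p * (N - n) + p * c : ℤ) : WithTop ℤ) ≤ vL (σ E - E) ∧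
      ((min (p ^ 2 * (N - n) + (p - 1) * p * c) (p ^ 2 * N) : ℤ) : WithTop ℤ) ≤
        vL (E ^ p - algebraMap K L a) := by
  have hp := (Fact.out : p.Prime)
  have hp0 : (0 : ℤ) < p := by exact_mod_cast hp.pos
  have : CharP L p := charP_of_injective_algebraMap (algebraMap K L).injective p
  induction n with
  | zero =>
    intro a ha
    refine ⟨0, by simp, by simp, ?_⟩
    rw [zero_pow hp.ne_zero, zero_sub, AddValuation.map_neg]
    refine le_val_of_le (hL.le_val_algebraMap ha) ?_
    rw [hL.finrank_eq]
    refine (min_le_right _ _).trans (le_of_eq ?_)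
    push_cast; ring
  | succ n ih =>
    intro a ha
    by_cases ha0 : a = 0
    · exact ⟨0, by simp, by simp, by simp [ha0, hp.ne_zero]⟩
    obtain ⟨w, hw⟩ := exists_val_eq vK ha0
    have hwN := le_of_le_val hw ha
    push_cast at hwN
    obtain ⟨a₀, i, hi, hv, hle, -⟩ := hK.exists_leading_monomial hpc hα hw
    obtain ⟨h1, h2, -⟩ := hL.monomial_estimates hc hα hy hσ i hi hv
    obtain ⟨E, hE1, hE2, hE3⟩ := ih _ (le_val_of_le hle (by linarith))
    refine ⟨algebraMap K L a₀ * y ^ i + E, fun τ hτ => ?_, ?_, ?_⟩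
    · rw [map_add, map_mul, map_pow, hτ, hE1 τ hτ, AlgEquiv.commutes]
    · rw [map_add, add_sub_add_comm]
      refine AddValuation.map_le_add vL (le_val_of_le h1 ?_) (le_val_of_le hE2 ?_)
      · push_cast; nlinarith
      · push_cast; nlinarith
    · rw [add_pow_char, show (algebraMap K L a₀ * y ^ i) ^ p + E ^ p - algebraMap K L a
        = ((algebraMap K L a₀ * y ^ i) ^ p - algebraMap K L (a₀ ^ p * α ^ i)) +
          (E ^ p - algebraMap K L (a - a₀ ^ p * α ^ i)) by rw [map_sub]; ring]
      refine AddValuation.map_le_add vL (le_val_of_le h2 ((min_le_left _ _).trans ?_))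
        (le_val_of_le hE3 (min_le_min_right _ ?_))
      · push_cast; nlinarith [sq_nonneg (p : ℤ)]
      · push_cast; nlinarith [sq_nonneg (p : ℤ)]

/-- For `a ∈ K` of valuation prime to `p` there is an `E ∈ K(y)` such that `E ^ p` is close to `a`;
both the distance and the amount by which `σ` moves `E` are known exactly. -/
theorem IsOneBreakExtension.exists_approx_eq [PerfectField F] (hK : IsLocalFieldOver F vK)
    (hL : IsOneBreakExtension p 2 vK vL b)
    {α : K} {y : L} {c : ℤ} (hc : 0 < c) (hpc : ¬ (p : ℤ) ∣ c)
    (hα : vK α = ((-c : ℤ) : WithTop ℤ))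
    (hy : y ^ p - y = algebraMap K L α) {σ : L ≃ₐ[K] L} (hσ : σ y = y + 1)
    {a : K} {w : ℤ} (hw : vK a = (w : WithTop ℤ)) (hpw : ¬ (p : ℤ) ∣ w) :
    ∃ E : L, (∀ τ : L ≃ₐ[K] L, τ y = y → τ E = E) ∧
      vL (σ E - E) = ((p * w + p * c : ℤ) : WithTop ℤ) ∧
      vL (E ^ p - algebraMap K L a) = ((p ^ 2 * w + (p - 1) * p * c : ℤ) : WithTop ℤ) := by
  have hp := (Fact.out : p.Prime)
  have hp0 : (0 : ℤ) < p := by exact_mod_cast hp.pos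
  have : CharP L p := charP_of_injective_algebraMap (algebraMap K L).injective p
  obtain ⟨a₀, i, hi, hv, hle, hi0⟩ := hK.exists_leading_monomial hpc hα hw
  obtain ⟨h1, h2⟩ := (hL.monomial_estimates hc hα hy hσ i hi hv).2.2 (hi0 hpw)
  -- with `N = w + 1 + c` the truncation error is negligible
  obtain ⟨E, hE1, hE2, hE3⟩ := hL.exists_approx hK hc hpc hα hy hσ (w + 1 + c) c.toNat _
    (le_val_of_le hle (by rw [Int.toNat_of_nonneg hc.le]; linarith))
  rw [Int.toNat_of_nonneg hc.le, add_sub_cancel_right] at hE2 hE3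
  refine ⟨algebraMap K L a₀ * y ^ i + E, fun τ hτ => ?_, ?_, ?_⟩
  · rw [map_add, map_mul, map_pow, hτ, hE1 τ hτ, AlgEquiv.commutes]
  · rw [map_add, add_sub_add_comm]
    exact val_add_eq h1 hE2 (by nlinarith)
  · rw [add_pow_char, show (algebraMap K L a₀ * y ^ i) ^ p + E ^ p - algebraMap K L a
        = ((algebraMap K L a₀ * y ^ i) ^ p - algebraMap K L (a₀ ^ p * α ^ i)) +
          (E ^ p - algebraMap K L (a - a₀ ^ p * α ^ i)) by rw [map_sub]; ring]
    refine val_add_eq h2 hE3 (lt_min ?_ ?_) <;> nlinarith [mul_pos hp0 hc, mul_pos hp0 hp0]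

end Approximation

/-! ### Generators of the extension and of its Galois group -/

section Generators

variable {p : ℕ} [Fact p.Prime] {F K L : Type*} [Field F] [Field K] [Algebra F K]
  [Field L] [Algebra K L]
  {vK : AddValuation K (WithTop ℤ)} {vL : AddValuation L (WithTop ℤ)} {b : ℤ}

omit [Fact p.Prime] in
theorem IsOneBreakExtension.gal_commute {n : ℕ} (hL : IsOneBreakExtension p n vK vL b)
    (σ τ : L ≃ₐ[K] L) : σ * τ = τ * σ := by
  obtain ⟨φ⟩ := hL.elementary
  exact φ.injective (by rw [map_mul, map_mul, mul_comm])

variable [CharP K p]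

/-- The Galois group acts on `(x 0, x 1)` by all translations by pairs of integers modulo `p`. -/
theorem IsOneBreakExtension.exists_gal_translation (hL : IsOneBreakExtension p 2 vK vL b)
    {α : Fin 2 → K} {x : Fin 2 → L} (hx : ∀ i, x i ^ p - x i = algebraMap K L (α i))
    (hgen : IntermediateField.adjoin K (Set.range x) = ⊤) :
    (∀ m : Fin 2 → ℕ, ∃ σ : L ≃ₐ[K] L, ∀ i, σ (x i) = x i + m i) ∧
    (∀ σ : L ≃ₐ[K] L, ∃ m : Fin 2 → ℕ, ∀ i, σ (x i) = x i + m i) ∧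
    (∀ σ τ : L ≃ₐ[K] L, (∀ i, σ (x i) = τ (x i)) → σ = τ) := by
  have := hL.finite
  have := hL.galois
  have : CharP L p := charP_of_injective_algebraMap (algebraMap K L).injective p
  have h1 : ∀ (σ : L ≃ₐ[K] L) (i : Fin 2), ∃ n : ℕ, σ (x i) = x i + n := by
    intro σ i
    have h2 : (σ (x i) - x i) ^ p = σ (x i) - x i := by
      have h3 := congrArg σ (hx i)
      rw [AlgEquiv.commutes, map_sub, map_pow, ← hx i] at h3
      rw [sub_pow_char]
      linear_combination h3
    obtain ⟨n, hn⟩ := exists_natCast_of_pow_eq_self h2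
    exact ⟨n, by rw [← hn]; ring⟩
  have hinj : ∀ σ τ : L ≃ₐ[K] L, (∀ i, σ (x i) = τ (x i)) → σ = τ := by
    intro σ τ h
    ext y
    have hy : y ∈ IntermediateField.adjoin K (Set.range x) := by rw [hgen]; trivial
    induction hy using IntermediateField.adjoin_induction with
    | mem y hy => obtain ⟨i, rfl⟩ := hy; exact h i
    | algebraMap y => rw [AlgEquiv.commutes, AlgEquiv.commutes]
    | add y z _ _ hy hz => rw [map_add, map_add, hy, hz]
    | inv y _ hy => rw [map_inv₀, map_inv₀, hy]
    | mul y z _ _ hy hz => rw [map_mul, map_mul, hy, hz]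
  refine ⟨fun m => ?_, fun σ => ⟨fun i => (h1 σ i).choose, fun i => (h1 σ i).choose_spec⟩, hinj⟩
  choose f hf using h1
  have hbij : Function.Bijective fun (σ : L ≃ₐ[K] L) (i : Fin 2) => (f σ i : ZMod p) := by
    rw [Nat.bijective_iff_injective_and_card]
    constructor
    · intro σ τ h
      refine hinj σ τ fun i => ?_
      have h2 := congrFun h i
      rw [ZMod.natCast_eq_natCast_iff] at h2
      rw [hf σ i, hf τ i, (CharP.natCast_eq_natCast L p).2 h2]
    · rw [IsGalois.card_aut_eq_finrank, hL.finrank_eq]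
      simp
  obtain ⟨σ, hσ⟩ := hbij.2 fun i => (m i : ZMod p)
  refine ⟨σ, fun i => ?_⟩
  have h2 := congrFun hσ i
  simp only at h2
  rw [ZMod.natCast_eq_natCast_iff] at h2
  rw [hf σ i, (CharP.natCast_eq_natCast L p).2 h2]

/-- `L = K(x₁, x₂)` with Artin-Schreier generators `x₁`, `x₂` for `β` and `w ^ (p ^ 2) β + ε`, and
`σ₁`, `σ₂` are the generators of the Galois group that are dual to `x₁`, `x₂`. -/
structure IsDualGenerators (p : ℕ) {F K L : Type*} [Field F] [Field K] [Algebra F K]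
    [Field L] [Algebra K L] (β : K) (w : F) (ε : K) (x₁ x₂ : L) (σ₁ σ₂ : L ≃ₐ[K] L) : Prop where
  root₁ : x₁ ^ p - x₁ = algebraMap K L β
  root₂ : x₂ ^ p - x₂ = algebraMap K L (algebraMap F K w ^ p ^ 2 * β + ε)
  map₁₁ : σ₁ x₁ = x₁ + 1
  map₁₂ : σ₁ x₂ = x₂
  map₂₁ : σ₂ x₁ = x₁
  map₂₂ : σ₂ x₂ = x₂ + 1
  generate : ∀ σ : L ≃ₐ[K] L, ∃ i j : ℕ, σ = σ₁ ^ i * σ₂ ^ j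

theorem IsArtinSchreierData.exists_dualGenerators (hL : IsOneBreakExtension p 2 vK vL b)
    {β : K} {ω : Fin 2 → F} {ε : Fin 2 → K} (hAS : IsArtinSchreierData p 2 L vK b β ω ε)
    (hω : ω 0 = 1) (hε : ε 0 = 0) :
    ∃ (x₁ x₂ : L) (σ₁ σ₂ : L ≃ₐ[K] L), IsDualGenerators p β (ω 1) (ε 1) x₁ x₂ σ₁ σ₂ := by
  obtain ⟨x, hx, hgen⟩ := hAS.generates
  obtain ⟨hex, hall, hinj⟩ := hL.exists_gal_translation hx hgen
  obtain ⟨σ₁, hσ₁⟩ := hex ![1, 0]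
  obtain ⟨σ₂, hσ₂⟩ := hex ![0, 1]
  have h10 : σ₁ (x 0) = x 0 + 1 := by simpa using hσ₁ 0
  have h11 : σ₁ (x 1) = x 1 := by simpa using hσ₁ 1
  have h20 : σ₂ (x 0) = x 0 := by simpa using hσ₂ 0
  have h21 : σ₂ (x 1) = x 1 + 1 := by simpa using hσ₂ 1
  refine ⟨x 0, x 1, σ₁, σ₂, ⟨?_, hx 1, h10, h11, h20, h21, fun σ => ?_⟩⟩
  · simpa [hω, hε] using hx 0
  · obtain ⟨m, hm⟩ := hall σ
    have pow_add : ∀ (τ : L ≃ₐ[K] L) (y : L) (a : ℕ), τ y = y + a → ∀ k : ℕ,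
        (τ ^ k) y = y + (k * a : ℕ) := by
      intro τ y a h k
      induction k with
      | zero => simp
      | succ k ih =>
        rw [pow_succ, AlgEquiv.mul_apply, h, map_add, ih, map_natCast]
        push_cast; ring
    refine ⟨m 0, m 1, hinj _ _ fun i => ?_⟩
    fin_cases i
    · have e1 := pow_add σ₂ (x 0) 0 (by simpa using h20) (m 1)
      have e2 := pow_add σ₁ (x 0) 1 (by simpa using h10) (m 0)
      simp only [mul_zero, Nat.cast_zero, add_zero, mul_one] at e1 e2
      exact (hm 0).trans (by rw [AlgEquiv.mul_apply]; exact (congrArg _ e1).trans e2 |>.symm)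
    · have e1 := pow_add σ₂ (x 1) 1 (by simpa using h21) (m 1)
      have e2 := pow_add σ₁ (x 1) 0 (by simpa using h11) (m 0)
      simp only [mul_zero, Nat.cast_zero, add_zero, mul_one] at e1 e2
      exact (hm 1).trans (by
        rw [AlgEquiv.mul_apply]
        exact ((congrArg _ e1).trans (by rw [map_add, e2, map_natCast])).symm)

/-! ### The element `X` of valuation `-b` -/

/-- If `ω 1` were in the prime field, then `x₂ - ω 1 x₁` would be an Artin-Schreier generator of a
subextension with a break smaller than `b`. -/
theorem IsArtinSchreierData.coeff_pow_ne [PerfectField F] (hK : IsLocalFieldOver F vK)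
    (hb : 0 < b) (hL : IsOneBreakExtension p 2 vK vL b)
    {β : K} {ω : Fin 2 → F} {ε : Fin 2 → K} (hAS : IsArtinSchreierData p 2 L vK b β ω ε)
    {x₁ x₂ : L} {σ₁ σ₂ : L ≃ₐ[K] L} (hG : IsDualGenerators p β (ω 1) (ε 1) x₁ x₂ σ₁ σ₂) :
    ω 1 ^ p ≠ ω 1 := by
  intro hw
  have hp := (Fact.out : p.Prime)
  have hp1 : (1 : ℤ) < p := by exact_mod_cast hp.one_lt
  have : CharP L p := charP_of_injective_algebraMap (algebraMap K L).injective p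
  have hpb := hL.not_dvd_break hb
  set w := algebraMap K L (algebraMap F K (ω 1)) with hwdef
  have hwp : w ^ p = w := by rw [hwdef, ← map_pow, ← map_pow, hw]
  set y := x₂ - w * x₁ with hydef
  have hy : y ^ p - y = algebraMap K L (ε 1) := by
    rw [hydef, sub_pow_char, mul_pow, hwp]
    have h2 := hG.root₂
    have h1 := hG.root₁
    rw [map_add, map_mul, map_pow, ← hwdef, show w ^ p ^ 2 = w by rw [pow_two, pow_mul, hwp, hwp],
      ← h1] at h2
    linear_combination h2
  have hσy : σ₂ y = y + 1 := by
    rw [hydef, map_sub, map_mul, hG.map₂₁, hG.map₂₂, AlgEquiv.commutes]; ring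
  rcases hAS.reduced 1 with ⟨m, hm, hm0, hpm⟩ | ⟨a, ha⟩
  · -- `x₁ - E` has valuation prime to `p`, but `σ₂` moves it by less than the break
    obtain ⟨E, hE1, hE2, hE3⟩ := hL.exists_approx_eq hK (c := -m) (by linarith)
      (by rwa [dvd_neg]) (by rw [neg_neg, hm]) hy hσy hAS.val_beta (by rwa [dvd_neg])
    have hbm : -b < m := WithTop.coe_lt_coe.1 (hm ▸ hAS.val_eps 1)
    have hx₁ := hL.val_artinSchreier_root hb hAS.val_beta hG.root₁
    have hY : vL ((x₁ - E) ^ p) = ((p ^ 2 * -b + (p - 1) * p * -m : ℤ) : WithTop ℤ) := by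
      rw [sub_pow_char, show x₁ ^ p - E ^ p = -(E ^ p - algebraMap K L β) + x₁ by
        rw [← hG.root₁]; ring]
      have h1 : (0 : ℤ) < p * ((p - 1) * (b + m)) :=
        mul_pos (by linarith) (mul_pos (by linarith) (by linarith))
      exact val_add_eq (val_neg_eq hE3) hx₁.ge (by linarith)
    obtain ⟨n, hn⟩ := exists_val_eq vL (x := x₁ - E) (by
      intro h0
      rw [h0, zero_pow hp.ne_zero, AddValuation.map_zero] at hY
      exact WithTop.top_ne_coe hY)
    have hn' : n = p * -b + (p - 1) * -m := by
      have := val_unique hY (val_pow_eq hn p)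
      exact mul_left_cancel₀ (by linarith : (p : ℤ) ≠ 0) (by linarith)
    have h3 := hL.le_val_gal_sub hb σ₂ hn.ge
    rw [map_sub σ₂, hG.map₂₁, show x₁ - σ₂ E - (x₁ - E) = -(σ₂ E - E) by ring] at h3
    have h4 := le_of_le_val (val_neg_eq hE2) h3
    nlinarith
  · have h1 : ((0 : ℤ) : WithTop ℤ) ≤ vL y := by
      by_cases h0 : y = 0
      · simp [h0]
      obtain ⟨n, hn⟩ := exists_val_eq vL h0
      refine le_val_of_eq hn ?_
      by_contra! hn0
      have h2 := val_sub_eq (val_pow_eq hn p) hn.ge (by nlinarith)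
      rw [hy, ← ha] at h2
      have h3 := le_of_le_val h2 (m := 0) (by
        simpa using hL.le_val_algebraMap (m := 0) (hK.coeff_integral a))
      nlinarith
    have h2 := hL.le_val_gal_sub hb σ₂ h1
    rw [hσy, add_sub_cancel_left, AddValuation.map_one] at h2
    have h3 : 0 + b ≤ 0 := WithTop.coe_le_coe.1 h2
    linarith

/-- The approximation `E` of a `p`-th root of `ε 1`, and the second refined break in terms of the
amount by which `σ₁` moves `E`. -/
theorem IsArtinSchreierData.exists_approx_root [PerfectField F] (hK : IsLocalFieldOver F vK)
    (hb : 0 < b) (hL : IsOneBreakExtension p 2 vK vL b)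
    {β : K} {ω : Fin 2 → F} {ε : Fin 2 → K} (hAS : IsArtinSchreierData p 2 L vK b β ω ε)
    {x₁ x₂ : L} {σ₁ σ₂ : L ≃ₐ[K] L} (hG : IsDualGenerators p β (ω 1) (ε 1) x₁ x₂ σ₁ σ₂) :
    ∃ (E : L) (s : ℤ), σ₂ E = E ∧
      ((-(p * b) + 1 : ℤ) : WithTop ℤ) ≤ vL (E ^ p - algebraMap K L (ε 1)) ∧
      bStar p vK b (ε 1) = (s : WithTop ℤ) ∧
      ((s = p * b ∧ ((s - b + 1 : ℤ) : WithTop ℤ) ≤ vL (σ₁ E - E)) ∨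
        (b < s ∧ s < p * b ∧ (p : ℤ) ∣ s - b ∧ vL (σ₁ E - E) = ((s - b : ℤ) : WithTop ℤ))) := by
  have hp := (Fact.out : p.Prime)
  have hp1 : (1 : ℤ) < p := by exact_mod_cast hp.one_lt
  have hpb := hL.not_dvd_break hb
  rcases hAS.reduced 1 with ⟨m, hm, hm0, hpm⟩ | ⟨a, ha⟩
  · obtain ⟨E, hE1, hE2, hE3⟩ := hL.exists_approx_eq hK hb hpb hAS.val_beta hG.root₁ hG.map₁₁
      hm hpm
    have hbm : -b < m := WithTop.coe_lt_coe.1 (hm ▸ hAS.val_eps 1)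
    have hstar : bStar p vK b (ε 1) = ((min (p * (b + m) + b) (b * p) : ℤ) : WithTop ℤ) := by
      rw [bStar, hm, ← WithTop.coe_add, ← WithTop.coe_nsmul, ← WithTop.coe_add, ← WithTop.coe_min,
        nsmul_eq_mul]
    refine ⟨E, _, hE1 σ₂ hG.map₂₁, le_val_of_eq hE3 (by nlinarith), hstar, ?_⟩
    have hpos : 0 < p * (b + m) := mul_pos (by linarith) (by linarith)
    have hne : p * (b + m) + b ≠ b * p := by
      intro h
      exact hpb ⟨b - (b + m), by linarith⟩
    rcases lt_or_gt_of_ne hne with h | h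
    · rw [min_eq_left h.le]
      refine Or.inr ⟨by linarith, by linarith, ⟨b + m, by ring⟩, ?_⟩
      rw [hE2]
      congr 1; ring
    · rw [min_eq_right h.le]
      exact Or.inl ⟨by ring, le_val_of_eq hE2 (by linarith)⟩
  · refine ⟨0, p * b, by simp, ?_, ?_, Or.inl ⟨rfl, by simp⟩⟩
    · rw [zero_pow hp.ne_zero, zero_sub, AddValuation.map_neg, ← ha]
      refine le_val_of_le (hL.le_val_algebraMap (m := 0) (hK.coeff_integral a)) (by nlinarith)
    · by_cases ha0 : a = 0
      · subst ha0
        rw [map_zero] at ha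
        rw [bStar, ← ha, AddValuation.map_zero, mul_comm]
        obtain ⟨q, rfl⟩ := Nat.exists_eq_succ_of_ne_zero hp.ne_zero
        simp [succ_nsmul]
      · rw [bStar, ← ha, hK.val_coeff_eq_zero ha0, ← WithTop.coe_add, ← WithTop.coe_nsmul,
          ← WithTop.coe_add, ← WithTop.coe_min, nsmul_eq_mul]
        congr 1
        rw [min_eq_right] <;> linarith

/-- The element `X = x₂ - (ω 1) ^ p x₁ - E`. It generates `L` over `K(x₁)`, and since its valuation
is prime to `p`, the action of the Galois group on it determines the refined breaks. -/
theorem IsArtinSchreierData.exists_generator [PerfectField F] (hK : IsLocalFieldOver F vK)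
    (hb : 0 < b) (hL : IsOneBreakExtension p 2 vK vL b)
    {β : K} {ω : Fin 2 → F} {ε : Fin 2 → K} (hAS : IsArtinSchreierData p 2 L vK b β ω ε)
    {x₁ x₂ : L} {σ₁ σ₂ : L ≃ₐ[K] L} (hG : IsDualGenerators p β (ω 1) (ε 1) x₁ x₂ σ₁ σ₂) :
    ∃ (X μ : L) (s : ℤ), vL X = ((-b : ℤ) : WithTop ℤ) ∧ σ₂ X = X + 1 ∧
      σ₁ X = X - algebraMap K L (algebraMap F K (ω 1 ^ p)) - μ ∧ σ₂ μ = μ ∧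
      bStar p vK b (ε 1) = (s : WithTop ℤ) ∧
      ((s = p * b ∧ ((s - b + 1 : ℤ) : WithTop ℤ) ≤ vL μ) ∨
        (b < s ∧ s < p * b ∧ (p : ℤ) ∣ s - b ∧ vL μ = ((s - b : ℤ) : WithTop ℤ))) := by
  have hp := (Fact.out : p.Prime)
  have hp1 : (1 : ℤ) < p := by exact_mod_cast hp.one_lt
  have : CharP L p := charP_of_injective_algebraMap (algebraMap K L).injective p
  have : CharP F p := (algebraMap F K).charP (algebraMap F K).injective p
  obtain ⟨E, s, hE, hE2, hs, hμ⟩ := hAS.exists_approx_root hK hb hL hG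
  have hx₁ := hL.val_artinSchreier_root hb hAS.val_beta hG.root₁
  set w := algebraMap K L (algebraMap F K (ω 1)) with hwdef
  have hw : algebraMap K L (algebraMap F K (ω 1 ^ p)) = w ^ p := by rw [hwdef, map_pow, map_pow]
  have hroot₂ := hG.root₂
  rw [map_add, map_mul, map_pow, ← hwdef, ← hG.root₁, pow_two, pow_mul] at hroot₂
  -- the leading term of `X ^ p`
  have hlead : vL ((w ^ p - (w ^ p) ^ p) * x₁) = ((-(p * b) : ℤ) : WithTop ℤ) := by
    have h1 : ω 1 ^ p - (ω 1 ^ p) ^ p ≠ 0 := by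
      rw [← sub_pow_char]
      exact pow_ne_zero _ (sub_ne_zero.2 (hAS.coeff_pow_ne hK hb hL hG).symm)
    have h2 := hL.val_algebraMap (hK.val_coeff_eq_zero h1)
    rw [map_sub, map_sub, map_pow _ (ω 1 ^ p), map_pow _ (algebraMap F K (ω 1 ^ p)), hw,
      mul_zero] at h2
    rw [val_mul_eq h2 hx₁, zero_add]
  have hε : ((p ^ 2 * (-b + 1) : ℤ) : WithTop ℤ) ≤ vL (algebraMap K L (ε 1)) := by
    have h1 := hL.le_val_algebraMap (lt_val_iff.1 (hAS.val_eps 1))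
    rw [hL.finrank_eq] at h1
    exact_mod_cast h1
  have hy : ((-(p * b) + 1 : ℤ) : WithTop ℤ) ≤ vL (x₂ - w ^ p * x₁) := by
    by_cases h0 : x₂ - w ^ p * x₁ = 0
    · simp [h0]
    obtain ⟨m, hm⟩ := exists_val_eq vL h0
    refine le_val_of_eq hm ?_
    by_contra! hlt
    have hpb : 0 < p * b := mul_pos (by linarith) hb
    have h1 : (x₂ - w ^ p * x₁) ^ p
        = (x₂ - w ^ p * x₁) + ((w ^ p - (w ^ p) ^ p) * x₁ + algebraMap K L (ε 1)) := by
      rw [sub_pow_char, mul_pow]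
      linear_combination hroot₂
    have h2 := le_of_le_val (val_pow_eq hm p) (m := p * m + 1) (by
      rw [h1]
      refine AddValuation.map_le_add vL (le_val_of_eq hm ?_) (AddValuation.map_le_add vL
        (le_val_of_eq hlead ?_) (le_val_of_le hε ?_)) <;> nlinarith)
    linarith
  have hXp : vL ((x₂ - w ^ p * x₁ - E) ^ p) = ((-(p * b) : ℤ) : WithTop ℤ) := by
    have h1 : (x₂ - w ^ p * x₁ - E) ^ p = (w ^ p - (w ^ p) ^ p) * x₁ +
        ((x₂ - w ^ p * x₁) - (E ^ p - algebraMap K L (ε 1))) := by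
      rw [sub_pow_char, sub_pow_char, mul_pow]
      linear_combination hroot₂
    rw [h1]
    exact val_add_eq hlead (AddValuation.map_le_sub vL hy hE2) (by linarith)
  refine ⟨x₂ - w ^ p * x₁ - E, σ₁ E - E, s, ?_, ?_, ?_, ?_, hs, hμ⟩
  · obtain ⟨n, hn⟩ := exists_val_eq vL (x := x₂ - w ^ p * x₁ - E) (by
      intro h0
      rw [h0, zero_pow hp.ne_zero, AddValuation.map_zero] at hXp
      exact WithTop.top_ne_coe hXp)
    rw [hn, show n = -b from mul_left_cancel₀ (by linarith : (p : ℤ) ≠ 0) (by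
      linarith [val_unique hXp (val_pow_eq hn p)])]
  · rw [map_sub, map_sub, map_mul, hE, hG.map₂₂, hG.map₂₁, ← hw, AlgEquiv.commutes]; ring
  · rw [map_sub, map_sub, map_mul, hG.map₁₂, hG.map₁₁, ← hw, AlgEquiv.commutes]; ring
  · rw [map_sub, hE, ← AlgEquiv.mul_apply, hL.gal_commute, AlgEquiv.mul_apply, hE]

end Generators

/-! ### Binomial coefficients in fields of characteristic `p` -/

section Binomial

variable {M : Type*} [Field M]

theorem fieldBinom_zero (w : M) : fieldBinom w 0 = 1 := by simp [fieldBinom]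

theorem fieldBinom_one (w : M) : fieldBinom w 1 = w := by simp [fieldBinom]

theorem fieldBinom_succ (w : M) (i : ℕ) :
    fieldBinom w (i + 1) = fieldBinom w i * (w - i) * ((i + 1 : ℕ) : M)⁻¹ := by
  rw [fieldBinom, fieldBinom, Finset.prod_range_succ, Nat.factorial_succ, Nat.cast_mul,
    div_eq_mul_inv, div_eq_mul_inv, mul_inv]
  ring

theorem map_fieldBinom {M' : Type*} [Field M'] (f : M →+* M') (w : M) (i : ℕ) :
    f (fieldBinom w i) = fieldBinom (f w) i := by
  simp [fieldBinom, map_div₀, map_prod]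

theorem natCast_ne_zero_of_lt {p : ℕ} [CharP M p] {i : ℕ} (hi : i + 1 < p) :
    ((i + 1 : ℕ) : M) ≠ 0 := fun h =>
  Nat.not_dvd_of_pos_of_lt (Nat.succ_pos i) hi ((CharP.cast_eq_zero_iff M p _).1 h)

theorem fieldBinom_natCast {p : ℕ} [CharP M p] (n : ℕ) {i : ℕ} (hi : i < p) :
    fieldBinom (n : M) i = (n.choose i : M) := by
  induction i with
  | zero => simp [fieldBinom_zero]
  | succ i ih =>
    have h0 := natCast_ne_zero_of_lt (M := M) hi
    rw [fieldBinom_succ, ih (Nat.lt_of_succ_lt hi), mul_inv_eq_iff_eq_mul₀ h0, ← Nat.cast_mul,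
      Nat.choose_succ_right_eq, Nat.cast_mul]
    rcases le_or_gt i n with h | h
    · rw [Nat.cast_sub h]
    · rw [Nat.choose_eq_zero_of_lt h]; simp

theorem fieldBinom_add_one {p : ℕ} [CharP M p] (w : M) {i : ℕ} (hi : i + 1 < p) :
    fieldBinom (w + 1) (i + 1) = fieldBinom w (i + 1) + fieldBinom w i := by
  induction i with
  | zero => simp [fieldBinom_zero, fieldBinom_one]
  | succ i ih =>
    have h0 := natCast_ne_zero_of_lt (M := M) hi
    have h1 := natCast_ne_zero_of_lt (M := M) (Nat.lt_of_succ_lt hi)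
    rw [fieldBinom_succ (w + 1) (i + 1), ih (Nat.lt_of_succ_lt hi), fieldBinom_succ w (i + 1),
      fieldBinom_succ w i]
    push_cast at h0 h1 ⊢
    field_simp
    ring

theorem fieldBinom_eq_smeval (w : M) (i : ℕ) :
    fieldBinom w i = (descPochhammer ℤ i).smeval w * ((i.factorial : ℕ) : M)⁻¹ := by
  rw [fieldBinom, div_eq_mul_inv]
  congr 1
  induction i with
  | zero => simp
  | succ i ih =>
    rw [Finset.prod_range_succ, ih, descPochhammer_succ_right, Polynomial.smeval_mul,
      Polynomial.smeval_sub, Polynomial.smeval_X, Polynomial.smeval_natCast]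
    simp

/-- Vandermonde's identity. -/
theorem fieldBinom_add {p : ℕ} [Fact p.Prime] [CharP M p] (u w : M) {m : ℕ} (hm : m < p) :
    fieldBinom (u + w) m
      = ∑ ij ∈ Finset.HasAntidiagonal.antidiagonal m, fieldBinom u ij.1 * fieldBinom w ij.2 := by
  rw [fieldBinom_eq_smeval, Ring.descPochhammer_smeval_add m (Commute.all u w), Finset.sum_mul]
  refine Finset.sum_congr rfl fun ij hij => ?_
  have hij' := Finset.HasAntidiagonal.mem_antidiagonal.1 hij
  have hf : ∀ k < p, ((k.factorial : ℕ) : M) ≠ 0 := fun k hk h =>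
    hk.not_ge (((Fact.out : p.Prime).dvd_factorial).1 ((CharP.cast_eq_zero_iff M p _).1 h))
  rw [fieldBinom_eq_smeval, fieldBinom_eq_smeval]
  have h1 := hf ij.1 (by omega)
  have h2 := hf ij.2 (by omega)
  have h3 := hf m hm
  have h4 : ((m.choose ij.1 : ℕ) : M) * (ij.1.factorial * ij.2.factorial) = m.factorial := by
    rw [← Nat.choose_mul_factorial_mul_factorial (show ij.1 ≤ m by omega),
      show m - ij.1 = ij.2 by omega]
    push_cast; ring
  rw [← h4] at h3 ⊢
  have h5 := left_ne_zero_of_mul h3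
  field_simp

variable {v : AddValuation M (WithTop ℤ)} {p : ℕ} [Fact p.Prime] [CharP M p]

theorem val_natCast_inv {i : ℕ} (hi : i + 1 < p) :
    v ((i + 1 : ℕ) : M)⁻¹ = ((0 : ℤ) : WithTop ℤ) := by
  have h := val_inv_eq (val_natCast_eq_zero v p (Nat.not_dvd_of_pos_of_lt (Nat.succ_pos i) hi))
  rwa [neg_zero] at h

theorem val_fieldBinom {Z : M} {b : ℤ} (hb : 0 < b) (hZ : v Z = ((-b : ℤ) : WithTop ℤ)) {i : ℕ}
    (hi : i < p) : v (fieldBinom Z i) = ((-(i * b) : ℤ) : WithTop ℤ) := by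
  induction i with
  | zero => simp [fieldBinom_zero]
  | succ i ih =>
    rw [fieldBinom_succ, val_mul_eq (val_mul_eq (ih (Nat.lt_of_succ_lt hi))
      (val_sub_eq hZ (val_natCast_nonneg v i) (by linarith))) (val_natCast_inv hi)]
    congr 1
    push_cast; ring

theorem le_val_fieldBinom {d : M} {c : ℤ} (hc : 0 ≤ c) (hd : (c : WithTop ℤ) ≤ v d) {i : ℕ}
    (hi : i + 1 < p) : (c : WithTop ℤ) ≤ v (fieldBinom d (i + 1)) := by
  induction i with
  | zero => simpa [fieldBinom_one] using hd
  | succ i ih =>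
    rw [fieldBinom_succ]
    have h1 := le_val_mul (le_val_mul (ih (Nat.lt_of_succ_lt hi))
      (AddValuation.map_le_sub v (le_val_of_le hd hc) (val_natCast_nonneg v (i + 1))))
      (val_natCast_inv (v := v) hi).ge
    simpa using h1

/-- The effect of a small change of a variable of negative valuation on a binomial coefficient. -/
theorem val_fieldBinom_add_sub {Z d : M} {b c : ℤ} (hb : 0 < b)
    (hZ : v Z = ((-b : ℤ) : WithTop ℤ)) (hc : 0 ≤ c) (hd : (c : WithTop ℤ) ≤ v d) {i : ℕ}
    (hi : i + 1 < p) :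
    ((c - i * b : ℤ) : WithTop ℤ) ≤ v (fieldBinom (Z + d) (i + 1) - fieldBinom Z (i + 1)) ∧
      (v d = (c : WithTop ℤ) →
        v (fieldBinom (Z + d) (i + 1) - fieldBinom Z (i + 1))
          = ((c - i * b : ℤ) : WithTop ℤ)) := by
  have h1 : fieldBinom (Z + d) (i + 1) - fieldBinom Z (i + 1) = d * fieldBinom Z i +
      ∑ j ∈ Finset.range i, fieldBinom d (j + 1 + 1) * fieldBinom Z (i + 1 - (j + 1 + 1)) := by
    rw [add_comm Z d, fieldBinom_add d Z hi, Finset.Nat.sum_antidiagonal_eq_sum_range_succ_mk,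
      Finset.sum_range_succ', Finset.sum_range_succ']
    simp only [fieldBinom_zero, fieldBinom_one, zero_add, Nat.add_sub_cancel, Nat.sub_zero]
    ring
  have h2 : ((c - i * b + 1 : ℤ) : WithTop ℤ) ≤ v (∑ j ∈ Finset.range i,
      fieldBinom d (j + 1 + 1) * fieldBinom Z (i + 1 - (j + 1 + 1))) := by
    refine AddValuation.map_le_sum v fun j hj => ?_
    have hj' := Finset.mem_range.1 hj
    refine le_val_of_le (le_val_mul (le_val_fieldBinom hc hd (by omega))
      (val_fieldBinom hb hZ (by omega)).ge) ?_
    have h3 : ((i + 1 - (j + 1 + 1) : ℕ) : ℤ) + 1 ≤ i := by omega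
    nlinarith
  have h3 := val_fieldBinom hb hZ (Nat.lt_of_succ_lt hi)
  rw [h1]
  constructor
  · exact AddValuation.map_le_add v (le_val_mul hd h3.ge) (le_val_of_le h2 (by linarith))
  · intro hd'
    exact val_add_eq (val_mul_eq hd' h3) h2 (by linarith)

end Binomial

/-! ### The operator `σ₁ σ₂^[ω]` -/

section Scaffold

variable {p : ℕ} {F K L : Type*} [Field F] [Field K] [Algebra F K]
  [Field L] [Algebra K L]

/-- Elements `x₁`, `X` of `L` on which the generators `σ₁`, `σ₂` act by explicit translations.
Here `w ∈ F`, and `μ` is the part of the translation of `X` by `σ₁` that is not in `F`; it is small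
and determines `s`, which is going to be the second refined break. -/
structure IsScaffold (p : ℕ) {F K L : Type*} [Field F] [Field K] [Algebra F K]
    [Field L] [Algebra K L] (vL : AddValuation L (WithTop ℤ)) (b s : ℤ) (x₁ X μ : L) (w : F)
    (σ₁ σ₂ : L ≃ₐ[K] L) : Prop where
  pos : 0 < b
  not_dvd : ¬ (p : ℤ) ∣ b
  val_x₁ : vL x₁ = ((-(p * b) : ℤ) : WithTop ℤ)
  val_X : vL X = ((-b : ℤ) : WithTop ℤ)
  map₁_x₁ : σ₁ x₁ = x₁ + 1
  map₂_x₁ : σ₂ x₁ = x₁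
  map₂_X : σ₂ X = X + 1
  map₁_X : σ₁ X = X - algebraMap K L (algebraMap F K w) - μ
  map₂_μ : σ₂ μ = μ
  val_μ : (s = p * b ∧ ((s - b + 1 : ℤ) : WithTop ℤ) ≤ vL μ) ∨
    (b < s ∧ s < p * b ∧ (p : ℤ) ∣ s - b ∧ vL μ = ((s - b : ℤ) : WithTop ℤ))

/-- The operator `σ₁ σ₂^[w]` on `L`, where `σ₂^[w]` is the truncated power. -/
noncomputable def scaffoldOperator (p : ℕ) (w : F) (σ₁ σ₂ : L ≃ₐ[K] L) : Module.End K L :=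
  (∑ m ∈ Finset.range p,
    algebraMap F K (fieldBinom w m) • (σ₂.toLinearMap - 1 : Module.End K L) ^ m) * σ₁.toLinearMap

theorem sub_one_pow_mul_fieldBinom [CharP L p] {σ : L ≃ₐ[K] L} {a Z : L} (ha : σ a = a)
    (hZ : σ Z = Z + 1) {i : ℕ} (hi : i < p) (m : ℕ) :
    ((σ.toLinearMap - 1 : Module.End K L) ^ m) (a * fieldBinom Z i)
      = if m ≤ i then a * fieldBinom Z (i - m) else 0 := by
  induction m generalizing i with
  | zero => simp
  | succ m ih =>
    rw [pow_succ, Module.End.mul_apply]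
    have h1 : (σ.toLinearMap - 1 : Module.End K L) (a * fieldBinom Z i)
        = a * (fieldBinom (Z + 1) i - fieldBinom Z i) := by
      change σ (a * fieldBinom Z i) - a * fieldBinom Z i = _
      have h2 : σ (fieldBinom Z i) = fieldBinom (σ Z) i := map_fieldBinom (σ : L →+* L) Z i
      rw [map_mul, ha, h2, hZ, mul_sub]
    rw [h1]
    cases i with
    | zero => simp [fieldBinom_zero]
    | succ i =>
      rw [fieldBinom_add_one Z hi, add_sub_cancel_left, ih (Nat.lt_of_succ_lt hi)]
      simp

/-- `σ₁ σ₂^[w]` translates the two variables separately: it maps `x₁` to `x₁ + 1`, and the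
translation of `X` by `-w` cancels against `σ₂^[w]`, so that only `-μ` is left. -/
theorem IsScaffold.scaffoldOperator_apply [Fact p.Prime] [CharP L p]
    {vL : AddValuation L (WithTop ℤ)} {b s : ℤ}
    {x₁ X μ : L} {w : F} {σ₁ σ₂ : L ≃ₐ[K] L} (hS : IsScaffold p vL b s x₁ X μ w σ₁ σ₂)
    {i : ℕ} (hi : i < p) (j : ℕ) :
    scaffoldOperator p w σ₁ σ₂ (x₁ ^ j * fieldBinom X i)
      = (x₁ + 1) ^ j * fieldBinom (X - μ) i := by
  set c := algebraMap K L (algebraMap F K w) with hc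
  have h1 : σ₁ (x₁ ^ j * fieldBinom X i) = (x₁ + 1) ^ j * fieldBinom (X - c - μ) i := by
    have h2 : σ₁ (fieldBinom X i) = fieldBinom (σ₁ X) i := map_fieldBinom (σ₁ : L →+* L) X i
    rw [map_mul, map_pow, hS.map₁_x₁, h2, hS.map₁_X]
  have h3 : σ₂ ((x₁ + 1) ^ j) = (x₁ + 1) ^ j := by rw [map_pow, map_add, hS.map₂_x₁, map_one]
  have h4 : σ₂ (X - c - μ) = (X - c - μ) + 1 := by
    rw [map_sub, map_sub, hS.map₂_X, hS.map₂_μ, hc, AlgEquiv.commutes]; ring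
  rw [scaffoldOperator, Module.End.mul_apply, AlgEquiv.toLinearMap_apply, h1,
    LinearMap.sum_apply, show X - μ = c + (X - c - μ) by ring, fieldBinom_add (p := p) _ _ hi,
    Finset.Nat.sum_antidiagonal_eq_sum_range_succ_mk, Finset.mul_sum]
  rw [← Finset.sum_subset (Finset.range_subset_range.2 (Nat.succ_le_of_lt hi))]
  · refine Finset.sum_congr rfl fun m hm => ?_
    have hm' : m ≤ i := Nat.lt_succ_iff.1 (Finset.mem_range.1 hm)
    rw [LinearMap.smul_apply, sub_one_pow_mul_fieldBinom h3 h4 hi, if_pos hm', Algebra.smul_def,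
      ← RingHom.comp_apply, map_fieldBinom, hc, RingHom.comp_apply]
    ring
  · intro m _ hm
    rw [LinearMap.smul_apply, sub_one_pow_mul_fieldBinom h3 h4 hi, if_neg, smul_zero]
    simpa [Nat.lt_succ_iff] using hm

/-- The valuations `-(p j + i) b` of the elements `x₁ ^ j (X choose i)` are distinct modulo `p ^ 2`,
since `p` does not divide `b`. -/
theorem IsScaffold.isValuationBasis [Fact p.Prime] [CharP K p]
    {vK : AddValuation K (WithTop ℤ)} {vL : AddValuation L (WithTop ℤ)} {b s : ℤ}
    (hL : IsOneBreakExtension p 2 vK vL b)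
    {x₁ X μ : L} {w : F} {σ₁ σ₂ : L ≃ₐ[K] L} (hS : IsScaffold p vL b s x₁ X μ w σ₁ σ₂) :
    IsValuationBasis vL (p ^ 2) K
      (fun k : Fin p × Fin p => x₁ ^ (k.2 : ℕ) * fieldBinom X k.1)
      (fun k => -(p * b * (k.2 : ℕ)) - b * (k.1 : ℕ)) where
  val_base c hc := by
    obtain ⟨m, hm⟩ := exists_val_eq vK hc
    refine ⟨m, ?_⟩
    rw [hL.val_algebraMap hm, hL.finrank_eq]
    push_cast; rfl
  val_eq k := by
    have : CharP L p := charP_of_injective_algebraMap (algebraMap K L).injective p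
    rw [val_mul_eq (val_pow_eq hS.val_x₁ k.2) (val_fieldBinom hS.pos hS.val_X k.1.2)]
    congr 1; ring
  incongruent k l h := by
    have hp := (Fact.out : p.Prime)
    have hcop : IsCoprime ((p : ℤ) ^ 2) b :=
      IsCoprime.pow_left ((Nat.prime_iff_prime_int.1 hp).coprime_iff_not_dvd.2 hS.not_dvd)
    have h1 : ((p : ℤ) ^ 2) ∣ b * (((p * l.2 + l.1 : ℕ) : ℤ) - ((p * k.2 + k.1 : ℕ) : ℤ)) := by
      refine dvd_trans h (dvd_of_eq ?_)
      push_cast; ring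
    have h2 := hcop.dvd_of_dvd_mul_left h1
    have hlt : ∀ k : Fin p × Fin p, p * (k.2 : ℕ) + k.1 < p ^ 2 := by
      intro k
      nlinarith [k.1.2, k.2.2]
    have h3 : p * (k.2 : ℕ) + k.1 = p * l.2 + l.1 :=
      Nat.ModEq.eq_of_lt_of_lt ((Nat.modEq_iff_dvd (n := p ^ 2)).2 (by exact_mod_cast h2))
        (hlt k) (hlt l)
    have h4 : (k.1 : ℕ) = l.1 := by
      have := congrArg (· % p) h3
      simpa [Nat.mul_add_mod, Nat.mod_eq_of_lt] using this
    have h5 : (k.2 : ℕ) = l.2 := by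
      rw [h4] at h3
      exact Nat.eq_of_mul_eq_mul_left hp.pos (Nat.add_right_cancel h3)
    exact Prod.ext (Fin.ext h4) (Fin.ext h5)
  card_eq := by rw [hL.finrank_eq, Fintype.card_prod, Fintype.card_fin, sq]

/-- On the basis, `σ₁ σ₂^[w] - 1` raises the valuation by at least `s`, and by exactly `s` on basis
elements that involve both `x₁` and `X`: translating `x₁` contributes `p b`, translating `X`
contributes `v(μ) + b`. -/
theorem IsScaffold.val_scaffoldOperator_basis [Fact p.Prime] [CharP L p]
    {vL : AddValuation L (WithTop ℤ)} {b s : ℤ}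
    {x₁ X μ : L} {w : F} {σ₁ σ₂ : L ≃ₐ[K] L} (hS : IsScaffold p vL b s x₁ X μ w σ₁ σ₂)
    {i j : ℕ} (hi : i < p) (hj : j < p) :
    ((-(p * b * j) - b * i + s : ℤ) : WithTop ℤ) ≤
        vL ((x₁ + 1) ^ j * fieldBinom (X - μ) i - x₁ ^ j * fieldBinom X i) ∧
      (i ≠ 0 → j ≠ 0 → vL ((x₁ + 1) ^ j * fieldBinom (X - μ) i - x₁ ^ j * fieldBinom X i)
        = ((-(p * b * j) - b * i + s : ℤ) : WithTop ℤ)) := by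
  have hp1 : (1 : ℤ) < p := by exact_mod_cast (Fact.out : p.Prime).one_lt
  have hb := hS.pos
  have hpb : b < p * b := by nlinarith
  have hμ1 : ((1 : ℤ) : WithTop ℤ) ≤ vL μ := by
    rcases hS.val_μ with ⟨h1, h2⟩ | ⟨h1, -, -, h2⟩
    · exact le_val_of_le h2 (by linarith)
    · exact le_val_of_eq h2 (by linarith)
  have hXμ : vL (X - μ) = ((-b : ℤ) : WithTop ℤ) := val_sub_eq hS.val_X hμ1 (by linarith)
  -- the contribution of the translation of `x₁`
  have hA : ((-(p * b * j) - b * i + p * b : ℤ) : WithTop ℤ) ≤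
        vL (((x₁ + 1) ^ j - x₁ ^ j) * fieldBinom (X - μ) i) ∧
      (j ≠ 0 → vL (((x₁ + 1) ^ j - x₁ ^ j) * fieldBinom (X - μ) i)
        = ((-(p * b * j) - b * i + p * b : ℤ) : WithTop ℤ)) := by
    rcases j with _ | j
    · simp
    · have h1 := val_mul_eq (val_add_pow_sub_pow hS.val_x₁
        (show vL 1 = ((0 : ℤ) : WithTop ℤ) by simp) (by nlinarith) j
        (val_natCast_eq_zero vL p (Nat.not_dvd_of_pos_of_lt (Nat.succ_pos j) hj)))
        (val_fieldBinom hb hXμ hi)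
      rw [show (0 + j * -(p * b) + -(i * b) : ℤ) = -(p * b * (j + 1 : ℕ)) - b * i + p * b by
        push_cast; ring] at h1
      exact ⟨h1.ge, fun _ => h1⟩
  -- the contribution of the translation of `X`
  have hB : ∀ c : ℤ, 0 ≤ c → (c : WithTop ℤ) ≤ vL μ →
      ((-(p * b * j) - b * i + (c + b) : ℤ) : WithTop ℤ) ≤
        vL (x₁ ^ j * (fieldBinom (X - μ) i - fieldBinom X i)) ∧
      (i ≠ 0 → vL μ = (c : WithTop ℤ) → vL (x₁ ^ j * (fieldBinom (X - μ) i - fieldBinom X i))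
        = ((-(p * b * j) - b * i + (c + b) : ℤ) : WithTop ℤ)) := by
    intro c hc hμ
    rcases i with _ | i
    · simp [fieldBinom_zero]
    · obtain ⟨h1, h2⟩ := val_fieldBinom_add_sub (d := -μ) hb hS.val_X hc
        (by rwa [AddValuation.map_neg]) hi
      rw [← sub_eq_add_neg] at h1 h2
      have h3 := val_pow_eq hS.val_x₁ j
      constructor
      · refine le_val_of_le (le_val_mul h3.ge h1) (le_of_eq ?_)
        push_cast; ring
      · intro _ hμ'
        rw [val_mul_eq h3 (h2 (val_neg_eq hμ'))]
        congr 1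
        push_cast; ring
  rw [show (x₁ + 1) ^ j * fieldBinom (X - μ) i - x₁ ^ j * fieldBinom X i
    = ((x₁ + 1) ^ j - x₁ ^ j) * fieldBinom (X - μ) i
      + x₁ ^ j * (fieldBinom (X - μ) i - fieldBinom X i) by ring]
  rcases hS.val_μ with ⟨h1, h2⟩ | ⟨h1, h2, -, h3⟩
  · have hB' := (hB _ (by linarith) h2).1
    subst h1
    exact ⟨AddValuation.map_le_add vL hA.1 (le_val_of_le hB' (by linarith)),
      fun _ hj0 => val_add_eq (hA.2 hj0) hB' (by linarith)⟩
  · obtain ⟨hB1, hB2⟩ := hB _ (by linarith) h3.ge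
    rw [sub_add_cancel] at hB1 hB2
    refine ⟨AddValuation.map_le_add vL (le_val_of_le hA.1 (by linarith)) hB1,
      fun hi0 _ => ?_⟩
    rw [add_comm (((x₁ + 1) ^ j - x₁ ^ j) * fieldBinom (X - μ) i)]
    exact val_add_eq (hB2 hi0 h3) hA.1 (by linarith)

/-- `σ₁ σ₂^[w] - 1` raises all valuations by at least `s`, and the valuation of a valuation
criterion element by exactly `s`. -/
theorem IsScaffold.val_scaffoldOperator_sub [Fact p.Prime] [CharP K p]
    {vK : AddValuation K (WithTop ℤ)} {vL : AddValuation L (WithTop ℤ)} {b s : ℤ}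
    (hL : IsOneBreakExtension p 2 vK vL b)
    {x₁ X μ : L} {w : F} {σ₁ σ₂ : L ≃ₐ[K] L} (hS : IsScaffold p vL b s x₁ X μ w σ₁ σ₂)
    {x : L} {m : ℤ} (hx : vL x = (m : WithTop ℤ)) :
    ((m + s : ℤ) : WithTop ℤ) ≤ vL (scaffoldOperator p w σ₁ σ₂ x - x) ∧
      ((p : ℤ) ^ 2 ∣ m - b →
        vL (scaffoldOperator p w σ₁ σ₂ x - x) = ((m + s : ℤ) : WithTop ℤ)) := by
  have hp := (Fact.out : p.Prime)
  have : CharP L p := charP_of_injective_algebraMap (algebraMap K L).injective p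
  have : Nonempty (Fin p × Fin p) := ⟨(⟨0, hp.pos⟩, ⟨0, hp.pos⟩)⟩
  have hT : ∀ k : Fin p × Fin p, (scaffoldOperator p w σ₁ σ₂ - 1 : Module.End K L)
      (x₁ ^ (k.2 : ℕ) * fieldBinom X k.1) = (x₁ + 1) ^ (k.2 : ℕ) * fieldBinom (X - μ) k.1
        - x₁ ^ (k.2 : ℕ) * fieldBinom X k.1 := fun k => by
    rw [LinearMap.sub_apply, hS.scaffoldOperator_apply k.1.2, Module.End.one_apply]
  obtain ⟨h1, k, hk, h2⟩ := (hS.isValuationBasis hL).shift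
    (scaffoldOperator p w σ₁ σ₂ - 1 : Module.End K L) s
    (fun k => by
      rw [hT k]
      exact (hS.val_scaffoldOperator_basis k.1.2 k.2.2).1) hx
  refine ⟨h1, fun hm => h2 ?_⟩
  rw [hT k]
  -- the leading term of `x` is the one with exponents `p - 1`, `p - 1`
  have hcop : IsCoprime ((p : ℤ) ^ 2) b :=
    IsCoprime.pow_left ((Nat.prime_iff_prime_int.1 hp).coprime_iff_not_dvd.2 hS.not_dvd)
  have h3 : ((p : ℤ) ^ 2) ∣ b * ((p * k.2 + k.1 + 1 : ℕ) : ℤ) := by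
    refine dvd_trans (dvd_sub hk hm) (dvd_of_eq ?_)
    push_cast; ring
  have h4 : p ^ 2 ∣ p * k.2 + k.1 + 1 := by exact_mod_cast hcop.dvd_of_dvd_mul_left h3
  have h5 := Nat.le_of_dvd (Nat.succ_pos _) h4
  refine (hS.val_scaffoldOperator_basis k.1.2 k.2.2).2 ?_ ?_
  · intro h0
    have h6 : p ∣ p * k.2 + k.1 + 1 := dvd_trans (dvd_pow_self p two_ne_zero) h4
    rw [h0, add_zero, Nat.dvd_add_right (dvd_mul_right p _)] at h6
    exact hp.one_lt.ne' (Nat.dvd_one.1 h6)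
  · intro h0
    rw [h0, mul_zero, zero_add] at h5
    nlinarith [k.1.2, hp.one_lt]

end Scaffold

/-! ### Truncated powers in commutative algebras -/

section TruncatedPower

variable {F : Type*} [Field F]

/-- The truncated power `γ^[w]` in an arbitrary `F`-algebra; `truncPow` is the case of the group
ring, and the quotients of the group ring are needed too. -/
noncomputable def truncatedPower (p : ℕ) {R : Type*} [Ring R] [Algebra F R] (γ : R) (w : F) : R :=
  ∑ i ∈ Finset.range p, fieldBinom w i • (γ - 1) ^ i

theorem fieldBinom_zero_succ (i : ℕ) : fieldBinom (0 : F) (i + 1) = 0 := by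
  induction i with
  | zero => simp [fieldBinom_one]
  | succ i ih => rw [fieldBinom_succ, ih, zero_mul, zero_mul]

theorem map_truncatedPower (p : ℕ) {R S : Type*} [Ring R] [Algebra F R] [Ring S] [Algebra F S]
    (f : R →ₐ[F] S) (γ : R) (w : F) :
    f (truncatedPower p γ w) = truncatedPower p (f γ) w := by
  simp [truncatedPower]

variable {p : ℕ} {Q : Type*} [CommRing Q] [Algebra F Q]

/-- The first order term of a truncated power. -/
theorem exists_truncatedPower_eq [Fact p.Prime] (γ : Q) (w : F) :
    ∃ r : Q, truncatedPower p γ w = 1 + w • (γ - 1) + (γ - 1) ^ 2 * r := by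
  obtain ⟨q, rfl⟩ := Nat.exists_eq_add_of_le' (Fact.out : p.Prime).two_le
  refine ⟨∑ i ∈ Finset.range q, fieldBinom w (i + 2) • (γ - 1) ^ i, ?_⟩
  rw [truncatedPower, Finset.sum_range_succ', Finset.sum_range_succ', Finset.mul_sum]
  simp only [fieldBinom_zero, fieldBinom_one, pow_zero, zero_add, pow_one, one_smul, mul_smul_comm]
  have h : ∀ i, (γ - 1) ^ 2 * (γ - 1) ^ i = (γ - 1) ^ (i + 1 + 1) := fun i => by ring
  simp only [h]
  ring

theorem truncatedPower_zero [Fact p.Prime] (γ : Q) : truncatedPower p γ (0 : F) = 1 := by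
  obtain ⟨q, hq⟩ := Nat.exists_eq_succ_of_ne_zero (Fact.out : p.Prime).ne_zero
  rw [hq, truncatedPower, Finset.sum_range_succ']
  simp [fieldBinom_zero_succ, fieldBinom_zero]

theorem truncatedPower_sub_one_mem [Fact p.Prime] {I : Ideal Q} {γ : Q} (hγ : γ - 1 ∈ I) (w : F) :
    truncatedPower p γ w - 1 ∈ I := by
  obtain ⟨r, hr⟩ := exists_truncatedPower_eq (p := p) γ w
  rw [hr, show 1 + w • (γ - 1) + (γ - 1) ^ 2 * r - 1
    = (γ - 1) * (algebraMap F Q w + (γ - 1) * r) by rw [Algebra.smul_def]; ring]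
  exact I.mul_mem_right _ hγ

open Polynomial in
/-- A function of `c ∈ F` with values in `Q` that is given by a polynomial whose `i`-th coefficient
lies in `I ^ i`. -/
def IsReesFunction (I : Ideal Q) (f : F → Q) : Prop :=
  ∃ P ∈ reesAlgebra I, ∀ c : F, P.eval (algebraMap F Q c) = f c

namespace IsReesFunction

variable {I : Ideal Q} {f g : F → Q}

open Polynomial

theorem const (a : Q) : IsReesFunction I (fun _ : F => a) :=
  ⟨C a, (reesAlgebra I).algebraMap_mem a, fun _ => eval_C⟩

theorem mul (hf : IsReesFunction I f) (hg : IsReesFunction I g) :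
    IsReesFunction I (fun c => f c * g c) := by
  obtain ⟨P, hP, hPf⟩ := hf
  obtain ⟨P', hP', hPg⟩ := hg
  exact ⟨P * P', mul_mem hP hP', fun c => by rw [eval_mul, hPf, hPg]⟩

theorem sum {ι : Type*} (s : Finset ι) {f : ι → F → Q} (hf : ∀ i ∈ s, IsReesFunction I (f i)) :
    IsReesFunction I (fun c => ∑ i ∈ s, f i c) := by
  choose! P hP hPf using hf
  refine ⟨∑ i ∈ s, P i, sum_mem hP, fun c => ?_⟩
  rw [eval_finsetSum]
  exact Finset.sum_congr rfl fun i hi => hPf i hi c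

theorem fieldBinom_smul {z : Q} (hz : z ∈ I) (u v : F) (i : ℕ) :
    IsReesFunction I (fun c : F => fieldBinom (u * c + v) i • z ^ i) := by
  induction i with
  | zero => simpa [fieldBinom_zero] using const (1 : Q)
  | succ i ih =>
    have h1 : IsReesFunction I (fun c : F =>
        z * algebraMap F Q u * algebraMap F Q c + z * algebraMap F Q (v - i)) := by
      refine ⟨monomial 1 (z * algebraMap F Q u) + C (z * algebraMap F Q (v - i)),
        add_mem ?_ ((reesAlgebra I).algebraMap_mem _), fun c => by simp⟩
      rw [reesAlgebra.monomial_mem, pow_one]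
      exact I.mul_mem_right _ hz
    obtain ⟨P, hP, hPf⟩ := (ih.mul h1).mul (const (algebraMap F Q ((i + 1 : ℕ) : F)⁻¹))
    refine ⟨P, hP, fun c => ?_⟩
    rw [hPf]
    simp only
    rw [fieldBinom_succ, Algebra.smul_def, Algebra.smul_def]
    simp only [map_mul, map_sub, map_add]
    ring

theorem truncatedPower {γ : Q} (hγ : γ - 1 ∈ I) (u v : F) :
    IsReesFunction I (fun c : F => truncatedPower p γ (u * c + v)) :=
  sum _ fun i _ => fieldBinom_smul hγ u v i

/-- Interpolation: if `I ^ k = 0` and `k ≤ p`, then the polynomials in question have degree less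
than `k`, so they are determined by their values at `0, …, k - 1`. -/
theorem eq_of_natCast [CharP F p] {k : ℕ} (hk : k ≤ p) (hI : I ^ k = ⊥)
    (hf : IsReesFunction I f) (hg : IsReesFunction I g) (h : ∀ n : ℕ, f n = g n) (c : F) :
    f c = g c := by
  nontriviality Q
  obtain ⟨P, hP, hPf⟩ := hf
  obtain ⟨P', hP', hPg⟩ := hg
  have hdeg : (P - P').degree < k := by
    rw [degree_lt_iff_coeff_zero]
    intro m hm
    have h1 := Ideal.pow_le_pow_right hm (sub_mem hP hP' m)
    rwa [hI, Ideal.mem_bot] at h1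
  have hdvd : ∏ n ∈ Finset.range k, (X - C (n : Q)) ∣ P - P' := by
    refine Finset.prod_dvd_of_coprime ?_ ?_
    · intro m hm n hn hmn
      refine isCoprime_X_sub_C_of_isUnit_sub ?_
      have h1 : (m : F) - n ≠ 0 := by
        intro h0
        rw [sub_eq_zero, CharP.natCast_eq_natCast F p] at h0
        exact hmn (Nat.ModEq.eq_of_lt_of_lt h0
          ((Finset.mem_range.1 hm).trans_le hk) ((Finset.mem_range.1 hn).trans_le hk))
      simpa using (IsUnit.mk0 _ h1).map (algebraMap F Q)
    · intro n _
      rw [dvd_iff_isRoot, IsRoot, eval_sub, sub_eq_zero, ← map_natCast (algebraMap F Q), hPf, hPg,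
        h]
  have h0 : P - P' = 0 := by
    by_contra hne
    have hmonic : (∏ n ∈ Finset.range k, (X - C (n : Q))).Monic :=
      monic_prod_of_monic _ _ fun n _ => monic_X_sub_C (n : Q)
    have hprod : (∏ n ∈ Finset.range k, (X - C (n : Q))).degree = (k : WithBot ℕ) := by
      rw [degree_eq_natDegree hmonic.ne_zero,
        natDegree_prod_of_monic _ (fun n : ℕ => X - C (n : Q)) fun n _ => monic_X_sub_C (n : Q)]
      simp only [natDegree_X_sub_C, Finset.sum_const, Finset.card_range, smul_eq_mul, mul_one]
    exact hmonic.not_dvd_of_degree_lt hne (hprod ▸ hdeg) hdvd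
  rw [← hPf, ← hPg, sub_eq_zero.1 h0]

end IsReesFunction

section Nilpotent

variable [CharP F p] {k : ℕ} {I : Ideal Q}

theorem truncatedPower_natCast (hk : k ≤ p) (hI : I ^ k = ⊥) {γ : Q} (hγ : γ - 1 ∈ I) (n : ℕ) :
    truncatedPower p γ (n : F) = γ ^ n := by
  have hz : ∀ m, p ≤ m → (γ - 1) ^ m = 0 := by
    intro m hm
    have h1 := Ideal.pow_le_pow_right (hk.trans hm) (Ideal.pow_mem_pow hγ m)
    rwa [hI, Ideal.mem_bot] at h1
  have h1 : γ ^ n = ∑ m ∈ Finset.range (n + 1), (γ - 1) ^ m * (n.choose m : Q) := by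
    conv_lhs => rw [← sub_add_cancel γ 1, add_pow]
    simp
  have h2 : truncatedPower p γ (n : F) = ∑ m ∈ Finset.range p, (γ - 1) ^ m * (n.choose m : Q) := by
    refine Finset.sum_congr rfl fun i hi => ?_
    rw [fieldBinom_natCast n (Finset.mem_range.1 hi), Algebra.smul_def, map_natCast, mul_comm]
  rw [h1, h2]
  rcases le_total p (n + 1) with h | h
  · refine Finset.sum_subset (Finset.range_subset_range.2 h) fun m _ hm => ?_
    rw [hz m (by simpa using hm), zero_mul]
  · refine (Finset.sum_subset (Finset.range_subset_range.2 h) fun m _ hm => ?_).symm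
    rw [Nat.choose_eq_zero_of_lt (by simpa [Nat.succ_le_iff] using hm)]
    simp

/-- Both sides are polynomial in `u` and in `w`, so natural numbers suffice. -/
theorem truncatedPower_add (hk : k ≤ p) (hI : I ^ k = ⊥) {γ : Q} (hγ : γ - 1 ∈ I) (u w : F) :
    truncatedPower p γ (u + w) = truncatedPower p γ u * truncatedPower p γ w := by
  have h1 : ∀ (n : ℕ) (c : F),
      truncatedPower p γ (c + n) = truncatedPower p γ c * truncatedPower p γ (n : F) := by
    intro n c
    refine IsReesFunction.eq_of_natCast hk hI
      (f := fun c : F => truncatedPower p γ (c + n))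
      (g := fun c => truncatedPower p γ c * truncatedPower p γ (n : F)) ?_ ?_ (fun m => ?_) c
    · simpa using IsReesFunction.truncatedPower (p := p) hγ (1 : F) (n : F)
    · simpa using (IsReesFunction.truncatedPower (p := p) hγ (1 : F) 0).mul (.const _)
    · rw [← Nat.cast_add, truncatedPower_natCast hk hI hγ, truncatedPower_natCast hk hI hγ,
        truncatedPower_natCast hk hI hγ, pow_add]
  refine IsReesFunction.eq_of_natCast hk hI
      (f := fun c => truncatedPower p γ (u + c))
      (g := fun c => truncatedPower p γ u * truncatedPower p γ c) ?_ ?_ (fun m => h1 m u) w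
  · simpa [add_comm] using IsReesFunction.truncatedPower (p := p) hγ (1 : F) u
  · simpa using (IsReesFunction.const _).mul (IsReesFunction.truncatedPower (p := p) hγ (1 : F) 0)

theorem truncatedPower_one (hk : k ≤ p) (hI : I ^ k = ⊥) {γ : Q} (hγ : γ - 1 ∈ I) :
    truncatedPower p γ (1 : F) = γ := by
  simpa using truncatedPower_natCast (F := F) hk hI hγ 1

theorem truncatedPower_pow [Fact p.Prime] (hk : k ≤ p) (hI : I ^ k = ⊥) {γ : Q} (hγ : γ - 1 ∈ I)
    (u : F) (n : ℕ) :
    truncatedPower p γ u ^ n = truncatedPower p γ (u * n) := by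
  induction n with
  | zero => simp [truncatedPower_zero]
  | succ n ih =>
    rw [pow_succ, ih, ← truncatedPower_add hk hI hγ, Nat.cast_succ, mul_add, mul_one]

theorem mul_sub_one_mem {a c : Q} (ha : a - 1 ∈ I) (hc : c - 1 ∈ I) : a * c - 1 ∈ I := by
  rw [show a * c - 1 = (a - 1) * c + (c - 1) by ring]
  exact add_mem (I.mul_mem_right _ ha) hc

/-- The elements `τ^[u] σ^[w]` are closed under truncated powers. -/
theorem truncatedPower_mul_truncatedPower [Fact p.Prime] (hk : k ≤ p) (hI : I ^ k = ⊥) {τ σ : Q}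
    (hτ : τ - 1 ∈ I) (hσ : σ - 1 ∈ I) (u w c : F) :
    truncatedPower p (truncatedPower p τ u * truncatedPower p σ w) c
      = truncatedPower p τ (u * c) * truncatedPower p σ (w * c) := by
  have h1 := mul_sub_one_mem (truncatedPower_sub_one_mem (p := p) hτ u)
    (truncatedPower_sub_one_mem (p := p) hσ w)
  refine IsReesFunction.eq_of_natCast hk hI
    (f := fun c => truncatedPower p (truncatedPower p τ u * truncatedPower p σ w) c)
    (g := fun c => truncatedPower p τ (u * c) * truncatedPower p σ (w * c)) ?_ ?_ (fun n => ?_) c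
  · simpa using IsReesFunction.truncatedPower (p := p) h1 (1 : F) 0
  · have h2 := (IsReesFunction.truncatedPower (p := p) hτ u 0).mul
      (IsReesFunction.truncatedPower (p := p) hσ w 0)
    simpa only [add_zero] using h2
  · rw [truncatedPower_natCast hk hI h1, mul_pow, truncatedPower_pow hk hI hτ,
      truncatedPower_pow hk hI hσ]

end Nilpotent

end TruncatedPower

/-! ### Structure of the group ring -/

section CommutativeModel

variable {F : Type*} [Field F] {p : ℕ} [Fact p.Prime] [CharP F p] {R : Type*} [CommRing R]
  [Algebra F R]

open Polynomial

/-- If `R` is generated by `σ₁` and a unipotent `σ₂`, then modulo `σ₁ σ₂^[w] - 1` each element is a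
polynomial in `σ₂ - 1`. -/
theorem exists_aeval_add_mul {σ₁ σ₂ : R} (hσ₂ : (σ₂ - 1) ^ p = 0)
    (hadj : Algebra.adjoin F {σ₁, σ₂} = ⊤) (w : F) (r : R) :
    ∃ (f : F[X]) (r' : R),
      r = aeval (σ₂ - 1) f + (truncatedPower p σ₂ w * σ₁ - 1) * r' := by
  have hr : r ∈ Algebra.adjoin F {σ₁, σ₂} := by rw [hadj]; trivial
  induction hr using Algebra.adjoin_induction with
  | mem r hr =>
    rcases hr with rfl | rfl
    · have hI : (Ideal.span {σ₂ - 1}) ^ p = ⊥ := by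
        rw [Ideal.span_singleton_pow, hσ₂, Ideal.span_singleton_eq_bot]
      have h1 : truncatedPower p σ₂ (-w) * truncatedPower p σ₂ w = 1 := by
        rw [← truncatedPower_add le_rfl hI (Ideal.mem_span_singleton_self _), neg_add_cancel,
          truncatedPower_zero]
      refine ⟨∑ i ∈ Finset.range p, C (fieldBinom (-w) i) * X ^ i, truncatedPower p σ₂ (-w), ?_⟩
      have h2 : aeval (σ₂ - 1) (∑ i ∈ Finset.range p, C (fieldBinom (-w) i) * X ^ i)
          = truncatedPower p σ₂ (-w) := by
        simp [truncatedPower, Algebra.smul_def]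
      rw [h2]
      linear_combination -r * h1
    · exact ⟨X + 1, 0, by simp⟩
  | algebraMap c => exact ⟨C c, 0, by simp⟩
  | add x y _ _ hx hy =>
    obtain ⟨f, r, hf⟩ := hx
    obtain ⟨g, s, hg⟩ := hy
    exact ⟨f + g, r + s, by rw [map_add, hf, hg]; ring⟩
  | mul x y _ _ hx hy =>
    obtain ⟨f, r, hf⟩ := hx
    obtain ⟨g, s, hg⟩ := hy
    exact ⟨f * g, aeval (σ₂ - 1) f * s + r * aeval (σ₂ - 1) g
      + (truncatedPower p σ₂ w * σ₁ - 1) * r * s, by rw [map_mul, hf, hg]; ring⟩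

omit [Fact p.Prime] [CharP F p] in
/-- An element of the augmentation ideal `A` has the form `Ψ f(Ψ) + Θ r`. -/
theorem exists_eq_of_mem {A : Ideal R} {Ψ Θ : R} (hΨ : Ψ ∈ A) (hΘ : Θ ∈ A)
    (hA : ∀ c : F, algebraMap F R c ∈ A → c = 0)
    (hgen : ∀ r : R, ∃ (f : F[X]) (r' : R), r = aeval Ψ f + Θ * r') {a : R} (ha : a ∈ A) :
    ∃ (f : F[X]) (r : R), a = Ψ * aeval Ψ f + Θ * r := by
  obtain ⟨f, r, hf⟩ := hgen a
  have h1 : aeval Ψ f = Ψ * aeval Ψ f.divX + algebraMap F R (f.coeff 0) := by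
    have h := congrArg (aeval Ψ) (X_mul_divX_add f)
    rw [map_add, map_mul, aeval_X, aeval_C] at h
    exact h.symm
  have h2 : f.coeff 0 = 0 := by
    apply hA
    rw [show algebraMap F R (f.coeff 0) = a - Ψ * aeval Ψ f.divX - Θ * r by rw [hf, h1]; ring]
    exact sub_mem (sub_mem ha (A.mul_mem_right _ hΨ)) (A.mul_mem_right _ hΘ)
  exact ⟨f.divX, r, by rw [hf, h1, h2]; simp⟩

omit [Fact p.Prime] [CharP F p] in
/-- An element of `A ^ 2` has the form `Ψ ^ 2 f(Ψ) + Θ r` with `r ∈ A`. -/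
theorem exists_eq_of_mem_sq {A : Ideal R} {Ψ Θ : R} (hΨ : Ψ ∈ A) (hΘ : Θ ∈ A)
    (hA : ∀ c : F, algebraMap F R c ∈ A → c = 0)
    (hgen : ∀ r : R, ∃ (f : F[X]) (r' : R), r = aeval Ψ f + Θ * r') {a : R} (ha : a ∈ A ^ 2) :
    ∃ (f : F[X]) (r : R), r ∈ A ∧ a = Ψ ^ 2 * aeval Ψ f + Θ * r := by
  rw [pow_two] at ha
  induction ha using Submodule.mul_induction_on' with
  | mem_mul_mem x hx y hy =>
    obtain ⟨f, r, rfl⟩ := exists_eq_of_mem hΨ hΘ hA hgen hx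
    obtain ⟨g, s, rfl⟩ := exists_eq_of_mem hΨ hΘ hA hgen hy
    refine ⟨f * g, Ψ * (aeval Ψ f * s + r * aeval Ψ g) + Θ * (r * s),
      add_mem (A.mul_mem_right _ hΨ) (A.mul_mem_right _ hΘ), ?_⟩
    rw [map_mul]; ring
  | add x _ y _ hx hy =>
    obtain ⟨f, r, hr, rfl⟩ := hx
    obtain ⟨g, s, hs, rfl⟩ := hy
    exact ⟨f + g, r + s, add_mem hr hs, by rw [map_add]; ring⟩

omit [CharP F p] in
theorem truncatedPower_sub_one_eq_mul (γ : R) (w : F) :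
    ∃ r : R, truncatedPower p γ w - 1 = (γ - 1) * r := by
  obtain ⟨r, hr⟩ := exists_truncatedPower_eq (p := p) γ w
  exact ⟨algebraMap F R w + (γ - 1) * r, by rw [hr, Algebra.smul_def]; ring⟩

omit [CharP F p] in
/-- The first order terms of `τ^[u] σ^[w]`. -/
theorem truncatedPower_mul_sub_one {A : Ideal R} {τ σ : R} (hτ : τ - 1 ∈ A) (hσ : σ - 1 ∈ A)
    (u w : F) : ∃ a ∈ A ^ 2, truncatedPower p τ u * truncatedPower p σ w - 1
      = w • (σ - 1) + u • (τ - 1) + a := by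
  obtain ⟨r, hr⟩ := exists_truncatedPower_eq (p := p) τ u
  obtain ⟨s, hs⟩ := exists_truncatedPower_eq (p := p) σ w
  refine ⟨_, ?_, (add_sub_cancel _ _).symm⟩
  rw [hr, hs, Algebra.smul_def, Algebra.smul_def]
  have h1 := Ideal.pow_mem_pow hτ 2
  have h2 := Ideal.pow_mem_pow hσ 2
  have h3 : (τ - 1) * (σ - 1) ∈ A ^ 2 := by
    rw [pow_two]
    exact Ideal.mul_mem_mul hτ hσ
  rw [show (1 + algebraMap F R u * (τ - 1) + (τ - 1) ^ 2 * r) *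
        (1 + algebraMap F R w * (σ - 1) + (σ - 1) ^ 2 * s) - 1
        - (algebraMap F R w * (σ - 1) + algebraMap F R u * (τ - 1))
      = (τ - 1) ^ 2 * (r * (1 + algebraMap F R w * (σ - 1) + (σ - 1) ^ 2 * s))
        + (σ - 1) ^ 2 * (s * (1 + algebraMap F R u * (τ - 1)))
        + (τ - 1) * (σ - 1) * (algebraMap F R w * algebraMap F R u) by ring]
  exact add_mem (add_mem (Ideal.mul_mem_right _ _ h1) (Ideal.mul_mem_right _ _ h2))
    (Ideal.mul_mem_right _ _ h3)

section Quotient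

variable {A : Ideal R} {k : ℕ} (hk : k ≤ p) {τ σ : R} (hτ : τ - 1 ∈ A) (hσ : σ - 1 ∈ A)

omit [Fact p.Prime] [CharP F p] in
theorem map_mk_pow_eq_bot (A : Ideal R) (k : ℕ) :
    (A.map (Ideal.Quotient.mkₐ F (A ^ k))) ^ k = ⊥ := by
  rw [← Ideal.map_pow]
  exact Ideal.map_quotient_self _

omit [Fact p.Prime] [CharP F p] in
theorem mkₐ_sub_one_mem {A : Ideal R} (k : ℕ) {γ : R} (hγ : γ - 1 ∈ A) :
    Ideal.Quotient.mkₐ F (A ^ k) γ - 1 ∈ A.map (Ideal.Quotient.mkₐ F (A ^ k)) := by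
  rw [← map_one (Ideal.Quotient.mkₐ F (A ^ k)), ← map_sub]
  exact Ideal.mem_map_of_mem _ hγ

include hk hτ hσ

omit [Fact p.Prime] in
theorem truncatedPower_mul_mem (u w u' w' : F) :
    (truncatedPower p τ u * truncatedPower p σ w) * (truncatedPower p τ u' * truncatedPower p σ w')
      - truncatedPower p τ (u + u') * truncatedPower p σ (w + w') ∈ A ^ k := by
  rw [← Ideal.Quotient.mk_eq_mk_iff_sub_mem]
  change Ideal.Quotient.mkₐ F (A ^ k) _ = Ideal.Quotient.mkₐ F (A ^ k) _
  simp only [map_mul, map_truncatedPower]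
  have hI := map_mk_pow_eq_bot (F := F) A k
  rw [truncatedPower_add hk hI (mkₐ_sub_one_mem k hτ),
    truncatedPower_add hk hI (mkₐ_sub_one_mem k hσ)]
  ring

theorem truncatedPower_truncatedPower_mem {γ : R} {u w : F}
    (hγ : γ - truncatedPower p τ u * truncatedPower p σ w ∈ A ^ k) (c : F) :
    truncatedPower p γ c - truncatedPower p τ (u * c) * truncatedPower p σ (w * c) ∈ A ^ k := by
  rw [← Ideal.Quotient.mk_eq_mk_iff_sub_mem] at hγ ⊢
  change Ideal.Quotient.mkₐ F (A ^ k) _ = Ideal.Quotient.mkₐ F (A ^ k) _ at hγ ⊢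
  simp only [map_mul, map_truncatedPower] at hγ ⊢
  rw [hγ, truncatedPower_mul_truncatedPower hk (map_mk_pow_eq_bot (F := F) A k)
    (mkₐ_sub_one_mem k hτ) (mkₐ_sub_one_mem k hσ)]

theorem sub_truncatedPower_mem {σ₁ : R} {w : F} (h : τ = truncatedPower p σ w * σ₁) :
    σ₁ - truncatedPower p τ (1 : F) * truncatedPower p σ (-w) ∈ A ^ k := by
  rw [← Ideal.Quotient.mk_eq_mk_iff_sub_mem]
  change Ideal.Quotient.mkₐ F (A ^ k) _ = Ideal.Quotient.mkₐ F (A ^ k) _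
  have hI := map_mk_pow_eq_bot (F := F) A k
  have h1 : truncatedPower p (Ideal.Quotient.mkₐ F (A ^ k) σ) w *
      truncatedPower p (Ideal.Quotient.mkₐ F (A ^ k) σ) (-w) = 1 := by
    rw [← truncatedPower_add hk hI (mkₐ_sub_one_mem k hσ), add_neg_cancel, truncatedPower_zero]
  rw [map_mul, map_truncatedPower, map_truncatedPower,
    truncatedPower_one hk hI (mkₐ_sub_one_mem k hτ), h, map_mul, map_truncatedPower]
  linear_combination -Ideal.Quotient.mkₐ F (A ^ k) σ₁ * h1

omit hτ in
theorem right_sub_truncatedPower_mem (τ : R) :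
    σ - truncatedPower p τ (0 : F) * truncatedPower p σ (1 : F) ∈ A ^ k := by
  rw [← Ideal.Quotient.mk_eq_mk_iff_sub_mem]
  change Ideal.Quotient.mkₐ F (A ^ k) _ = Ideal.Quotient.mkₐ F (A ^ k) _
  rw [map_mul, map_truncatedPower, map_truncatedPower,
    truncatedPower_one hk (map_mk_pow_eq_bot (F := F) A k) (mkₐ_sub_one_mem k hσ),
    truncatedPower_zero, one_mul]

end Quotient

end CommutativeModel

section GroupRing

variable {F K L : Type*} [Field F] [Field K] [Field L] [Algebra F K] [Algebra K L]

/-- The group ring of a commutative Galois group as a commutative ring. -/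
noncomputable abbrev galCommRing (F : Type*) [Field F]
    (hcomm : ∀ σ τ : L ≃ₐ[K] L, σ * τ = τ * σ) : CommRing (MonoidAlgebra F (L ≃ₐ[K] L)) :=
  { (inferInstance : Ring (MonoidAlgebra F (L ≃ₐ[K] L))) with
    mul_comm := fun a b => by
      induction a using MonoidAlgebra.induction_linear with
      | zero => rw [zero_mul, mul_zero]
      | add x y hx hy => rw [add_mul, mul_add, hx, hy]
      | single σ c =>
        induction b using MonoidAlgebra.induction_linear with
        | zero => rw [zero_mul, mul_zero]
        | add x y hx hy => rw [add_mul, mul_add, hx, hy]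
        | single τ d =>
          rw [MonoidAlgebra.single_mul_single, MonoidAlgebra.single_mul_single, hcomm, mul_comm] }

omit [Algebra F K] in
theorem truncPow_eq (p : ℕ) (γ : GalRing F K L) (w : F) :
    truncPow p γ w = truncatedPower p γ w := rfl

omit [Algebra F K] in
theorem GalQuot.mk_mul (k : ℕ) (x y : GalRing F K L) :
    GalQuot.mk k (x * y) = GalQuot.mk k x * GalQuot.mk k y :=
  map_mul (Ideal.Quotient.mk ((augIdeal F K L) ^ k)) x y

omit [Algebra F K] in
theorem GalQuot.mk_sub (k : ℕ) (x y : GalRing F K L) :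
    GalQuot.mk k (x - y) = GalQuot.mk k x - GalQuot.mk k y :=
  map_sub (Ideal.Quotient.mk ((augIdeal F K L) ^ k)) x y

omit [Algebra F K] in
theorem GalQuot.mk_one (k : ℕ) : GalQuot.mk k (1 : GalRing F K L) = 1 :=
  map_one (Ideal.Quotient.mk ((augIdeal F K L) ^ k))

omit [Algebra F K] in
theorem GalQuot.mk_eq_iff {k : ℕ} {x y : GalRing F K L} :
    GalQuot.mk k x = GalQuot.mk k y ↔ x - y ∈ (augIdeal F K L) ^ k :=
  Ideal.Quotient.mk_eq_mk_iff_sub_mem x y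

omit [Algebra F K] in
theorem of_sub_one_mem_augIdeal (σ : L ≃ₐ[K] L) :
    MonoidAlgebra.of F (L ≃ₐ[K] L) σ - 1 ∈ augIdeal F K L := by
  rw [RingHom.mem_ker, map_sub, MonoidAlgebra.lift_of, MonoidHom.one_apply, sub_eq_zero]
  exact (map_one (MonoidAlgebra.lift F F (L ≃ₐ[K] L) (1 : (L ≃ₐ[K] L) →* F))).symm

omit [Algebra F K] in
theorem eq_zero_of_algebraMap_mem_augIdeal (c : F)
    (h : algebraMap F (GalRing F K L) c ∈ augIdeal F K L) : c = 0 := by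
  rw [RingHom.mem_ker] at h
  exact (AlgHom.commutes _ c).symm.trans h

omit [Algebra F K] in
theorem adjoin_of_eq_top {σ₁ σ₂ : L ≃ₐ[K] L} (hgen : ∀ σ, ∃ i j : ℕ, σ = σ₁ ^ i * σ₂ ^ j) :
    Algebra.adjoin F {MonoidAlgebra.of F (L ≃ₐ[K] L) σ₁, MonoidAlgebra.of F (L ≃ₐ[K] L) σ₂}
      = ⊤ := by
  rw [eq_top_iff]
  intro r _
  induction r using MonoidAlgebra.induction_linear with
  | zero => exact zero_mem _
  | add x y hx hy => exact add_mem (hx trivial) (hy trivial)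
  | single σ c =>
    obtain ⟨i, j, rfl⟩ := hgen σ
    have h : MonoidAlgebra.single (σ₁ ^ i * σ₂ ^ j) c
        = c • (MonoidAlgebra.of F (L ≃ₐ[K] L) σ₁ ^ i * MonoidAlgebra.of F (L ≃ₐ[K] L) σ₂ ^ j) := by
      rw [← map_pow, ← map_pow, ← map_mul, MonoidAlgebra.of_apply, MonoidAlgebra.smul_single,
        smul_eq_mul, mul_one]
    rw [h]
    exact Subalgebra.smul_mem _ (mul_mem (pow_mem (Algebra.subset_adjoin (by simp)) _)
      (pow_mem (Algebra.subset_adjoin (by simp)) _)) c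

/-- The element `σ₁ σ₂^[w]` of the group ring. -/
noncomputable def scaffoldElement (p : ℕ) (w : F) (σ₁ σ₂ : L ≃ₐ[K] L) : GalRing F K L :=
  truncPow p (MonoidAlgebra.of F (L ≃ₐ[K] L) σ₂) w * MonoidAlgebra.of F (L ≃ₐ[K] L) σ₁

variable {p : ℕ} [Fact p.Prime] (hcomm : ∀ σ τ : L ≃ₐ[K] L, σ * τ = τ * σ)
include hcomm

omit [Algebra F K] in
theorem scaffoldElement_sub_one_mem (w : F) (σ₁ σ₂ : L ≃ₐ[K] L) :
    scaffoldElement p w σ₁ σ₂ - 1 ∈ augIdeal F K L := by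
  let _ := galCommRing F hcomm
  exact mul_sub_one_mem (truncatedPower_sub_one_mem (p := p) (of_sub_one_mem_augIdeal σ₂) w)
    (of_sub_one_mem_augIdeal σ₁)

variable [CharP F p]

omit [Algebra F K] in
/-- Every element of the `F`-span of the Galois group is the class of some `τ^[u] σ₂^[v]`, where
`τ = σ₁ σ₂^[w]`. -/
theorem InGalSpan.exists_eq {σ₁ σ₂ : L ≃ₐ[K] L} (hgen : ∀ σ, ∃ i j : ℕ, σ = σ₁ ^ i * σ₂ ^ j)
    {k : ℕ} (hk : k ≤ p) (w : F) {g : GalQuot F K L k} (hg : InGalSpan p k g) :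
    ∃ u v : F, g = GalQuot.mk k (truncPow p (scaffoldElement p w σ₁ σ₂) u *
      truncPow p (MonoidAlgebra.of F (L ≃ₐ[K] L) σ₂) v) := by
  let _ := galCommRing F hcomm
  have hτ := scaffoldElement_sub_one_mem (p := p) (F := F) hcomm w σ₁ σ₂
  have hσ := of_sub_one_mem_augIdeal (F := F) σ₂
  have hmul : ∀ {x y : GalQuot F K L k}, (∃ u v : F, x = GalQuot.mk k
      (truncPow p (scaffoldElement p w σ₁ σ₂) u *
        truncPow p (MonoidAlgebra.of F (L ≃ₐ[K] L) σ₂) v)) →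
      (∃ u v : F, y = GalQuot.mk k (truncPow p (scaffoldElement p w σ₁ σ₂) u *
        truncPow p (MonoidAlgebra.of F (L ≃ₐ[K] L) σ₂) v)) →
      ∃ u v : F, x * y = GalQuot.mk k (truncPow p (scaffoldElement p w σ₁ σ₂) u *
        truncPow p (MonoidAlgebra.of F (L ≃ₐ[K] L) σ₂) v) := by
    rintro _ _ ⟨u, v, rfl⟩ ⟨u', v', rfl⟩
    refine ⟨u + u', v + v', ?_⟩
    rw [← GalQuot.mk_mul, GalQuot.mk_eq_iff]
    exact truncatedPower_mul_mem (A := augIdeal F K L) hk hτ hσ u v u' v'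
  induction hg with
  | of σ =>
    have h1 : ∃ u v : F, GalQuot.mk k (1 : GalRing F K L) = GalQuot.mk k
        (truncPow p (scaffoldElement p w σ₁ σ₂) u *
          truncPow p (MonoidAlgebra.of F (L ≃ₐ[K] L) σ₂) v) :=
      ⟨0, 0, congrArg (GalQuot.mk k) (by
        rw [truncPow_eq, truncPow_eq]
        exact ((congrArg₂ (· * ·) (truncatedPower_zero (p := p) _)
          (truncatedPower_zero (p := p) _)).trans (mul_one 1)).symm)⟩
    have hpow : ∀ (x : GalRing F K L), (∃ u v : F, GalQuot.mk k x = GalQuot.mk k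
        (truncPow p (scaffoldElement p w σ₁ σ₂) u *
          truncPow p (MonoidAlgebra.of F (L ≃ₐ[K] L) σ₂) v)) → ∀ n : ℕ,
        ∃ u v : F, GalQuot.mk k (x ^ n) = GalQuot.mk k (truncPow p (scaffoldElement p w σ₁ σ₂) u *
          truncPow p (MonoidAlgebra.of F (L ≃ₐ[K] L) σ₂) v) := by
      intro x hx n
      induction n with
      | zero => rw [pow_zero]; exact h1
      | succ n ih => rw [pow_succ, GalQuot.mk_mul]; exact hmul ih hx
    obtain ⟨i, j, rfl⟩ := hgen σ
    rw [map_mul, map_pow, map_pow, GalQuot.mk_mul]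
    exact hmul
      (hpow _ ⟨1, -w, GalQuot.mk_eq_iff.2
        (sub_truncatedPower_mem (A := augIdeal F K L) hk hτ hσ rfl)⟩ i)
      (hpow _ ⟨0, 1, GalQuot.mk_eq_iff.2
        (right_sub_truncatedPower_mem (A := augIdeal F K L) hk hσ _)⟩ j)
  | mul _ _ hx hy => exact hmul hx hy
  | pow γ c _ ih =>
    obtain ⟨u, v, huv⟩ := ih
    exact ⟨u * c, v * c, GalQuot.mk_eq_iff.2 (truncatedPower_truncatedPower_mem
      (A := augIdeal F K L) hk hτ hσ (GalQuot.mk_eq_iff.1 huv) c)⟩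

omit [Algebra F K] [CharP F p] in
theorem exists_mul_of_truncPow (γ : GalRing F K L) (u : F) :
    ∃ r : GalRing F K L, truncPow p γ u - 1 = (γ - 1) * r := by
  let _ := galCommRing F hcomm
  exact truncatedPower_sub_one_eq_mul γ u

omit [Algebra F K] [CharP F p] in
theorem truncPow_zero (γ : GalRing F K L) : truncPow p γ 0 = 1 := by
  let _ := galCommRing F hcomm
  exact truncatedPower_zero γ

omit [Algebra F K] [CharP F p] in
theorem exists_truncPow_mul_sub_one (w : F) (σ₁ σ₂ : L ≃ₐ[K] L) (u v : F) :
    ∃ a ∈ (augIdeal F K L) ^ 2, truncPow p (scaffoldElement p w σ₁ σ₂) u *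
      truncPow p (MonoidAlgebra.of F (L ≃ₐ[K] L) σ₂) v - 1
        = v • (MonoidAlgebra.of F (L ≃ₐ[K] L) σ₂ - 1)
          + u • (scaffoldElement p w σ₁ σ₂ - 1) + a := by
  let _ := galCommRing F hcomm
  exact truncatedPower_mul_sub_one (A := augIdeal F K L)
    (scaffoldElement_sub_one_mem (p := p) (F := F) hcomm w σ₁ σ₂) (of_sub_one_mem_augIdeal σ₂) u v

open Polynomial in
omit [Algebra F K] in
/-- The augmentation ideal `A` and its square in terms of `Ψ = σ₂ - 1` and `Θ = σ₁ σ₂^[w] - 1`. -/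
theorem augIdeal_normal_form {σ₁ σ₂ : L ≃ₐ[K] L} (hgen : ∀ σ, ∃ i j : ℕ, σ = σ₁ ^ i * σ₂ ^ j)
    (hσ₂ : σ₂ ^ p = 1) (w : F) :
    (∀ a ∈ augIdeal F K L, ∃ (f : F[X]) (r : GalRing F K L),
      a = (MonoidAlgebra.of F (L ≃ₐ[K] L) σ₂ - 1) *
        aeval (MonoidAlgebra.of F (L ≃ₐ[K] L) σ₂ - 1) f + (scaffoldElement p w σ₁ σ₂ - 1) * r) ∧
    (∀ a ∈ (augIdeal F K L) ^ 2, ∃ (f : F[X]) (r : GalRing F K L), r ∈ augIdeal F K L ∧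
      a = (MonoidAlgebra.of F (L ≃ₐ[K] L) σ₂ - 1) ^ 2 *
        aeval (MonoidAlgebra.of F (L ≃ₐ[K] L) σ₂ - 1) f + (scaffoldElement p w σ₁ σ₂ - 1) * r) := by
  let _ := galCommRing F hcomm
  have : CharP (GalRing F K L) p :=
    charP_of_injective_algebraMap (algebraMap F (GalRing F K L)).injective p
  have h0 : (MonoidAlgebra.of F (L ≃ₐ[K] L) σ₂ - 1) ^ p = 0 := by
    rw [sub_pow_char_of_commute p (Commute.one_right _), ← map_pow, hσ₂, map_one, one_pow, sub_self]
  have hgen' : ∀ r : GalRing F K L, ∃ (f : F[X]) (r' : GalRing F K L),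
      r = aeval (MonoidAlgebra.of F (L ≃ₐ[K] L) σ₂ - 1) f + (scaffoldElement p w σ₁ σ₂ - 1) * r' :=
    exists_aeval_add_mul h0 (adjoin_of_eq_top hgen) w
  have hτ := scaffoldElement_sub_one_mem (p := p) (F := F) hcomm w σ₁ σ₂
  have hσ := of_sub_one_mem_augIdeal (F := F) σ₂
  exact ⟨fun a ha => exists_eq_of_mem hσ hτ eq_zero_of_algebraMap_mem_augIdeal hgen' ha,
    fun a ha => exists_eq_of_mem_sq hσ hτ eq_zero_of_algebraMap_mem_augIdeal hgen' ha⟩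

end GroupRing

/-! ### The action of the group ring on valuations -/

section Action

variable {F K L : Type*} [Field F] [Field K] [Algebra F K] [Field L] [Algebra K L]

/-- The action of `F[G]` on `L` as a ring homomorphism to the `K`-linear endomorphisms of `L`. -/
noncomputable def galActHom : GalRing F K L →+* Module.End K L :=
  MonoidAlgebra.liftNCRingHom ((algebraMap K (Module.End K L)).comp (algebraMap F K))
    (AlgEquiv.toLinearMapHom K L) fun c _ =>
      Algebra.commute_algebraMap_left (algebraMap F K c) _

theorem galActHom_single (σ : L ≃ₐ[K] L) (c : F) (x : L) :
    galActHom (MonoidAlgebra.single σ c) x = algebraMap K L (algebraMap F K c) * σ x := by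
  rw [galActHom, MonoidAlgebra.liftNCRingHom_single, Module.End.mul_apply, RingHom.comp_apply,
    Module.algebraMap_end_apply, Algebra.smul_def]
  rfl

theorem galActHom_of (σ : L ≃ₐ[K] L) :
    galActHom (MonoidAlgebra.of F (L ≃ₐ[K] L) σ) = σ.toLinearMap := by
  ext x
  rw [MonoidAlgebra.of_apply, galActHom_single]
  simp

theorem galActHom_smul (c : F) (γ : GalRing F K L) :
    galActHom (c • γ) = algebraMap F K c • galActHom γ := by
  have h : c • γ = MonoidAlgebra.single 1 c * γ := by
    rw [← one_mul γ, ← smul_mul_assoc, one_mul, MonoidAlgebra.one_def, MonoidAlgebra.smul_single,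
      smul_eq_mul, mul_one]
  ext x
  rw [h, map_mul, Module.End.mul_apply, galActHom_single, LinearMap.smul_apply, Algebra.smul_def]
  rfl

theorem galAct_eq (γ : GalRing F K L) (x : L) : galAct γ x = galActHom γ x := by
  induction γ using MonoidAlgebra.induction_linear with
  | zero => simp [galAct]
  | add γ δ hγ hδ =>
    rw [map_add, LinearMap.add_apply, ← hγ, ← hδ, galAct, MonoidAlgebra.coeff_add,
      Finsupp.sum_add_index']
    · rfl
    · simp
    · intro σ c d
      rw [map_add, map_add, add_mul]
  | single σ c =>
    rw [galActHom_single, galAct, MonoidAlgebra.coeff_single, Finsupp.sum_single_index]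
    simp

theorem galActHom_scaffoldElement (p : ℕ) (w : F) (σ₁ σ₂ : L ≃ₐ[K] L) :
    galActHom (scaffoldElement p w σ₁ σ₂) = scaffoldOperator p w σ₁ σ₂ := by
  rw [scaffoldElement, scaffoldOperator, map_mul, galActHom_of, truncPow, map_sum]
  congr 1
  refine Finset.sum_congr rfl fun i _ => ?_
  rw [galActHom_smul, map_pow, map_sub, galActHom_of, map_one]

variable {p : ℕ} {vK : AddValuation K (WithTop ℤ)} {vL : AddValuation L (WithTop ℤ)} {b s : ℤ}

theorem le_val_coeff_mul (hK : IsLocalFieldOver F vK) {n : ℕ}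
    (hL : IsOneBreakExtension p n vK vL b) (c : F) {x : L} {m : ℤ} (hx : (m : WithTop ℤ) ≤ vL x) :
    (m : WithTop ℤ) ≤ vL (algebraMap K L (algebraMap F K c) * x) := by
  simpa using le_val_mul (hL.le_val_algebraMap (m := 0) (hK.coeff_integral c)) hx

theorem val_coeff_mul (hK : IsLocalFieldOver F vK) {n : ℕ}
    (hL : IsOneBreakExtension p n vK vL b) {c : F} (hc : c ≠ 0) {x : L} {m : ℤ}
    (hx : vL x = (m : WithTop ℤ)) :
    vL (algebraMap K L (algebraMap F K c) * x) = (m : WithTop ℤ) := by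
  have h := val_mul_eq (hL.val_algebraMap (hK.val_coeff_eq_zero hc)) hx
  rwa [mul_zero, zero_add] at h

variable [Fact p.Prime] [CharP K p]

theorem le_val_galActHom (hK : IsLocalFieldOver F vK) (hL : IsOneBreakExtension p 2 vK vL b)
    (hb : 0 < b) (γ : GalRing F K L) {x : L} {m : ℤ} (hx : (m : WithTop ℤ) ≤ vL x) :
    (m : WithTop ℤ) ≤ vL (galActHom γ x) := by
  induction γ using MonoidAlgebra.induction_linear with
  | zero => simp
  | add γ δ hγ hδ =>
    rw [map_add, LinearMap.add_apply]
    exact AddValuation.map_le_add vL hγ hδ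
  | single σ c =>
    rw [galActHom_single]
    exact le_val_coeff_mul hK hL c (hL.le_val_gal hb σ hx)

section Scaffold

variable (hK : IsLocalFieldOver F vK) (hL : IsOneBreakExtension p 2 vK vL b)
  {x₁ X μ : L} {w : F} {σ₁ σ₂ : L ≃ₐ[K] L} (hS : IsScaffold p vL b s x₁ X μ w σ₁ σ₂)
  (hgen : ∀ σ : L ≃ₐ[K] L, ∃ i j : ℕ, σ = σ₁ ^ i * σ₂ ^ j)
include hL hS

omit hL [Fact p.Prime] [CharP K p] in
theorem IsScaffold.ne_one : σ₂ ≠ 1 := by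
  rintro rfl
  have h := hS.map₂_X
  simp at h

omit hL [CharP K p] in
theorem IsScaffold.lt : b < s := by
  have hp1 : (1 : ℤ) < p := by exact_mod_cast (Fact.out : p.Prime).one_lt
  rcases hS.val_μ with ⟨h, -⟩ | ⟨h, -⟩
  · rw [h]; nlinarith [hS.pos]
  · exact h

theorem IsScaffold.le_val_psi {x : L} {m : ℤ} (hx : (m : WithTop ℤ) ≤ vL x) :
    ((m + b : ℤ) : WithTop ℤ) ≤
      vL (galActHom (MonoidAlgebra.of F (L ≃ₐ[K] L) σ₂ - 1) x) := by
  rw [map_sub, galActHom_of, map_one]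
  exact hL.le_val_gal_sub hS.pos σ₂ hx

theorem IsScaffold.le_val_theta {x : L} {m : ℤ} (hx : (m : WithTop ℤ) ≤ vL x) :
    ((m + s : ℤ) : WithTop ℤ) ≤ vL (galActHom (scaffoldElement p w σ₁ σ₂ - 1) x) := by
  by_cases h0 : x = 0
  · simp [h0]
  obtain ⟨n, hn⟩ := exists_val_eq vL h0
  rw [map_sub, galActHom_scaffoldElement, map_one]
  exact le_val_of_le (hS.val_scaffoldOperator_sub hL hn).1 (by linarith [le_of_le_val hn hx])

theorem IsScaffold.val_theta {x : L} {m : ℤ} (hx : vL x = (m : WithTop ℤ))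
    (hm : (p : ℤ) ^ 2 ∣ m - b) :
    vL (galActHom (scaffoldElement p w σ₁ σ₂ - 1) x) = ((m + s : ℤ) : WithTop ℤ) := by
  rw [map_sub, galActHom_scaffoldElement, map_one]
  exact (hS.val_scaffoldOperator_sub hL hx).2 hm

/-- On a valuation criterion element, `(σ₂ - 1) ^ i` raises the valuation by `i b`. -/
theorem IsScaffold.val_psi_pow {x : L} {m : ℤ} (hx : vL x = (m : WithTop ℤ))
    (hm : (p : ℤ) ^ 2 ∣ m - b) {i : ℕ} (hi : i < p) :
    vL (galActHom ((MonoidAlgebra.of F (L ≃ₐ[K] L) σ₂ - 1) ^ i) x)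
      = ((m + i * b : ℤ) : WithTop ℤ) := by
  rw [map_pow, map_sub, galActHom_of, map_one]
  refine hL.val_gal_sub_pow hS.pos hS.ne_one hx i fun j hj hdvd => ?_
  have h1 : (p : ℤ) ∣ m - b := dvd_trans (dvd_pow_self _ two_ne_zero) hm
  have h2 : (p : ℤ) ∣ ((j + 1 : ℕ) : ℤ) * b := by
    refine dvd_trans (dvd_sub hdvd h1) (dvd_of_eq ?_)
    push_cast; ring
  rcases (Nat.prime_iff_prime_int.1 (Fact.out : p.Prime)).dvd_or_dvd h2 with h3 | h3
  · exact Nat.not_dvd_of_pos_of_lt (Nat.succ_pos j) (by omega) (Int.natCast_dvd_natCast.1 h3)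
  · exact hS.not_dvd h3

include hK hgen

theorem IsScaffold.le_val_of_mem {a : GalRing F K L} (ha : a ∈ augIdeal F K L) {x : L} {m : ℤ}
    (hx : (m : WithTop ℤ) ≤ vL x) : ((m + b : ℤ) : WithTop ℤ) ≤ vL (galActHom a x) := by
  have : CharP F p := (algebraMap F K).charP (algebraMap F K).injective p
  obtain ⟨f, r, rfl⟩ := (augIdeal_normal_form hL.gal_commute hgen (hL.pow_eq_one σ₂) w).1 a ha
  rw [map_add, map_mul, map_mul, LinearMap.add_apply, Module.End.mul_apply, Module.End.mul_apply]
  exact AddValuation.map_le_add vL (hS.le_val_psi hL (le_val_galActHom hK hL hS.pos _ hx))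
    (le_val_of_le (hS.le_val_theta hL (le_val_galActHom hK hL hS.pos _ hx)) (by linarith [hS.lt]))

/-- Since `A ^ 2` raises valuations by more than `b`, it can be neglected when the linear term
`v (σ₂ - 1)` is present. -/
theorem IsScaffold.le_val_of_mem_sq {a : GalRing F K L} (ha : a ∈ (augIdeal F K L) ^ 2) {x : L}
    {m : ℤ} (hx : (m : WithTop ℤ) ≤ vL x) :
    ((m + b + 1 : ℤ) : WithTop ℤ) ≤ vL (galActHom a x) := by
  have : CharP F p := (algebraMap F K).charP (algebraMap F K).injective p
  obtain ⟨f, r, hr, rfl⟩ := (augIdeal_normal_form hL.gal_commute hgen (hL.pow_eq_one σ₂) w).2 a ha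
  have hb := hS.pos
  rw [map_add, map_mul, map_mul, pow_two, map_mul, LinearMap.add_apply, Module.End.mul_apply,
    Module.End.mul_apply, Module.End.mul_apply]
  exact AddValuation.map_le_add vL
    (le_val_of_le (hS.le_val_psi hL (hS.le_val_psi hL (le_val_galActHom hK hL hb _ hx)))
      (by linarith))
    (le_val_of_le (hS.le_val_theta hL (le_val_galActHom hK hL hb _ hx)) (by linarith [hS.lt]))

omit hgen in
/-- A polynomial in `σ₂ - 1` without terms of degree less than two raises the valuation of a
valuation criterion element by a number of the form `i b` with `2 ≤ i < p`, and `s` is not of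
this form. -/
theorem IsScaffold.val_psi_sq_mul_aeval_ne (f : Polynomial F) {x : L} {m : ℤ}
    (hx : vL x = (m : WithTop ℤ)) (hm : (p : ℤ) ^ 2 ∣ m - b) :
    vL (galActHom ((MonoidAlgebra.of F (L ≃ₐ[K] L) σ₂ - 1) ^ 2 *
      Polynomial.aeval (MonoidAlgebra.of F (L ≃ₐ[K] L) σ₂ - 1) f) x)
        ≠ ((m + s : ℤ) : WithTop ℤ) := by
  set Ψ := MonoidAlgebra.of F (L ≃ₐ[K] L) σ₂ - 1 with hΨ
  have hp := (Fact.out : p.Prime)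
  have hb := hS.pos
  have hsum : galActHom (Ψ ^ 2 * Polynomial.aeval Ψ f) x
      = ∑ i : Fin (f.natDegree + 1),
        algebraMap K L (algebraMap F K (f.coeff i)) * galActHom (Ψ ^ ((i : ℕ) + 2)) x := by
    rw [Polynomial.aeval_eq_sum_range, Finset.mul_sum, map_sum, LinearMap.sum_apply,
      ← Fin.sum_univ_eq_sum_range
        (fun i => (galActHom (Ψ ^ 2 * f.coeff i • Ψ ^ i)) x) (f.natDegree + 1)]
    refine Finset.sum_congr rfl fun i _ => ?_
    rw [mul_smul_comm, ← pow_add, add_comm 2, galActHom_smul, LinearMap.smul_apply,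
      Algebra.smul_def]
  have hterm : ∀ i : ℕ,
      algebraMap K L (algebraMap F K (f.coeff i)) * galActHom (Ψ ^ (i + 2)) x ≠ 0 →
        i + 2 < p ∧ vL (algebraMap K L (algebraMap F K (f.coeff i)) * galActHom (Ψ ^ (i + 2)) x)
          = ((m + (i + 2 : ℕ) * b : ℤ) : WithTop ℤ) := by
    intro i hi
    have hip : i + 2 < p := by
      by_contra! hle
      apply hi
      have h0 : galActHom (Ψ ^ p) = 0 := by
        rw [map_pow, hΨ, map_sub, galActHom_of, map_one, hL.gal_sub_one_pow_eq_zero]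
      rw [← Nat.add_sub_cancel' hle, pow_add, map_mul, h0, zero_mul, LinearMap.zero_apply, mul_zero]
    refine ⟨hip, val_coeff_mul hK hL ?_ (hS.val_psi_pow hL hx hm hip)⟩
    intro h0
    simp [h0] at hi
  intro heq
  rw [hsum] at heq
  obtain ⟨i, hi, hv, -⟩ := exists_val_sum_eq (v := vL)
    (fun i : Fin (f.natDegree + 1) =>
      algebraMap K L (algebraMap F K (f.coeff i)) * galActHom (Ψ ^ ((i : ℕ) + 2)) x)
    (by
      intro i j hij hi h
      have h1 := (hterm i hi).2
      have hj : algebraMap K L (algebraMap F K (f.coeff j)) * galActHom (Ψ ^ ((j : ℕ) + 2)) x ≠ 0 :=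
        ne_zero_of_val_eq (h ▸ h1)
      have h2 := val_unique (hterm j hj).2 (h ▸ h1)
      have h3 : (((i : ℕ) + 2 : ℕ) : ℤ) = ((j : ℕ) + 2 : ℕ) :=
        mul_right_cancel₀ hb.ne' (by linarith)
      exact hij (Fin.ext (by omega)))
    (by
      by_contra! h0
      rw [Finset.sum_eq_zero fun i _ => h0 i, AddValuation.map_zero] at heq
      exact WithTop.top_ne_coe heq)
  obtain ⟨hip, h1⟩ := hterm i hi
  have h2 : s = ((i : ℕ) + 2 : ℕ) * b := by linarith [val_unique (hv ▸ h1) heq]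
  rcases hS.val_μ with ⟨h3, -⟩ | ⟨-, -, h3, -⟩
  · have h4 : (p : ℤ) = ((i : ℕ) + 2 : ℕ) := mul_right_cancel₀ hb.ne' (by linarith)
    have h5 : p = (i : ℕ) + 2 := by exact_mod_cast h4
    omega
  · have h4 : (p : ℤ) ∣ (((i : ℕ) + 1 : ℕ) : ℤ) * b := by
      refine dvd_trans h3 (dvd_of_eq ?_)
      rw [h2]; push_cast; ring
    rcases (Nat.prime_iff_prime_int.1 hp).dvd_or_dvd h4 with h5 | h5
    · exact Nat.not_dvd_of_pos_of_lt (Nat.succ_pos i) (by omega) (Int.natCast_dvd_natCast.1 h5)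
    · exact hS.not_dvd h5

end Scaffold

end Action

/-! ### Refined breaks from the values of the classes in the span -/

section RefinedValue

variable {F K L : Type*} [Field F] [Field K] [Algebra F K] [Field L] [Algebra K L]
  {p k : ℕ} {vL : AddValuation L (WithTop ℤ)} {b d : ℤ}

/-- The class `g` has refined value `d`: some representative `γ` of `g` is such that `γ - 1` raises
all valuations by at least `d`, and no representative is such that `γ - 1` raises the valuation of
a valuation criterion element by more than `d`. Both kinds of refined breaks can be read off. -/
structure HasRefinedValue (p : ℕ) (vL : AddValuation L (WithTop ℤ)) (b : ℤ)
    (g : GalQuot F K L k) (d : ℤ) : Prop where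
  exists_le : ∃ γ : GalRing F K L, GalQuot.mk k γ = g ∧ ∀ (x : L) (m : ℤ),
    (m : WithTop ℤ) ≤ vL x → ((m + d : ℤ) : WithTop ℤ) ≤ vL (galAct (γ - 1) x)
  val_le : ∀ γ : GalRing F K L, GalQuot.mk k γ = g → ∀ (ρ : L) (m : ℤ),
    vL ρ = (m : WithTop ℤ) → (p : ℤ) ^ 2 ∣ m - b →
      vL (galAct (γ - 1) ρ) ≤ ((m + d : ℤ) : WithTop ℤ)

theorem HasRefinedValue.iRho_eq {g : GalQuot F K L k} (hg : HasRefinedValue p vL b g d) {ρ : L}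
    {m : ℤ} (hρ : vL ρ = (m : WithTop ℤ)) (hm : (p : ℤ) ^ 2 ∣ m - b) :
    iRho vL k ρ g = ((m + d : ℤ) : WithTop ℤ) := by
  obtain ⟨γ, hγ, hle⟩ := hg.exists_le
  refine IsGreatest.csSup_eq ⟨⟨γ, hγ, le_antisymm (hle ρ m hρ.ge) (hg.val_le γ hγ ρ m hρ hm)⟩, ?_⟩
  rintro _ ⟨γ', hγ', rfl⟩
  exact hg.val_le γ' hγ' ρ m hρ hm

theorem HasRefinedValue.ne_one {g : GalQuot F K L k} (hg : HasRefinedValue p vL b g d) {ρ : L}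
    {m : ℤ} (hρ : vL ρ = (m : WithTop ℤ)) (hm : (p : ℤ) ^ 2 ∣ m - b) : g ≠ 1 := by
  rintro rfl
  have h := hg.val_le 1 (GalQuot.mk_one k) ρ m hρ hm
  rw [sub_self, galAct_eq, map_zero, LinearMap.zero_apply, AddValuation.map_zero] at h
  exact absurd h (WithTop.coe_lt_top _).not_ge

theorem vHat_zero : vHat vL (0 : GalRing F K L) = ⊤ := by
  refine (congrArg sInf ?_).trans (csInf_singleton ⊤)
  ext d
  rw [Set.mem_singleton_iff]
  constructor
  · rintro ⟨x, hx, rfl⟩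
    obtain ⟨m, hm⟩ := exists_val_eq vL hx
    rw [galAct_eq, map_zero, LinearMap.zero_apply, AddValuation.map_zero, hm]
    exact WithTop.LinearOrderedAddCommGroup.top_sub _
  · rintro rfl
    refine ⟨1, one_ne_zero, ?_⟩
    rw [galAct_eq, map_zero, LinearMap.zero_apply, AddValuation.map_zero, AddValuation.map_one]
    exact (WithTop.LinearOrderedAddCommGroup.top_sub _).symm

theorem le_vHat {γ : GalRing F K L} (h : ∀ (x : L) (m : ℤ), (m : WithTop ℤ) ≤ vL x →
    ((m + d : ℤ) : WithTop ℤ) ≤ vL (galAct γ x)) : (d : WithTop ℤ) ≤ vHat vL γ := by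
  refine le_csInf ⟨_, 1, one_ne_zero, rfl⟩ ?_
  rintro _ ⟨x, hx, rfl⟩
  obtain ⟨m, hm⟩ := exists_val_eq vL hx
  have h1 := h x m hm.ge
  rw [hm]
  by_cases h0 : galAct γ x = 0
  · rw [h0, AddValuation.map_zero, WithTop.LinearOrderedAddCommGroup.top_sub]
    exact le_top
  · obtain ⟨n, hn⟩ := exists_val_eq vL h0
    rw [hn, ← WithTop.LinearOrderedAddCommGroup.coe_sub, WithTop.coe_le_coe]
    have h2 := le_of_le_val hn h1
    linarith

variable {vK : AddValuation K (WithTop ℤ)} [Fact p.Prime] [CharP K p]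

theorem vHat_le (hK : IsLocalFieldOver F vK) (hL : IsOneBreakExtension p 2 vK vL b) (hb : 0 < b)
    {γ : GalRing F K L} {ρ : L} {m : ℤ} (hρ : vL ρ = (m : WithTop ℤ))
    (h : vL (galAct γ ρ) ≤ ((m + d : ℤ) : WithTop ℤ)) : vHat vL γ ≤ (d : WithTop ℤ) := by
  have hbdd : BddBelow {d | ∃ x : L, x ≠ 0 ∧ d = vL (galAct γ x) - vL x} := by
    refine ⟨((0 : ℤ) : WithTop ℤ), ?_⟩
    rintro _ ⟨x, hx, rfl⟩
    obtain ⟨n, hn⟩ := exists_val_eq vL hx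
    have h1 := le_val_galActHom hK hL hb γ hn.ge
    rw [← galAct_eq] at h1
    by_cases h0 : galAct γ x = 0
    · rw [h0, AddValuation.map_zero, hn, WithTop.LinearOrderedAddCommGroup.top_sub]
      exact le_top
    · obtain ⟨n', hn'⟩ := exists_val_eq vL h0
      rw [hn', hn, ← WithTop.LinearOrderedAddCommGroup.coe_sub, WithTop.coe_le_coe]
      linarith [le_of_le_val hn' h1]
  refine (csInf_le hbdd ⟨ρ, ne_zero_of_val_eq hρ, rfl⟩).trans ?_
  have h0 : galAct γ ρ ≠ 0 := by
    intro h0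
    rw [h0, AddValuation.map_zero] at h
    exact absurd h (WithTop.coe_lt_top _).not_ge
  obtain ⟨n, hn⟩ := exists_val_eq vL h0
  rw [hn, WithTop.coe_le_coe] at h
  rw [hn, hρ, ← WithTop.LinearOrderedAddCommGroup.coe_sub, WithTop.coe_le_coe]
  linarith

theorem HasRefinedValue.vHatQuot_eq (hK : IsLocalFieldOver F vK)
    (hL : IsOneBreakExtension p 2 vK vL b) (hb : 0 < b) {g : GalQuot F K L k}
    (hg : HasRefinedValue p vL b g d) {ρ : L} {m : ℤ} (hρ : vL ρ = (m : WithTop ℤ))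
    (hm : (p : ℤ) ^ 2 ∣ m - b) : vHatQuot vL k (g - 1) = (d : WithTop ℤ) := by
  have hle : ∀ γ : GalRing F K L, GalQuot.mk k γ = g → vHat vL (γ - 1) ≤ (d : WithTop ℤ) :=
    fun γ hγ => vHat_le hK hL hb hρ (hg.val_le γ hγ ρ m hρ hm)
  obtain ⟨γ, hγ, h⟩ := hg.exists_le
  refine IsGreatest.csSup_eq ⟨⟨γ - 1, ?_, le_antisymm (le_vHat h) (hle γ hγ)⟩, ?_⟩
  · rw [GalQuot.mk_sub, hγ, GalQuot.mk_one]
  · rintro _ ⟨δ, hδ, rfl⟩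
    have h1 := hle (δ + 1) ((map_add (Ideal.Quotient.mk ((augIdeal F K L) ^ k)) δ 1).trans
      (eq_sub_iff_add_eq.1 hδ))
    rwa [add_sub_cancel_right] at h1

theorem vHatQuot_zero : vHatQuot vL k (0 : GalQuot F K L k) = ⊤ := by
  refine IsGreatest.csSup_eq ⟨⟨0, ?_, vHat_zero.symm⟩, fun _ _ => le_top⟩
  rw [← sub_self (1 : GalRing F K L), GalQuot.mk_sub, sub_self]

end RefinedValue

/-! ### The values of the classes in the span -/

section Span

variable {F K L : Type*} [Field F] [Field K] [Algebra F K] [Field L] [Algebra K L]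
  {p k : ℕ} [Fact p.Prime]
  {vK : AddValuation K (WithTop ℤ)} {vL : AddValuation L (WithTop ℤ)} {b s : ℤ}

omit [Algebra F K] in
/-- Representatives of the class of `τ^[u] σ₂^[v]`, where `τ = σ₁ σ₂^[w]`, to first order. -/
theorem IsOneBreakExtension.exists_sub_one_eq (hL : IsOneBreakExtension p 2 vK vL b) (w : F)
    (σ₁ σ₂ : L ≃ₐ[K] L) (hk : 2 ≤ k) {γ : GalRing F K L} {u v : F}
    (h : GalQuot.mk k γ = GalQuot.mk k (truncPow p (scaffoldElement p w σ₁ σ₂) u *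
      truncPow p (MonoidAlgebra.of F (L ≃ₐ[K] L) σ₂) v)) :
    ∃ a ∈ (augIdeal F K L) ^ 2, γ - 1 = v • (MonoidAlgebra.of F (L ≃ₐ[K] L) σ₂ - 1)
      + u • (scaffoldElement p w σ₁ σ₂ - 1) + a := by
  obtain ⟨a, ha, h1⟩ := exists_truncPow_mul_sub_one (p := p) (F := F) hL.gal_commute w σ₁ σ₂ u v
  refine ⟨_, add_mem ha (Ideal.pow_le_pow_right hk (GalQuot.mk_eq_iff.1 h)), ?_⟩
  rw [← add_assoc, ← h1]
  abel

variable [CharP K p] (hK : IsLocalFieldOver F vK) (hL : IsOneBreakExtension p 2 vK vL b)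
  {x₁ X μ : L} {w : F} {σ₁ σ₂ : L ≃ₐ[K] L} (hS : IsScaffold p vL b s x₁ X μ w σ₁ σ₂)
  (hgen : ∀ σ : L ≃ₐ[K] L, ∃ i j : ℕ, σ = σ₁ ^ i * σ₂ ^ j) (hk : 2 ≤ k)
include hK hL hS hgen hk

/-- If `v ≠ 0`, then `v (σ₂ - 1)` dominates in every representative of the class of
`τ^[u] σ₂^[v]`. -/
theorem IsScaffold.hasRefinedValue_of_ne_zero (u : F) {v : F} (hv : v ≠ 0) :
    HasRefinedValue p vL b (GalQuot.mk k (truncPow p (scaffoldElement p w σ₁ σ₂) u *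
      truncPow p (MonoidAlgebra.of F (L ≃ₐ[K] L) σ₂) v)) b := by
  have hbs := hS.lt
  constructor
  · refine ⟨_, rfl, fun x m hx => ?_⟩
    rw [galAct_eq]
    refine hS.le_val_of_mem hK hL hgen ?_ hx
    obtain ⟨a, ha, h1⟩ := exists_truncPow_mul_sub_one (p := p) (F := F) hL.gal_commute w σ₁ σ₂ u v
    rw [h1]
    exact add_mem (add_mem (Submodule.smul_of_tower_mem _ v (of_sub_one_mem_augIdeal σ₂))
      (Submodule.smul_of_tower_mem _ u (scaffoldElement_sub_one_mem hL.gal_commute w σ₁ σ₂)))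
      (Ideal.pow_le_self two_ne_zero ha)
  · intro γ hγ ρ m hρ hm
    obtain ⟨a, ha, h1⟩ := hL.exists_sub_one_eq w σ₁ σ₂ hk hγ
    have h2 := hS.val_psi_pow (F := F) hL hρ hm (i := 1) (Fact.out : p.Prime).one_lt
    rw [pow_one, Nat.cast_one, one_mul] at h2
    rw [galAct_eq, h1, add_assoc, map_add, map_add, galActHom_smul, galActHom_smul,
      LinearMap.add_apply, LinearMap.add_apply, LinearMap.smul_apply, LinearMap.smul_apply,
      Algebra.smul_def, Algebra.smul_def]
    refine (val_add_eq (val_coeff_mul hK hL hv h2) (n := m + b + 1)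
      (AddValuation.map_le_add vL (le_val_coeff_mul hK hL u
        (le_val_of_le (hS.le_val_theta hL hρ.ge) (by linarith)))
      (hS.le_val_of_mem_sq hK hL hgen ha hρ.ge)) (by linarith)).le

/-- If `u ≠ 0`, then `τ^[u] - 1` is a multiple of `Θ = τ - 1`, which gives the value `s`. A change
of representative contributes a term `Ψ ^ 2 f(Ψ)` with `Ψ = σ₂ - 1`; on a valuation criterion element
it cannot cancel the term `u Θ`, because it never has the same valuation. -/
theorem IsScaffold.hasRefinedValue_scaffoldElement {u : F} (hu : u ≠ 0) :
    HasRefinedValue p vL b (GalQuot.mk k (truncPow p (scaffoldElement p w σ₁ σ₂) u *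
      truncPow p (MonoidAlgebra.of F (L ≃ₐ[K] L) σ₂) 0)) s := by
  have : CharP F p := (algebraMap F K).charP (algebraMap F K).injective p
  have hb := hS.pos
  constructor
  · refine ⟨_, rfl, fun x m hx => ?_⟩
    obtain ⟨r, hr⟩ := exists_mul_of_truncPow (p := p) hL.gal_commute
      (scaffoldElement p w σ₁ σ₂) u
    rw [galAct_eq, truncPow_zero hL.gal_commute, mul_one, hr, map_mul, Module.End.mul_apply]
    exact hS.le_val_theta hL (le_val_galActHom hK hL hb r hx)
  · intro γ hγ ρ m hρ hm
    obtain ⟨a, ha, h1⟩ := hL.exists_sub_one_eq w σ₁ σ₂ hk hγ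
    obtain ⟨f, r, hr, rfl⟩ :=
      (augIdeal_normal_form hL.gal_commute hgen (hL.pow_eq_one σ₂) w).2 a ha
    rw [zero_smul, zero_add] at h1
    by_contra! hlt
    -- the terms divisible by `Θ` have value `m + s`, hence so has the remaining term
    apply hS.val_psi_sq_mul_aeval_ne hK hL f hρ hm
    set y := galActHom ((MonoidAlgebra.of F (L ≃ₐ[K] L) σ₂ - 1) ^ 2 *
      Polynomial.aeval (MonoidAlgebra.of F (L ≃ₐ[K] L) σ₂ - 1) f) ρ with hy
    have h2 : galAct (γ - 1) ρ = algebraMap K L (algebraMap F K u) *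
        galActHom (scaffoldElement p w σ₁ σ₂ - 1) ρ
          + galActHom (scaffoldElement p w σ₁ σ₂ - 1) (galActHom r ρ) + y := by
      rw [galAct_eq, h1, map_add, map_add, galActHom_smul, LinearMap.add_apply,
        LinearMap.add_apply, LinearMap.smul_apply, Algebra.smul_def, map_mul galActHom _ r,
        Module.End.mul_apply, hy]
      abel
    have h3 : vL (algebraMap K L (algebraMap F K u) *
        galActHom (scaffoldElement p w σ₁ σ₂ - 1) ρ
          + galActHom (scaffoldElement p w σ₁ σ₂ - 1) (galActHom r ρ))
        = ((m + s : ℤ) : WithTop ℤ) :=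
      val_add_eq (val_coeff_mul hK hL hu (hS.val_theta hL hρ hm))
        (hS.le_val_theta hL (hS.le_val_of_mem hK hL hgen hr hρ.ge)) (by linarith)
    have h4 : ((m + s + 1 : ℤ) : WithTop ℤ) ≤ vL (galAct (γ - 1) ρ) := by
      by_cases h0 : galAct (γ - 1) ρ = 0
      · rw [h0, AddValuation.map_zero]; exact le_top
      · obtain ⟨n, hn⟩ := exists_val_eq vL h0
        rw [hn, WithTop.coe_lt_coe] at hlt
        rw [hn, WithTop.coe_le_coe]
        exact hlt
    have h5 := val_sub_eq h3 h4 (by linarith)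
    rw [h2, sub_add_cancel_left] at h5
    rw [← h5, AddValuation.map_neg]

theorem IsScaffold.eq_one_or_hasRefinedValue (hkp : k ≤ p) {g : GalQuot F K L k}
    (hg : InGalSpan p k g) :
    g = 1 ∨ HasRefinedValue p vL b g b ∨ HasRefinedValue p vL b g s := by
  have : CharP F p := (algebraMap F K).charP (algebraMap F K).injective p
  obtain ⟨u, v, rfl⟩ := hg.exists_eq hL.gal_commute hgen hkp w
  by_cases hv : v = 0
  · subst hv
    by_cases hu : u = 0
    · left
      rw [hu, truncPow_zero hL.gal_commute, truncPow_zero hL.gal_commute, mul_one, GalQuot.mk_one]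
    · exact Or.inr (Or.inr (hS.hasRefinedValue_scaffoldElement hK hL hgen hk hu))
  · exact Or.inr (Or.inl (hS.hasRefinedValue_of_ne_zero hK hL hgen hk u hv))

theorem IsScaffold.exists_hasRefinedValue :
    (∃ g : GalQuot F K L k, InGalSpan p k g ∧ HasRefinedValue p vL b g b) ∧
      ∃ g : GalQuot F K L k, InGalSpan p k g ∧ HasRefinedValue p vL b g s := by
  have hτ : InGalSpan p k (GalQuot.mk k (scaffoldElement p w σ₁ σ₂)) := by
    rw [scaffoldElement, GalQuot.mk_mul]
    exact (InGalSpan.pow _ w (InGalSpan.of σ₂)).mul (InGalSpan.of σ₁)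
  have h : ∀ u v : F, InGalSpan p k (GalQuot.mk k (truncPow p (scaffoldElement p w σ₁ σ₂) u *
      truncPow p (MonoidAlgebra.of F (L ≃ₐ[K] L) σ₂) v)) := by
    intro u v
    rw [GalQuot.mk_mul]
    exact (InGalSpan.pow _ u hτ).mul (InGalSpan.pow _ v (InGalSpan.of σ₂))
  exact ⟨⟨_, h 0 1, hS.hasRefinedValue_of_ne_zero hK hL hgen hk 0 one_ne_zero⟩,
    ⟨_, h 1 0, hS.hasRefinedValue_scaffoldElement hK hL hgen hk one_ne_zero⟩⟩

omit hK hgen hk [Fact p.Prime] [CharP K p] in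
theorem IsScaffold.exists_val_eq_break : ∃ ρ : L, vL ρ = (b : WithTop ℤ) := by
  obtain ⟨π, hπ⟩ := hL.normalized
  refine ⟨π ^ b.toNat, ?_⟩
  rw [val_pow_eq (m := 1) hπ, mul_one, Int.toNat_of_nonneg hS.pos.le]

theorem IsScaffold.hasVCRefinedBreaks (hkp : k ≤ p) :
    HasVCRefinedBreaks F K p 2 vL b k {(b : WithTop ℤ), (s : WithTop ℤ)} := by
  obtain ⟨ρ₀, hρ₀⟩ := hS.exists_val_eq_break hL
  refine ⟨⟨ρ₀, b, hρ₀, rfl⟩, ?_⟩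
  rintro ρ ⟨m, hρ, hmod⟩
  have hm : (p : ℤ) ^ 2 ∣ m - b := hmod.symm.dvd
  have hval : ∀ (g : GalQuot F K L k) (d : ℤ), HasRefinedValue p vL b g d →
      iRho vL k ρ g - vL ρ = (d : WithTop ℤ) := by
    intro g d hg
    rw [hg.iRho_eq hρ hm, hρ, ← WithTop.LinearOrderedAddCommGroup.coe_sub, add_sub_cancel_left]
  obtain ⟨⟨g, hg, hgb⟩, ⟨g', hg', hgs⟩⟩ := hS.exists_hasRefinedValue hK hL hgen hk
  ext h
  constructor
  · rintro ⟨y, hy, hy1, rfl⟩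
    rcases hS.eq_one_or_hasRefinedValue hK hL hgen hk hkp hy with h1 | h1 | h1
    · exact absurd h1 hy1
    · exact Or.inl (hval y b h1)
    · exact Or.inr (hval y s h1)
  · rintro (rfl | rfl)
    · exact ⟨g, hg, hgb.ne_one hρ hm, (hval g b hgb).symm⟩
    · exact ⟨g', hg', hgs.ne_one hρ hm, (hval g' s hgs).symm⟩

theorem IsScaffold.ssRefinedBreaks_eq (hkp : k ≤ p) :
    ssRefinedBreaks F K p vL k = {(b : WithTop ℤ), (s : WithTop ℤ)} := by
  obtain ⟨ρ, hρ⟩ := hS.exists_val_eq_break hL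
  have hm : (p : ℤ) ^ 2 ∣ b - b := by simp
  have hb := hS.pos
  have hbs := hS.lt
  have hval : ∀ (g : GalQuot F K L k) (d : ℤ), HasRefinedValue p vL b g d →
      vHatQuot vL k (g - 1) = (d : WithTop ℤ) := fun g d hg => hg.vHatQuot_eq hK hL hb hρ hm
  obtain ⟨⟨g, hg, hgb⟩, ⟨g', hg', hgs⟩⟩ := hS.exists_hasRefinedValue hK hL hgen hk
  -- a class of refined value `d` lies in the `d`-th filtration step, but not in the next one
  have hbreak : ∀ (g : GalQuot F K L k) (d : ℤ), 0 ≤ d → InGalSpan p k g →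
      HasRefinedValue p vL b g d → (d : WithTop ℤ) ∈ ssRefinedBreaks F K p vL k := by
    intro g d hd hg hgd
    refine ⟨d.toNat, by rw [Int.toNat_of_nonneg hd], fun heq => ?_⟩
    have h1 : g ∈ galSpanFiltration F K p vL k d.toNat :=
      ⟨hg, by rw [hval g d hgd, Int.toNat_of_nonneg hd]⟩
    rw [← heq] at h1
    have h2 := h1.2
    rw [hval g d hgd, WithTop.coe_le_coe] at h2
    omega
  ext h
  constructor
  · rintro ⟨n, rfl, hne⟩
    by_contra hn
    rw [Set.mem_insert_iff, Set.mem_singleton_iff, WithTop.coe_inj, WithTop.coe_inj] at hn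
    apply hne
    ext y
    refine and_congr_right fun hy => ?_
    rcases hS.eq_one_or_hasRefinedValue hK hL hgen hk hkp hy with rfl | h1 | h1
    · rw [sub_self, vHatQuot_zero]
      exact iff_of_true le_top le_top
    · rw [hval y b h1, WithTop.coe_le_coe, WithTop.coe_le_coe]
      omega
    · rw [hval y s h1, WithTop.coe_le_coe, WithTop.coe_le_coe]
      omega
  · rintro (rfl | rfl)
    · exact hbreak g b hb.le hg hgb
    · exact hbreak g' s (hb.trans hbs).le hg' hgs

end Span

theorem mainTheorem6 {p : ℕ} [Fact p.Prime] {F K L : Type*}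
    [Field F] [PerfectField F] [Field K] [CharP K p] [Algebra F K] [Field L] [Algebra K L]
    (vK : AddValuation K (WithTop ℤ)) (vL : AddValuation L (WithTop ℤ))
    (hK : IsLocalFieldOver F vK)
    (b : ℤ) (hb : 0 < b) (hL : IsOneBreakExtension p 2 vK vL b)
    (β : K) (ω : Fin 2 → F) (ε : Fin 2 → K)
    (hAS : IsArtinSchreierData p 2 L vK b β ω ε) (hω : ω 0 = 1) (hε : ε 0 = 0)
    (k : ℕ) (hk2 : 2 ≤ k) (hkp : k ≤ p) :
    HasVCRefinedBreaks F K p 2 vL b k {(b : WithTop ℤ), bStar p vK b (ε 1)} ∧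
      ssRefinedBreaks F K p vL k = {(b : WithTop ℤ), bStar p vK b (ε 1)} := by
  obtain ⟨x₁, x₂, σ₁, σ₂, hG⟩ := hAS.exists_dualGenerators hL hω hε
  obtain ⟨X, μ, s, hX, hX₂, hX₁, hμ, hs, hv⟩ := hAS.exists_generator hK hb hL hG
  have hS : IsScaffold p vL b s x₁ X μ (ω 1 ^ p) σ₁ σ₂ :=
    { pos := hb
      not_dvd := hL.not_dvd_break hb
      val_x₁ := hL.val_artinSchreier_root hb hAS.val_beta hG.root₁
      val_X := hX
      map₁_x₁ := hG.map₁₁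
      map₂_x₁ := hG.map₂₁
      map₂_X := hX₂
      map₁_X := hX₁
      map₂_μ := hμ
      val_μ := hv }
  rw [hs]
  exact ⟨hS.hasVCRefinedBreaks hK hL hG.generate hk2 hkp,
    hS.ssRefinedBreaks_eq hK hL hG.generate hk2 hkp⟩
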